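/- Let $k$ be a field of characteristic $0$ and let $\mathfrak g$ be a finite-dimensional simple Lie algebra over $k$ with a splitting Cartan subalgebra $\mathfrak t$; let $\Phi$ be its root system and $\Delta$ a set of simple roots. For $\alpha_j\in\Delta$ let $m_j(\alpha)\in\mathbb Z$ be the coefficient of $\alpha_j$ in the root $\alpha$, and put $$\mathfrak m=\mathfrak t\oplus\bigoplus_{m_j(\alpha)=0}\mathfrak g_\alpha,\qquad \mathfrak n=\bigoplus_{m_j(\alpha)>0}\mathfrak g_\alpha,\qquad \bar{\mathfrak n}=\bigoplus_{m_j(\alpha)<0}\mathfrak g_\alpha .$$ Assume that $\mathfrak n$ is commutative and that $\mathfrak p=\mathfrak m+\mathfrak n$ is conjugate to $\bar{\mathfrak p}=\mathfrak m+\bar{\mathfrak n}$ by an element of $G(k)$, where $G$ is the split simply connected group with Lie algebra $\mathfrak g$. (The image of $G(k)$ in $\mathrm{Aut}(\mathfrak g)$ is the group generated by all $\exp(\mathrm{ad}\,x)$ with $x$ in a root space.) Let $S$ be a maximal set of strongly orthogonal roots $\beta$ with $\mathfrak g_\beta\subseteq\mathfrak n$; for each $\beta\in S$ let $(f_\beta,h_\beta,e_\beta)$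 be an $\mathfrak{sl}_2$-triple with $e_\beta\in\mathfrak g_\beta$ and $f_\beta\in\mathfrak g_{-\beta}$, and put $f=\sum_{\beta\in S} f_\beta$, $h=\sum_{\beta\in S} h_\beta$, $e=\sum_{\beta\in S} e_\beta$. Then $(f,h,e)$ is an $\mathfrak{sl}_2$-triple, and $x\circ y=\frac12[x,[f,y]]$ makes $J=\mathfrak n$ a Jordan algebra with identity $e$. Let $C$ be the centralizer of $(f,h,e)$ in $\mathrm{Aut}(\mathfrak g)$. Then: 1. $C$ preserves $\mathfrak n$, and restriction to $\mathfrak n$ is an isomorphism of groups $\iota: C\to\mathrm{Aut}(J)$. More precisely, $\iota$ is an isomorphism of group functors: for every commutative $k$-algebra $R$, restriction to $R\otimes_k\mathfrak n$ is an isomorphism $\iota_R$, natural in $R$, from the centralizer $C(R)$ of $(1\otimes f,1\otimes h,1\otimes e)$ in $\mathrm{Aut}_R(R\otimes_k\mathfrak g)$ onto $\mathrm{Aut}_R(R\otimes_k J)$. 2. (Kantor–Koecher–Tits construction of forms.) Let $K/k$ be a Galois extension (for instance an algebraic closure of $k$), and let $c$ be a continuous $1$-cocycle of $\mathrm{Gal}(K/k)$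 with values in $\mathrm{Aut}_K(K\otimes_k J)$. Then $\iota_K^{-1}\circ c$ is a continuous $1$-cocycle with values in $\mathrm{Aut}_K(K\otimes_k\mathfrak g)$. Let $J^c\subseteq K\otimes_k J$ and $\mathfrak g^c\subseteq K\otimes_k\mathfrak g$ be the fixed points of the twisted Galois actions $\sigma\mapsto c_\sigma\circ(\sigma\otimes1)$ and $\sigma\mapsto \iota_K^{-1}(c_\sigma)\circ(\sigma\otimes 1)$. Then $J^c$ is a $k$-form of $J$ and $\mathfrak g^c$ is a $k$-form of $\mathfrak g$. The form $\mathfrak g^c$ contains the triple $(f,h,e)$ and is the direct sum of the eigenspaces $\bar{\mathfrak n}^c,\mathfrak m^c,\mathfrak n^c$ of $\mathrm{ad}\,h$ with eigenvalues $-2,0,2$. The space $\mathfrak n^c$, with the multiplication $\frac12[x,[f,y]]$, is the algebra $J^c$. If $a\in\mathrm{Aut}_K(K\otimes_k J)$ exhibits two such cocycles $c,c'$ as cohomologous, that is, $c'_\sigma=a^{-1}c_\sigma\,\sigma(a)$ for all $\sigma$, then $\iota_K^{-1}(a)$ exhibits their images as cohomologous, and $a$ and $\iota_K^{-1}(a)$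 restrict to isomorphisms $J^{c'}\cong J^{c}$ and $\mathfrak g^{c'}\cong\mathfrak g^{c}$. -/

import Mathlib

open scoped TensorProduct

universe u v w

namespace KKT

noncomputable section

/-! ### Automorphism groups -/

/-- The group of `R`-linear automorphisms of the nonassociative algebra `(M, mul)`. -/
def algAut {R : Type*} {M : Type*} [CommRing R] [AddCommGroup M] [Module R M]
    (mul : M →ₗ[R] M →ₗ[R] M) : Subgroup (M ≃ₗ[R] M) where
  carrier := {g | ∀ x y, g (mul x y) = mul (g x) (g y)}
  mul_mem' := by
    intro a b ha hb x y
    rw [LinearEquiv.mul_apply, hb x y, ha]; rfl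
  one_mem' := by intro x y; rfl
  inv_mem' := by
    intro a ha x y
    apply a.injective
    have h (z : M) : a (a⁻¹ z) = z := a.apply_symm_apply z
    rw [ha, h, h, h]

/-- The group `Aut(L)` of `R`-linear automorphisms of the Lie algebra `L`. -/
def lieAut (R : Type*) (L : Type*) [CommRing R] [LieRing L] [LieAlgebra R L] :
    Subgroup (L ≃ₗ[R] L) where
  carrier := {g | ∀ x y, g ⁅x, y⁆ = ⁅g x, g y⁆}
  mul_mem' := by
    intro a b ha hb x y
    rw [LinearEquiv.mul_apply, hb x y, ha]; rfl
  one_mem' := by intro x y; rfl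
  inv_mem' := by
    intro a ha x y
    apply a.injective
    have h (z : L) : a (a⁻¹ z) = z := a.apply_symm_apply z
    rw [ha, h, h, h]

/-- The centralizer in `Aut(L)` of a triple `(f, h, e)` of elements of `L`. -/
def tripleCentralizer (R : Type*) {L : Type*} [CommRing R] [LieRing L] [LieAlgebra R L]
    (f h e : L) : Subgroup (L ≃ₗ[R] L) where
  carrier := {g | g ∈ lieAut R L ∧ g f = f ∧ g h = h ∧ g e = e}
  mul_mem' := by
    rintro a b ⟨ha, ha1, ha2, ha3⟩ ⟨hb, hb1, hb2, hb3⟩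
    refine ⟨mul_mem ha hb, ?_, ?_, ?_⟩ <;> simp [LinearEquiv.mul_apply, *]
  one_mem' := ⟨one_mem _, rfl, rfl, rfl⟩
  inv_mem' := by
    rintro a ⟨ha, ha1, ha2, ha3⟩
    have h (z : L) (hz : a z = z) : a⁻¹ z = z := by
      apply a.injective
      rw [hz]
      exact a.apply_symm_apply z
    exact ⟨inv_mem ha, h _ ha1, h _ ha2, h _ ha3⟩

theorem tripleCentralizer_le_lieAut (R : Type*) {L : Type*} [CommRing R] [LieRing L]
    [LieAlgebra R L] (f h e : L) : tripleCentralizer R f h e ≤ lieAut R L :=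
  fun _ hg => hg.1

/-! ### Maximal parabolic subalgebras of split Lie algebras -/

/-- The coefficient `m_j(α)` of the simple root `α_j` in the root `α`. -/
def simpleCoeff {ι R M N : Type*} [CommRing R] [CharZero R] [AddCommGroup M] [Module R M]
    [AddCommGroup N] [Module R N] {P : RootPairing ι R M N} (b : P.Base) (j : b.support)
    (α : ι) : ℤ :=
  b.toWeightBasisInt.repr (P.rootSpanMem ℤ α) j

/-- Two roots are strongly orthogonal if neither their sum nor their difference is a root
or zero. -/
def StronglyOrthogonal {ι R M N : Type*} [CommRing R] [AddCommGroup M] [Module R M]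
    [AddCommGroup N] [Module R N] (P : RootPairing ι R M N) (α β : ι) : Prop :=
  P.root α + P.root β ∉ insert 0 (Set.range P.root) ∧
    P.root α - P.root β ∉ insert 0 (Set.range P.root)

section Parabolic

variable {k : Type u} {L : Type v} [Field k] [CharZero k] [LieRing L] [LieAlgebra k L]
  [FiniteDimensional k L] [LieAlgebra.IsKilling k L]
  {H : LieSubalgebra k L} [H.IsCartanSubalgebra] [LieModule.IsTriangularizable k H L]

/-- The sum of the root spaces `L_α` over all roots `α` such that `m_j(α)` satisfies `p`. -/
def rootSum (b : (LieAlgebra.IsKilling.rootSystem H).Base) (j : b.support) (p : ℤ → Prop) :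
    Submodule k L :=
  ⨆ (α : H.root) (_ : p (simpleCoeff b j α)),
    (LieAlgebra.rootSpace H (α : LieModule.Weight k H L)).toSubmodule

/-- The nilpotent radical `𝔫` of the maximal parabolic subalgebra attached to `α_j`. -/
def nilradical (b : (LieAlgebra.IsKilling.rootSystem H).Base) (j : b.support) :
    Submodule k L :=
  rootSum b j (fun m => 0 < m)

/-- The nilpotent radical of the opposite parabolic subalgebra. -/
def oppNilradical (b : (LieAlgebra.IsKilling.rootSystem H).Base) (j : b.support) :
    Submodule k L :=
  rootSum b j (fun m => m < 0)

/-- The Levi subalgebra `𝔪`. -/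
def levi (b : (LieAlgebra.IsKilling.rootSystem H).Base) (j : b.support) : Submodule k L :=
  H.toSubmodule ⊔ rootSum b j (fun m => m = 0)

/-- The maximal parabolic subalgebra `𝔭 = 𝔪 + 𝔫` attached to `α_j`. -/
def parabolic (b : (LieAlgebra.IsKilling.rootSystem H).Base) (j : b.support) : Submodule k L :=
  levi b j ⊔ nilradical b j

/-- The opposite parabolic subalgebra. -/
def oppParabolic (b : (LieAlgebra.IsKilling.rootSystem H).Base) (j : b.support) :
    Submodule k L :=
  levi b j ⊔ oppNilradical b j

variable (H) in
/-- The image of `G(k)` in `Aut(L)` under the adjoint action, where `G` is the split simply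
connected group with Lie algebra `L`. The group `G(k)` is generated by its root subgroups, so
its image is generated by the automorphisms `exp (ad x)`, where `x` is a root vector. -/
def adjointImage : Subgroup (L ≃ₗ[k] L) :=
  Subgroup.closure {g | ∃ α : H.root,
    ∃ x ∈ LieAlgebra.rootSpace H (α : LieModule.Weight k H L),
    ∃ N : ℕ, (LieAlgebra.ad k L x) ^ N = 0 ∧
      (g : L →ₗ[k] L) =
        ∑ i ∈ Finset.range N, ((i.factorial : k)⁻¹) • (LieAlgebra.ad k L x) ^ i}

/-- The parabolic subalgebra attached to `α_j` is conjugate to its opposite under `G(k)`. -/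
def IsSelfOpposite (b : (LieAlgebra.IsKilling.rootSystem H).Base) (j : b.support) : Prop :=
  ∃ g ∈ adjointImage H, (parabolic b j).map (g : L →ₗ[k] L) = oppParabolic b j

/-- `S` is a maximal set of strongly orthogonal roots whose root spaces lie in `𝔫`. -/
def IsMaximalStronglyOrthogonal (b : (LieAlgebra.IsKilling.rootSystem H).Base)
    (j : b.support) (S : Finset H.root) : Prop :=
  Maximal (fun T : Finset H.root => (∀ α ∈ T, 0 < simpleCoeff b j α) ∧
    (T : Set H.root).Pairwise (StronglyOrthogonal (LieAlgebra.IsKilling.rootSystem H))) S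

end Parabolic

/-! ### Galois cocycles and twisted forms -/

section Galois

variable {k : Type u} [Field k] (K : Type w) [Field K] [Algebra k K]

/-- The action of `σ ∈ Gal(K/k)` on `K ⊗ V` through the first factor. -/
def galAct (V : Type*) [AddCommGroup V] [Module k V] (σ : K ≃ₐ[k] K) :
    (K ⊗[k] V) →ₗ[k] (K ⊗[k] V) :=
  TensorProduct.map σ.toLinearMap LinearMap.id

variable {K}

/-- `c` is a continuous `1`-cocycle of `Gal(K/k)` (with the Krull topology) with values in the
group of `K`-linear automorphisms of `K ⊗ V` (with the discrete topology), on which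
`σ` acts by conjugation: `c (σ τ) = c σ ∘ σ(c τ)`, where `σ(g) ∘ σ = σ ∘ g`. -/
def IsCocycle {V : Type*} [AddCommGroup V] [Module k V]
    (c : (K ≃ₐ[k] K) → ((K ⊗[k] V) ≃ₗ[K] (K ⊗[k] V))) : Prop :=
  IsLocallyConstant c ∧ ∀ (σ τ : K ≃ₐ[k] K) (x : K ⊗[k] V),
    c (σ * τ) (galAct K V σ x) = c σ (galAct K V σ (c τ x))

/-- `a` exhibits the cocycles `c` and `c'` as cohomologous: `c' σ = a⁻¹ ∘ c σ ∘ σ(a)`. -/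
def IsCoboundaryBetween {V : Type*} [AddCommGroup V] [Module k V]
    (c c' : (K ≃ₐ[k] K) → ((K ⊗[k] V) ≃ₗ[K] (K ⊗[k] V)))
    (a : (K ⊗[k] V) ≃ₗ[K] (K ⊗[k] V)) : Prop :=
  ∀ (σ : K ≃ₐ[k] K) (x : K ⊗[k] V),
    a (c' σ (galAct K V σ x)) = c σ (galAct K V σ (a x))

/-- The fixed points of the twisted Galois action `σ ↦ c σ ∘ σ` on `K ⊗ V`. -/
def twistedForm {V : Type*} [AddCommGroup V] [Module k V]
    (c : (K ≃ₐ[k] K) → ((K ⊗[k] V) ≃ₗ[K] (K ⊗[k] V))) : Submodule k (K ⊗[k] V) where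
  carrier := {x | ∀ σ, c σ (galAct K V σ x) = x}
  add_mem' := by
    intro x y hx hy σ
    rw [map_add, map_add, hx σ, hy σ]
  zero_mem' := by intro σ; simp
  smul_mem' := by
    intro t x hx σ
    rw [map_smul, ← algebraMap_smul K t (galAct K V σ x), map_smul, hx σ, algebraMap_smul]

/-- The Lie algebra form of `L` given by a family of automorphisms `c` of `K ⊗ L`. -/
def twistedLieForm {L : Type*} [LieRing L] [LieAlgebra k L]
    (c : (K ≃ₐ[k] K) → lieAut K (K ⊗[k] L)) : LieSubalgebra k (K ⊗[k] L) where
  toSubmodule := twistedForm (fun σ => (c σ : (K ⊗[k] L) ≃ₗ[K] (K ⊗[k] L)))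
  lie_mem' := by
    intro x y hx hy σ
    have h : galAct K L σ ⁅x, y⁆ = ⁅galAct K L σ x, galAct K L σ y⁆ :=
      (LieAlgebra.ExtendScalars.map (σ : K →ₐ[k] K) (LieHom.id : L →ₗ⁅k⁆ L)).map_lie x y
    simp only at *
    rw [h, (c σ).2, hx σ, hy σ]

/-- The part of a Lie subalgebra `A` on which `ad x` acts by the scalar `t`. -/
def adEigen {L : Type*} [LieRing L] [LieAlgebra k L] (A : LieSubalgebra k L) (x : L) (t : k) :
    Submodule k L :=
  A.toSubmodule ⊓ Module.End.eigenspace (LieAlgebra.ad k L x) t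

end Galois

/-! ### The Kantor–Koecher–Tits construction

Here `n` is a subspace of a Lie algebra `L`, `mul` is a multiplication on `n`, and `f`, `h`, `e`
are elements of `L`. -/

section Construction

variable {k : Type u} {L : Type v} [Field k] [LieRing L] [LieAlgebra k L]

/-- `mul` is the multiplication `x ∘ y = ½ [x, [f, y]]` on `n`, and with it `n` is a
(commutative) Jordan algebra with identity `e`. -/
structure IsJordanMul (n : Submodule k L) (f e : L) (mul : n →ₗ[k] n →ₗ[k] n) : Prop where
  coe_mul : ∀ x y, (mul x y : L) = (2⁻¹ : k) • ⁅(x : L), ⁅f, (y : L)⁆⁆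
  comm : ∀ x y, mul x y = mul y x
  jordan : ∀ x y, mul (mul x y) (mul x x) = mul x (mul y (mul x x))
  identity : ∃ u : n, (u : L) = e ∧ ∀ x, mul u x = x

/-- The centralizer `C(R)` of the triple in `Aut(R ⊗ L)`. -/
abbrev centralizerPoints (f h e : L) (R : Type w) [CommRing R] [Algebra k R] :
    Subgroup ((R ⊗[k] L) ≃ₗ[R] (R ⊗[k] L)) :=
  tripleCentralizer R (1 ⊗ₜ[k] f : R ⊗[k] L) (1 ⊗ₜ[k] h) (1 ⊗ₜ[k] e)

/-- The group `Aut(J)(R)` of automorphisms of the `R`-algebra `R ⊗ J`, where `J = (n, mul)`. -/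
abbrev autPoints {n : Submodule k L} (mul : n →ₗ[k] n →ₗ[k] n)
    (R : Type w) [CommRing R] [Algebra k R] :
    Subgroup ((R ⊗[k] n) ≃ₗ[R] (R ⊗[k] n)) :=
  algAut (LinearMap.BilinMap.baseChange R mul)

/-- An isomorphism of group functors on commutative `k`-algebras from the centralizer of the
triple `(f, h, e)` to `Aut(J)`, given by restricting automorphisms to `n`. -/
structure RestrictionIso {n : Submodule k L} (mul : n →ₗ[k] n →ₗ[k] n) (f h e : L) where
  /-- The isomorphism on `R`-points. -/
  iso : ∀ (R : Type w) [CommRing R] [Algebra k R],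
    centralizerPoints (k := k) f h e R ≃* autPoints mul R
  /-- The isomorphism is the restriction to `n`. -/
  restrict : ∀ (R : Type w) [CommRing R] [Algebra k R] (c : centralizerPoints (k := k) f h e R)
    (x : R ⊗[k] n), n.subtype.baseChange R ((iso R c).1 x) = c.1 (n.subtype.baseChange R x)
  /-- It is natural: if `c'` is the base change of `c`, then so are their images. -/
  natural : ∀ (R R' : Type w) [CommRing R] [Algebra k R] [CommRing R'] [Algebra k R']
    (φ : R →ₐ[k] R') (c : centralizerPoints (k := k) f h e R) (c' : centralizerPoints (k := k) f h e R'),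
    (∀ x : R ⊗[k] L, c'.1 (φ.toLinearMap.rTensor L x) = φ.toLinearMap.rTensor L (c.1 x)) →
    ∀ x : R ⊗[k] n, (iso R' c').1 (φ.toLinearMap.rTensor n x) = φ.toLinearMap.rTensor n ((iso R c).1 x)

/-- The homomorphism `Aut(J)(R) ≃ C(R) → Aut(L)(R)`. -/
def RestrictionIso.toLieAut {n : Submodule k L} {mul : n →ₗ[k] n →ₗ[k] n} {f h e : L}
    (ι : RestrictionIso.{u, v, w} mul f h e) (R : Type w) [CommRing R] [Algebra k R] :
    autPoints mul R →* lieAut R (R ⊗[k] L) :=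
  (Subgroup.inclusion (tripleCentralizer_le_lieAut R _ _ _)).comp (ι.iso R).symm.toMonoidHom

/-- The forms `A` of `L` and `B` of `J = (n, mul)`, given inside `K ⊗ L` and `K ⊗ n`, are related
by the Kantor–Koecher–Tits construction through the triple `(f, h, e)`. -/
structure IsKKTForm {n : Submodule k L} (mul : n →ₗ[k] n →ₗ[k] n) (f h e : L)
    {K : Type w} [Field K] [Algebra k K]
    (B : Submodule k (K ⊗[k] n)) (A : LieSubalgebra k (K ⊗[k] L)) : Prop where
  /-- `B` is a `k`-subalgebra of `K ⊗ J`. -/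
  mul_mem : ∀ x ∈ B, ∀ y ∈ B, LinearMap.BilinMap.baseChange K mul x y ∈ B
  /-- `B` is a `k`-form of `J`. -/
  form_jordan : ∃ θ : (K ⊗[k] B) ≃ₗ[K] (K ⊗[k] n), ∀ x : B, θ (1 ⊗ₜ[k] x) = x
  /-- `A` is a `k`-form of `L`. -/
  form_lie : ∃ θ : (K ⊗[k] A) ≃ₗ⁅K⁆ (K ⊗[k] L), ∀ x : A, θ (1 ⊗ₜ[k] x) = x
  mem_f : 1 ⊗ₜ[k] f ∈ A
  mem_h : 1 ⊗ₜ[k] h ∈ A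
  mem_e : 1 ⊗ₜ[k] e ∈ A
  /-- `A` is the direct sum of the eigenspaces of `ad h` with eigenvalues `-2`, `0`, `2`. -/
  indep : iSupIndep ![adEigen A (1 ⊗ₜ[k] h) (-2), adEigen A (1 ⊗ₜ[k] h) 0,
    adEigen A (1 ⊗ₜ[k] h) 2]
  sup_eq : adEigen A (1 ⊗ₜ[k] h) (-2) ⊔ adEigen A (1 ⊗ₜ[k] h) 0 ⊔ adEigen A (1 ⊗ₜ[k] h) 2 =
    A.toSubmodule
  /-- The eigenspace with eigenvalue `2` is `B`, -/
  eigen_two : B.map ((n.subtype.baseChange K).restrictScalars k) = adEigen A (1 ⊗ₜ[k] h) 2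
  /-- and the multiplication of `B` is `½ [x, [f, y]]`. -/
  coe_mul : ∀ x ∈ B, ∀ y ∈ B, n.subtype.baseChange K (LinearMap.BilinMap.baseChange K mul x y) =
    (2⁻¹ : k) • ⁅n.subtype.baseChange K x,
      ⁅(1 ⊗ₜ[k] f : K ⊗[k] L), n.subtype.baseChange K y⁆⁆

end Construction

end

end KKT

/-!
The proof has three parts.

*The grading is of tube type.* Let `ζ` be the element of the Cartan subalgebra with
`α(ζ) = m_j(α)`. Since `𝔫` is commutative, `m_j` only takes the values `-1`, `0`, `1`
(`simpleCoeff_trichotomy`), so that `𝔤 = 𝔫 ⊕ 𝔪 ⊕ 𝔫̄` is the eigenspace decomposition of `ad ζ`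
(`threeGrading`). The point is that `h = 2ζ`. The weights of `h` on `𝔫` are at least `1` by maximality
of `S`, and at most `2` because `(ad f)³` kills `𝔫`; hence `[𝔪, e] = 𝔫`. That their sum is at least
`2 dim 𝔫` is where conjugacy of `𝔭` and `𝔭̄` enters (`two_mul_card_le_sum`). Let `ω` be the multilinear
form on `𝔤` given by the determinant of the `𝔫`-components; it is killed by `𝔫̄`, preserved up to scalars
by `𝔪`, has weight `-dim 𝔫` for `ζ`, and generates a module with weights `-dim 𝔫 + r`, the weight spaces
being spanned by products of `r` elements of `𝔫` applied to `ω`. By `𝔰𝔩₂`-theory `e ^ (s + 1)` kills `ω`,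
where `s` is the trace of `ad h` on `𝔫`, and by polarization (`tower_eq_bot`), using `[𝔪, e] = 𝔫`, so does
every product of `s + 1` elements of `𝔫`. An element of `G(k)` that maps `𝔭` to `𝔭̄` transforms `ω`
into a nonzero vector of weight `dim 𝔫` in the same module, whence `2 dim 𝔫 ≤ s`. So `h` acts by `2` on
`𝔫`, and `h - 2ζ` is central, hence zero. Simplicity also gives `𝔪 = [𝔫, 𝔫̄]` and the faithfulness of
`𝔪` on `𝔫`; these facts make up a `TubeGrading`.

*Automorphisms.* For a `TubeGrading` over any commutative ring in which `2` is invertible,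
restriction to `N` is an isomorphism from the centralizer of the triple onto the automorphism
group of the product `½ [x, [f, y]]` (`TubeGrading.exists_mulEquiv`). An automorphism `a` of `N` is
extended to `B = [f, [f, N]]` by transport of structure, and to `M = [N, B]` by conjugation of the
action on `N`, which the product determines because `[x, [f, y]] = -[[f, y], x]`. A tube grading
over a field remains one after extension of scalars (`TubeGrading.baseChange`), which gives the
isomorphism of group functors.

*Forms.* Two bracket-preserving semilinear maps that agree on `N` and at `f` are equal
(`TubeGrading.eq_of_eqOn`), so cocycle and coboundary identities pass from `J` to `𝔤`. The
twisted Galois actions are continuous and semilinear, and Galois descent holds for such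
actions (`IsSemilinearAction.exists_linearEquiv`). The triple is fixed, and the eigenspace
components of a fixed vector are polynomials in `ad h` applied to it.
-/

namespace KKT

/-! ### Tube gradings and the extension of Jordan automorphisms -/

/-- A linear relation that is total and injective in both directions is the graph of a linear
equivalence. -/
theorem exists_linearEquiv_of_graph {R A B : Type*} [CommRing R] [AddCommGroup A] [Module R A]
    [AddCommGroup B] [Module R B] (Γ : Submodule R (A × B))
    (h₁ : ∀ a, ∃ b, (a, b) ∈ Γ) (h₂ : ∀ b, ∃ a, (a, b) ∈ Γ)
    (h₃ : ∀ b, (0, b) ∈ Γ → b = 0) (h₄ : ∀ a, (a, 0) ∈ Γ → a = 0) :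
    ∃ g : A ≃ₗ[R] B, ∀ a, (a, g a) ∈ Γ := by
  have b₁ : Function.Bijective ((LinearMap.fst R A B).comp Γ.subtype) := by
    refine ⟨(injective_iff_map_eq_zero _).2 ?_, fun a => ?_⟩
    · rintro ⟨⟨a, b⟩, hab⟩ (h : a = 0)
      subst h
      obtain rfl := h₃ b hab
      rfl
    · obtain ⟨b, hb⟩ := h₁ a
      exact ⟨⟨(a, b), hb⟩, rfl⟩
  have b₂ : Function.Bijective ((LinearMap.snd R A B).comp Γ.subtype) := by
    refine ⟨(injective_iff_map_eq_zero _).2 ?_, fun b => ?_⟩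
    · rintro ⟨⟨a, b⟩, hab⟩ (h : b = 0)
      subst h
      obtain rfl := h₄ a hab
      rfl
    · obtain ⟨a, ha⟩ := h₂ b
      exact ⟨⟨(a, b), ha⟩, rfl⟩
  refine ⟨(LinearEquiv.ofBijective _ b₁).symm.trans (LinearEquiv.ofBijective _ b₂), fun a => ?_⟩
  obtain ⟨p, rfl⟩ := (LinearEquiv.ofBijective _ b₁).surjective a
  rw [LinearEquiv.trans_apply, LinearEquiv.symm_apply_apply]
  exact p.2

/-- A `3`-grading `𝔏 = N ⊕ M ⊕ B` of a Lie algebra by the eigenvalues `2`, `0`, `-2` of `ad h`,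
where `h` belongs to a triple `(f, h, e)` with `e ∈ N` and `f ∈ B`, such that `M` is spanned by
`[N, B]` and acts faithfully on `N`. -/
structure TubeGrading (R : Type*) {𝔏 : Type*} [CommRing R] [LieRing 𝔏] [LieAlgebra R 𝔏]
    (f h e : 𝔏) (N M B : Submodule R 𝔏) : Prop where
  lie_e_f : ⁅e, f⁆ = h
  mem_e : e ∈ N
  mem_f : f ∈ B
  lie_h_N : ∀ x ∈ N, ⁅h, x⁆ = (2 : R) • x
  lie_h_M : ∀ x ∈ M, ⁅h, x⁆ = 0
  lie_h_B : ∀ x ∈ B, ⁅h, x⁆ = -((2 : R) • x)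
  sup_eq_top : N ⊔ M ⊔ B = ⊤
  lie_N_N : ∀ x ∈ N, ∀ y ∈ N, ⁅x, y⁆ = 0
  lie_B_B : ∀ x ∈ B, ∀ y ∈ B, ⁅x, y⁆ = 0
  lie_N_B : ∀ x ∈ N, ∀ y ∈ B, ⁅x, y⁆ ∈ M
  lie_M_N : ∀ x ∈ M, ∀ y ∈ N, ⁅x, y⁆ ∈ N
  lie_M_B : ∀ x ∈ M, ∀ y ∈ B, ⁅x, y⁆ ∈ B
  lie_M_M : ∀ x ∈ M, ∀ y ∈ M, ⁅x, y⁆ ∈ M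
  M_le_span : M ≤ Submodule.span R {z | ∃ x ∈ N, ∃ y ∈ B, ⁅x, y⁆ = z}
  faithful : ∀ z ∈ M, (∀ x ∈ N, ⁅z, x⁆ = 0) → z = 0

namespace TubeGrading

variable {R : Type*} {𝔏 : Type*} [CommRing R] [LieRing 𝔏] [LieAlgebra R 𝔏]
  {f h e : 𝔏} {N M B : Submodule R 𝔏}

theorem eq_zero_of_two_smul (h2 : IsUnit (2 : R)) {z : 𝔏} (hz : (2 : R) • z = 0) : z = 0 := by
  rwa [h2.smul_eq_zero] at hz

theorem exists_decomp (T : TubeGrading R f h e N M B) (z : 𝔏) :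
    ∃ x ∈ N, ∃ m ∈ M, ∃ y ∈ B, z = x + m + y := by
  have hz : z ∈ N ⊔ M ⊔ B := T.sup_eq_top ▸ Submodule.mem_top
  obtain ⟨w, hw, y, hy, rfl⟩ := Submodule.mem_sup.1 hz
  obtain ⟨x, hx, m, hm, rfl⟩ := Submodule.mem_sup.1 hw
  exact ⟨x, hx, m, hm, y, hy, rfl⟩

theorem lie_h_decomp (T : TubeGrading R f h e N M B) {x m y : 𝔏} (hx : x ∈ N) (hm : m ∈ M)
    (hy : y ∈ B) : ⁅h, x + m + y⁆ = (2 : R) • x - (2 : R) • y := by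
  rw [lie_add, lie_add, T.lie_h_N x hx, T.lie_h_M m hm, T.lie_h_B y hy]
  abel

theorem decomp_eq_zero (T : TubeGrading R f h e N M B) (h2 : IsUnit (2 : R)) {x m y : 𝔏}
    (hx : x ∈ N) (hm : m ∈ M) (hy : y ∈ B) (h0 : x + m + y = 0) : x = 0 ∧ m = 0 ∧ y = 0 := by
  have e1 : (2 : R) • x - (2 : R) • y = 0 := by rw [← T.lie_h_decomp hx hm hy, h0, lie_zero]
  have e2 : x - y = 0 := eq_zero_of_two_smul h2 (by rw [smul_sub, e1])
  have e3 : ⁅h, x - y⁆ = (2 : R) • (x + y) := by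
    rw [lie_sub, T.lie_h_N x hx, T.lie_h_B y hy]
    module
  have e4 : x + y = 0 := eq_zero_of_two_smul h2 (by rw [← e3, e2, lie_zero])
  have e5 : x = 0 := eq_zero_of_two_smul h2 (by
    rw [show (2 : R) • x = (x - y) + (x + y) by module, e2, e4, add_zero])
  have e6 : y = 0 := by rw [e5, zero_add] at e4; exact e4
  refine ⟨e5, ?_, e6⟩
  simpa [e5, e6] using h0

/-- The summand `N` is the whole eigenspace of `ad h` for the eigenvalue `2`. -/
theorem mem_N_iff (T : TubeGrading R f h e N M B) (h2 : IsUnit (2 : R)) {z : 𝔏} :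
    z ∈ N ↔ ⁅h, z⁆ = (2 : R) • z := by
  refine ⟨T.lie_h_N z, fun hz => ?_⟩
  obtain ⟨x, hx, m, hm, y, hy, rfl⟩ := T.exists_decomp z
  rw [T.lie_h_decomp hx hm hy] at hz
  have h0 : (0 : 𝔏) + m + (2 : R) • y = 0 := eq_zero_of_two_smul h2 (by
    rw [show (2 : R) • (0 + m + (2 : R) • y) = (2 : R) • (x + m + y) -
      ((2 : R) • x - (2 : R) • y) by module, hz, sub_self])
  obtain ⟨-, rfl, hy0⟩ := T.decomp_eq_zero h2 N.zero_mem hm (B.smul_mem 2 hy) h0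
  obtain rfl := eq_zero_of_two_smul h2 hy0
  simpa using hx

theorem lie_e_lie_f (T : TubeGrading R f h e N M B) {x : 𝔏} (hx : x ∈ N) :
    ⁅e, ⁅f, x⁆⁆ = (2 : R) • x := by
  rw [leibniz_lie, T.lie_e_f, T.lie_h_N x hx, T.lie_N_N e T.mem_e x hx, lie_zero, add_zero]

theorem lie_f_mem_M (T : TubeGrading R f h e N M B) {x : 𝔏} (hx : x ∈ N) : ⁅f, x⁆ ∈ M := by
  rw [← lie_skew]
  exact M.neg_mem (T.lie_N_B x hx f T.mem_f)

theorem lie_f_lie_f_mem_B (T : TubeGrading R f h e N M B) {x : 𝔏} (hx : x ∈ N) :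
    ⁅f, ⁅f, x⁆⁆ ∈ B := by
  rw [← lie_skew]
  exact B.neg_mem (T.lie_M_B _ (T.lie_f_mem_M hx) f T.mem_f)

theorem lie_e_lie_f_lie_f (T : TubeGrading R f h e N M B) {x : 𝔏} (hx : x ∈ N) :
    ⁅e, ⁅f, ⁅f, x⁆⁆⁆ = (2 : R) • ⁅f, x⁆ := by
  rw [leibniz_lie, T.lie_e_f, T.lie_h_M _ (T.lie_f_mem_M hx), T.lie_e_lie_f hx, lie_smul, zero_add]

theorem lie_f_lie_e (T : TubeGrading R f h e N M B) {y : 𝔏} (hy : y ∈ B) :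
    ⁅f, ⁅e, y⁆⁆ = (2 : R) • y := by
  rw [leibniz_lie, ← lie_skew f e, T.lie_e_f, neg_lie, T.lie_h_B y hy,
    T.lie_B_B f T.mem_f y hy, lie_zero, add_zero, neg_neg]

/-- Every element of `B` is `[f, [f, x]]` for some `x ∈ N`. -/
theorem exists_eq_lie_f_lie_f (T : TubeGrading R f h e N M B) (h2 : IsUnit (2 : R)) {y : 𝔏}
    (hy : y ∈ B) : ∃ x ∈ N, ⁅f, ⁅f, x⁆⁆ = y := by
  obtain ⟨c, hc⟩ := h2.exists_left_inv
  have hm : ⁅e, y⁆ ∈ M := T.lie_N_B e T.mem_e y hy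
  have hn : ⁅e, ⁅e, y⁆⁆ ∈ N := by
    rw [← lie_skew]
    exact N.neg_mem (T.lie_M_N _ hm e T.mem_e)
  have e1 : ⁅f, ⁅e, ⁅e, y⁆⁆⁆ = (2 : R) • ⁅e, y⁆ := by
    rw [leibniz_lie, ← lie_skew f e, T.lie_e_f, neg_lie, T.lie_h_M _ hm, T.lie_f_lie_e hy,
      lie_smul, neg_zero, zero_add]
  refine ⟨(c * c) • ⁅e, ⁅e, y⁆⁆, N.smul_mem _ hn, ?_⟩
  rw [lie_smul, lie_smul, e1, lie_smul, T.lie_f_lie_e hy, smul_smul, smul_smul]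
  rw [show c * c * 2 * 2 = (c * 2) * (c * 2) by ring, hc, one_mul, one_smul]

theorem eq_zero_of_lie_f_lie_f (T : TubeGrading R f h e N M B) (h2 : IsUnit (2 : R)) {x : 𝔏}
    (hx : x ∈ N) (h0 : ⁅f, ⁅f, x⁆⁆ = 0) : x = 0 := by
  have e1 := T.lie_e_lie_f_lie_f hx
  rw [h0, lie_zero] at e1
  have e2 := T.lie_e_lie_f hx
  rw [eq_zero_of_two_smul h2 e1.symm, lie_zero] at e2
  exact eq_zero_of_two_smul h2 e2.symm

/-- The operator `ad [x, [f, [f, z]]]` in terms of the operators `ad [x, f]`, which give the Jordan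
multiplication. -/
theorem lie_lie_f_lie_f {𝔏 : Type*} [LieRing 𝔏] (f x z : 𝔏) :
    ⁅x, ⁅f, ⁅f, z⁆⁆⁆ = ⁅⁅z, f⁆, ⁅x, f⁆⁆ - ⁅⁅⁅z, f⁆, x⁆, f⁆ := by
  have h1 : ⁅f, ⁅f, z⁆⁆ = ⁅⁅z, f⁆, f⁆ := by
    rw [← lie_skew f z, lie_neg, lie_skew]
  rw [h1, leibniz_lie ⁅z, f⁆ x f]
  abel

/-- An additive bracket-preserving map is determined by its values on `N` and at `f`. -/
theorem eq_of_eqOn {𝔏' : Type*} [LieRing 𝔏'] (T : TubeGrading R f h e N M B) (h2 : IsUnit (2 : R))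
    {F G : 𝔏 →+ 𝔏'} (hF : ∀ x y, F ⁅x, y⁆ = ⁅F x, F y⁆) (hG : ∀ x y, G ⁅x, y⁆ = ⁅G x, G y⁆)
    (hf : F f = G f) (hN : ∀ x ∈ N, F x = G x) (z : 𝔏) : F z = G z := by
  have hB : ∀ y ∈ B, F y = G y := by
    intro y hy
    obtain ⟨x, hx, rfl⟩ := T.exists_eq_lie_f_lie_f h2 hy
    rw [hF, hF, hG, hG, hf, hN x hx]
  have hM : ∀ m ∈ M, F m = G m := by
    intro m hm
    have hm' := T.M_le_span hm
    clear hm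
    induction hm' using Submodule.closure_induction with
    | zero => rw [map_zero, map_zero]
    | add x y _ _ hx hy => rw [map_add, map_add, hx, hy]
    | smul_mem r z hz =>
      obtain ⟨x, hx, y, hy, rfl⟩ := hz
      rw [← smul_lie, hF, hG, hN _ (N.smul_mem r hx), hB y hy]
  obtain ⟨x, hx, m, hm, y, hy, rfl⟩ := T.exists_decomp z
  simp only [map_add, hN x hx, hM m hm, hB y hy]

section Extension

variable {J : Type*} [AddCommGroup J] [Module R J] {i : J →ₗ[R] 𝔏}

/-- The elements `z`, `z'` of `M` correspond to each other under the automorphism `a` of `J`: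
their actions on `N` are conjugate by `a`. -/
def LeviRel (M : Submodule R 𝔏) (i : J →ₗ[R] 𝔏) (a : J ≃ₗ[R] J) (z z' : 𝔏) : Prop :=
  z ∈ M ∧ z' ∈ M ∧ ∀ w, ∃ u, ⁅z, i w⁆ = i u ∧ ⁅z', i (a w)⁆ = i (a u)

theorem LeviRel.symm {a : J ≃ₗ[R] J} {z z' : 𝔏} (hz : LeviRel M i a z z') :
    LeviRel M i a.symm z' z := by
  refine ⟨hz.2.1, hz.1, fun w => ?_⟩
  obtain ⟨u, h1, h2⟩ := hz.2.2 (a.symm w)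
  exact ⟨a u, by simpa using h2, by simpa using h1⟩

theorem LeviRel.add {a : J ≃ₗ[R] J} {z z' w w' : 𝔏} (hz : LeviRel M i a z z')
    (hw : LeviRel M i a w w') : LeviRel M i a (z + w) (z' + w') := by
  refine ⟨M.add_mem hz.1 hw.1, M.add_mem hz.2.1 hw.2.1, fun x => ?_⟩
  obtain ⟨u, h1, h2⟩ := hz.2.2 x
  obtain ⟨v, h3, h4⟩ := hw.2.2 x
  exact ⟨u + v, by rw [add_lie, h1, h3, map_add], by rw [add_lie, h2, h4, map_add, map_add]⟩

theorem LeviRel.smul {a : J ≃ₗ[R] J} {z z' : 𝔏} (r : R) (hz : LeviRel M i a z z') :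
    LeviRel M i a (r • z) (r • z') := by
  refine ⟨M.smul_mem r hz.1, M.smul_mem r hz.2.1, fun x => ?_⟩
  obtain ⟨u, h1, h2⟩ := hz.2.2 x
  exact ⟨r • u, by rw [smul_lie, h1, map_smul], by rw [smul_lie, h2, map_smul, map_smul]⟩

theorem LeviRel.sub {a : J ≃ₗ[R] J} {z z' w w' : 𝔏} (hz : LeviRel M i a z z')
    (hw : LeviRel M i a w w') : LeviRel M i a (z - w) (z' - w') := by
  have := hz.add (hw.smul (-1))
  simpa [sub_eq_add_neg] using this

theorem LeviRel.zero (a : J ≃ₗ[R] J) : LeviRel M i a 0 0 :=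
  ⟨M.zero_mem, M.zero_mem, fun _ => ⟨0, by simp, by simp⟩⟩

theorem LeviRel.lie (T : TubeGrading R f h e N M B) {a : J ≃ₗ[R] J} {z z' w w' : 𝔏}
    (hz : LeviRel M i a z z') (hw : LeviRel M i a w w') :
    LeviRel M i a ⁅z, w⁆ ⁅z', w'⁆ := by
  refine ⟨T.lie_M_M _ hz.1 _ hw.1, T.lie_M_M _ hz.2.1 _ hw.2.1, fun x => ?_⟩
  obtain ⟨u, h1, h2⟩ := hz.2.2 x
  obtain ⟨v, h3, h4⟩ := hw.2.2 x
  obtain ⟨u', h5, h6⟩ := hw.2.2 u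
  obtain ⟨v', h7, h8⟩ := hz.2.2 v
  exact ⟨v' - u', by rw [lie_lie, h1, h3, h5, h7, map_sub],
    by rw [lie_lie, h2, h4, h6, h8, map_sub, map_sub]⟩

theorem LeviRel.eq_zero (T : TubeGrading R f h e N M B) (hi : LinearMap.range i = N)
    (hinj : Function.Injective i) {a : J ≃ₗ[R] J} {z' : 𝔏} (hz : LeviRel M i a 0 z') : z' = 0 := by
  refine T.faithful z' hz.2.1 fun x hx => ?_
  obtain ⟨w, rfl⟩ : x ∈ LinearMap.range i := hi ▸ hx
  obtain ⟨u, h1, h2⟩ := hz.2.2 (a.symm w)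
  rw [zero_lie] at h1
  obtain rfl : u = 0 := hinj (by rw [← h1, map_zero])
  simpa using h2

variable {mul : J →ₗ[R] J →ₗ[R] J}

/-- If `a` is an automorphism of the algebra `J`, the elements `[x, f]` and `[a x, f]` of `M`
correspond to each other, because `ad [x, f]` is twice the multiplication by `x`. -/
theorem leviRel_lie_f (T : TubeGrading R f h e N M B) (hi : LinearMap.range i = N)
    (hmul : ∀ x y, (2 : R) • i (mul x y) = ⁅i x, ⁅f, i y⁆⁆) {a : J ≃ₗ[R] J} (ha : a ∈ algAut mul)
    (x : J) : LeviRel M i a ⁅i x, f⁆ ⁅i (a x), f⁆ := by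
  have hN : ∀ x, i x ∈ N := fun x => hi ▸ ⟨x, rfl⟩
  have key : ∀ x w, ⁅⁅i x, f⁆, i w⁆ = i ((2 : R) • mul x w) := by
    intro x w
    rw [map_smul, hmul, leibniz_lie (i x), T.lie_N_N _ (hN x) _ (hN w), lie_zero, add_zero]
  refine ⟨T.lie_N_B _ (hN x) f T.mem_f, T.lie_N_B _ (hN _) f T.mem_f, fun w => ?_⟩
  exact ⟨_, key x w, by rw [key, ← ha x w, map_smul a]⟩

theorem leviRel_lie_lie_f_lie_f (T : TubeGrading R f h e N M B) (hi : LinearMap.range i = N)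
    (hmul : ∀ x y, (2 : R) • i (mul x y) = ⁅i x, ⁅f, i y⁆⁆) {a : J ≃ₗ[R] J} (ha : a ∈ algAut mul)
    (x z : J) : LeviRel M i a ⁅i x, ⁅f, ⁅f, i z⁆⁆⁆ ⁅i (a x), ⁅f, ⁅f, i (a z)⁆⁆⁆ := by
  rw [lie_lie_f_lie_f, lie_lie_f_lie_f]
  have hx := T.leviRel_lie_f hi hmul ha x
  have hz := T.leviRel_lie_f hi hmul ha z
  refine (hz.lie T hx).sub ?_
  obtain ⟨u, h1, h2⟩ := hz.2.2 x
  rw [h1, h2]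
  exact T.leviRel_lie_f hi hmul ha u

theorem exists_leviRel (T : TubeGrading R f h e N M B) (h2 : IsUnit (2 : R))
    (hi : LinearMap.range i = N)
    (hmul : ∀ x y, (2 : R) • i (mul x y) = ⁅i x, ⁅f, i y⁆⁆) {a : J ≃ₗ[R] J} (ha : a ∈ algAut mul)
    {z : 𝔏} (hz : z ∈ M) : ∃ z', LeviRel M i a z z' := by
  have hz' := T.M_le_span hz
  clear hz
  induction hz' using Submodule.span_induction with
  | zero => exact ⟨0, LeviRel.zero a⟩
  | add x y _ _ hx hy =>
    obtain ⟨x', hx⟩ := hx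
    obtain ⟨y', hy⟩ := hy
    exact ⟨_, hx.add hy⟩
  | smul r x _ hx =>
    obtain ⟨x', hx⟩ := hx
    exact ⟨_, hx.smul r⟩
  | mem z hz =>
    obtain ⟨x, hx, y, hy, rfl⟩ := hz
    obtain ⟨w, hw, rfl⟩ := T.exists_eq_lie_f_lie_f h2 hy
    obtain ⟨x, rfl⟩ : x ∈ LinearMap.range i := hi ▸ hx
    obtain ⟨w, rfl⟩ : w ∈ LinearMap.range i := hi ▸ hw
    exact ⟨_, T.leviRel_lie_lie_f_lie_f hi hmul ha x w⟩

/-- If `z`, `z'` correspond to each other under `a`, then `ad z` and `ad z'` also correspond to each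
other on `B`, which is identified with `J` by `x ↦ [f, [f, x]]`. -/
theorem LeviRel.lie_B (T : TubeGrading R f h e N M B) (h2 : IsUnit (2 : R))
    (hi : LinearMap.range i = N) (hinj : Function.Injective i)
    (hmul : ∀ x y, (2 : R) • i (mul x y) = ⁅i x, ⁅f, i y⁆⁆) {a : J ≃ₗ[R] J} (ha : a ∈ algAut mul)
    {z z' : 𝔏} (hz : LeviRel M i a z z') (v : J) :
    ∃ u, ⁅z, ⁅f, ⁅f, i v⁆⁆⁆ = ⁅f, ⁅f, i u⁆⁆ ∧ ⁅z', ⁅f, ⁅f, i (a v)⁆⁆⁆ = ⁅f, ⁅f, i (a u)⁆⁆ := by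
  have hN : ∀ x, i x ∈ N := fun x => hi ▸ ⟨x, rfl⟩
  obtain ⟨u, hu, h1⟩ := T.exists_eq_lie_f_lie_f h2
    (T.lie_M_B z hz.1 _ (T.lie_f_lie_f_mem_B (hN v)))
  obtain ⟨u, rfl⟩ : u ∈ LinearMap.range i := hi ▸ hu
  refine ⟨u, h1.symm, ?_⟩
  have hd : ⁅z', ⁅f, ⁅f, i (a v)⁆⁆⁆ - ⁅f, ⁅f, i (a u)⁆⁆ ∈ B :=
    B.sub_mem (T.lie_M_B z' hz.2.1 _ (T.lie_f_lie_f_mem_B (hN _))) (T.lie_f_lie_f_mem_B (hN _))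
  -- Both sides have the same bracket with every element of `N`.
  have key : ∀ x, ⁅i (a x), ⁅z', ⁅f, ⁅f, i (a v)⁆⁆⁆ - ⁅f, ⁅f, i (a u)⁆⁆⁆ = 0 := by
    intro x
    obtain ⟨w, h3, h4⟩ := hz.2.2 x
    have r1 := hz.lie T (T.leviRel_lie_lie_f_lie_f hi hmul ha x v)
    have r2 := T.leviRel_lie_lie_f_lie_f hi hmul ha w v
    have r3 := T.leviRel_lie_lie_f_lie_f hi hmul ha x u
    rw [← h3, ← h4] at r2
    have r4 := (r1.sub r2).sub r3
    have e1 : ⁅z, ⁅i x, ⁅f, ⁅f, i v⁆⁆⁆⁆ - ⁅⁅z, i x⁆, ⁅f, ⁅f, i v⁆⁆⁆ - ⁅i x, ⁅f, ⁅f, i u⁆⁆⁆ = 0 := by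
      rw [leibniz_lie z, h1]
      abel
    have e2 : ⁅z', ⁅i (a x), ⁅f, ⁅f, i (a v)⁆⁆⁆⁆ - ⁅⁅z', i (a x)⁆, ⁅f, ⁅f, i (a v)⁆⁆⁆ -
        ⁅i (a x), ⁅f, ⁅f, i (a u)⁆⁆⁆ =
        ⁅i (a x), ⁅z', ⁅f, ⁅f, i (a v)⁆⁆⁆ - ⁅f, ⁅f, i (a u)⁆⁆⁆ := by
      rw [leibniz_lie z', lie_sub]
      abel
    rw [e1, e2] at r4
    exact r4.eq_zero T hi hinj
  obtain ⟨x, hx⟩ : e ∈ LinearMap.range i := hi ▸ T.mem_e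
  have h5 := T.lie_f_lie_e hd
  rw [← hx, ← a.apply_symm_apply x, key, lie_zero] at h5
  exact sub_eq_zero.1 (eq_zero_of_two_smul h2 h5.symm)

/-- The graph of the extension to `𝔏` of an automorphism `a` of `J`. -/
def extensionGraph (f : 𝔏) (M : Submodule R 𝔏) (i : J →ₗ[R] 𝔏) (a : J ≃ₗ[R] J) :
    Submodule R (𝔏 × 𝔏) where
  carrier := {p | ∃ x m m' v, LeviRel M i a m m' ∧ p.1 = i x + m + ⁅f, ⁅f, i v⁆⁆ ∧
    p.2 = i (a x) + m' + ⁅f, ⁅f, i (a v)⁆⁆}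
  add_mem' := by
    rintro ⟨_, _⟩ ⟨_, _⟩ ⟨x, m, m', v, hm, rfl, rfl⟩ ⟨y, n, n', w, hn, rfl, rfl⟩
    refine ⟨x + y, m + n, m' + n', v + w, hm.add hn, ?_, ?_⟩ <;>
    · simp only [Prod.mk_add_mk, map_add, lie_add]
      abel
  zero_mem' := ⟨0, 0, 0, 0, LeviRel.zero a, by simp, by simp⟩
  smul_mem' := by
    rintro r ⟨_, _⟩ ⟨x, m, m', v, hm, rfl, rfl⟩
    exact ⟨r • x, r • m, r • m', r • v, hm.smul r, by simp, by simp⟩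

theorem extensionGraph_symm {a : J ≃ₗ[R] J} {z z' : 𝔏} (hz : (z, z') ∈ extensionGraph f M i a) :
    (z', z) ∈ extensionGraph f M i a.symm := by
  obtain ⟨x, m, m', v, hm, h1, h2⟩ := hz
  exact ⟨a x, m', m, a v, hm.symm, by simpa using h2, by simpa using h1⟩

theorem extensionGraph_total (T : TubeGrading R f h e N M B) (h2 : IsUnit (2 : R))
    (hi : LinearMap.range i = N)
    (hmul : ∀ x y, (2 : R) • i (mul x y) = ⁅i x, ⁅f, i y⁆⁆) {a : J ≃ₗ[R] J} (ha : a ∈ algAut mul)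
    (z : 𝔏) : ∃ z', (z, z') ∈ extensionGraph f M i a := by
  obtain ⟨x, hx, m, hm, y, hy, rfl⟩ := T.exists_decomp z
  obtain ⟨w, hw, rfl⟩ := T.exists_eq_lie_f_lie_f h2 hy
  obtain ⟨x, rfl⟩ : x ∈ LinearMap.range i := hi ▸ hx
  obtain ⟨w, rfl⟩ : w ∈ LinearMap.range i := hi ▸ hw
  obtain ⟨m', hm'⟩ := T.exists_leviRel h2 hi hmul ha hm
  exact ⟨_, x, m, m', w, hm', rfl, rfl⟩

theorem extensionGraph_eq_zero (T : TubeGrading R f h e N M B) (h2 : IsUnit (2 : R))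
    (hi : LinearMap.range i = N) (hinj : Function.Injective i) {a : J ≃ₗ[R] J} {z' : 𝔏}
    (hz : (0, z') ∈ extensionGraph f M i a) : z' = 0 := by
  obtain ⟨x, m, m', v, hm, h1, h3⟩ := hz
  have hN : ∀ x, i x ∈ N := fun x => hi ▸ ⟨x, rfl⟩
  obtain ⟨hx, rfl, hv⟩ := T.decomp_eq_zero h2 (hN x) hm.1 (T.lie_f_lie_f_mem_B (hN v)) h1.symm
  obtain rfl : x = 0 := hinj (by simpa using hx)
  obtain rfl : v = 0 := hinj (by simpa using T.eq_zero_of_lie_f_lie_f h2 (hN v) hv)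
  simpa [hm.eq_zero T hi hinj] using h3

theorem extensionGraph_lie (T : TubeGrading R f h e N M B) (h2 : IsUnit (2 : R))
    (hi : LinearMap.range i = N) (hinj : Function.Injective i)
    (hmul : ∀ x y, (2 : R) • i (mul x y) = ⁅i x, ⁅f, i y⁆⁆) {a : J ≃ₗ[R] J} (ha : a ∈ algAut mul)
    {z z' w w' : 𝔏} (hz : (z, z') ∈ extensionGraph f M i a)
    (hw : (w, w') ∈ extensionGraph f M i a) :
    (⁅z, w⁆, ⁅z', w'⁆) ∈ extensionGraph f M i a := by
  have hN : ∀ x, i x ∈ N := fun x => hi ▸ ⟨x, rfl⟩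
  have hB : ∀ x, ⁅f, ⁅f, i x⁆⁆ ∈ B := fun x => T.lie_f_lie_f_mem_B (hN x)
  obtain ⟨x, m, m', v, hm, h1, h3⟩ := hz
  obtain ⟨y, n, n', t, hn, h4, h5⟩ := hw
  dsimp only at h1 h3 h4 h5
  obtain ⟨p, hp, hp'⟩ := hm.2.2 y
  obtain ⟨q, hq, hq'⟩ := hn.2.2 x
  obtain ⟨r, hr, hr'⟩ := hm.lie_B T h2 hi hinj hmul ha t
  obtain ⟨s, hs, hs'⟩ := hn.lie_B T h2 hi hinj hmul ha v
  have e1 : ∀ x y m n v t : 𝔏, ⁅x + m + v, y + n + t⁆ = ⁅x, y⁆ + (⁅m, y⁆ - ⁅n, x⁆) +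
      (⁅m, n⁆ + ⁅x, t⁆ - ⁅y, v⁆) + (⁅m, t⁆ - ⁅n, v⁆) + ⁅v, t⁆ := by
    intro x y m n v t
    simp only [add_lie, lie_add]
    rw [← lie_skew n x, ← lie_skew y v, ← lie_skew n v]
    abel
  refine ⟨p - q, _, _, r - s, ((hm.lie T hn).add (T.leviRel_lie_lie_f_lie_f hi hmul ha x t)).sub
    (T.leviRel_lie_lie_f_lie_f hi hmul ha y v), ?_, ?_⟩
  · simp only [h1, h4, e1, T.lie_N_N _ (hN _) _ (hN _), T.lie_B_B _ (hB _) _ (hB _), hp, hq, hr, hs,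
      map_sub, lie_sub, zero_add, add_zero]
  · simp only [h3, h5, e1, T.lie_N_N _ (hN _) _ (hN _), T.lie_B_B _ (hB _) _ (hB _), hp', hq', hr',
      hs', map_sub, lie_sub, zero_add, add_zero]

/-- Every automorphism of the algebra `J` extends to an automorphism of `𝔏` fixing the triple. -/
theorem exists_extension (T : TubeGrading R f h e N M B) (h2 : IsUnit (2 : R))
    (hi : LinearMap.range i = N) (hinj : Function.Injective i)
    (hmul : ∀ x y, (2 : R) • i (mul x y) = ⁅i x, ⁅f, i y⁆⁆) {a : J ≃ₗ[R] J} (ha : a ∈ algAut mul) :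
    ∃ g ∈ tripleCentralizer R f h e, ∀ x, g (i x) = i (a x) := by
  have ha' : a.symm ∈ algAut mul := inv_mem ha
  obtain ⟨g, hg⟩ := exists_linearEquiv_of_graph (extensionGraph f M i a)
    (T.extensionGraph_total h2 hi hmul ha)
    (fun z => (T.extensionGraph_total h2 hi hmul ha' z).imp fun _ hz => by
      simpa using extensionGraph_symm hz)
    (fun _ => T.extensionGraph_eq_zero h2 hi hinj)
    (fun _ hz => T.extensionGraph_eq_zero h2 hi hinj (extensionGraph_symm hz))
  have huniq : ∀ {z z'}, (z, z') ∈ extensionGraph f M i a → g z = z' := by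
    intro z z' hz
    have := (extensionGraph f M i a).sub_mem (hg z) hz
    rw [Prod.mk_sub_mk, sub_self] at this
    exact sub_eq_zero.1 (T.extensionGraph_eq_zero h2 hi hinj this)
  have hgi : ∀ x, g (i x) = i (a x) := fun x =>
    huniq ⟨x, 0, 0, 0, LeviRel.zero a, by simp, by simp⟩
  have hgB : ∀ x, g ⁅f, ⁅f, i x⁆⁆ = ⁅f, ⁅f, i (a x)⁆⁆ := fun x =>
    huniq ⟨0, 0, 0, x, LeviRel.zero a, by simp, by simp⟩
  have hglie : ∀ x y, g ⁅x, y⁆ = ⁅g x, g y⁆ := fun x y =>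
    huniq (T.extensionGraph_lie h2 hi hinj hmul ha (hg x) (hg y))
  have hN : ∀ x, i x ∈ N := fun x => hi ▸ ⟨x, rfl⟩
  obtain ⟨u, hu⟩ : e ∈ LinearMap.range i := hi ▸ T.mem_e
  -- The element `u` with `i u = e` is the identity of `J`, hence is fixed by `a`.
  have hunit : ∀ x, mul u x = x := by
    intro x
    apply hinj
    have := hmul u x
    rw [hu, T.lie_e_lie_f (hN x)] at this
    exact (h2.smul_left_cancel).1 this
  have hcomm : ∀ x, mul x u = x := by
    intro x
    apply hinj
    have := hmul x u
    rw [hu, ← lie_skew f e, T.lie_e_f, lie_neg, lie_skew, T.lie_h_N _ (hN x)] at this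
    exact (h2.smul_left_cancel).1 this
  have hau : a u = u := by
    have h1 := hcomm (a u)
    have h3 := ha u (a.symm u)
    rw [hunit, a.apply_symm_apply] at h3
    rw [h1] at h3
    exact h3.symm
  have hge : g e = e := by rw [← hu, hgi, hau]
  have hgf : g f = f := by
    have h1 : ⁅f, ⁅f, e⁆⁆ = -((2 : R) • f) := by
      rw [← lie_skew f e, T.lie_e_f, lie_neg, lie_skew, T.lie_h_B f T.mem_f]
    have h3 := hgB u
    rw [hau, hu, h1, map_neg, map_smul, neg_inj] at h3
    exact (h2.smul_left_cancel).1 h3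
  refine ⟨g, ⟨hglie, hgf, ?_, hge⟩, hgi⟩
  rw [← T.lie_e_f, hglie, hge, hgf]

/-- Every automorphism of `𝔏` fixing the triple restricts to an automorphism of the algebra `J`. -/
theorem exists_restriction (T : TubeGrading R f h e N M B) (h2 : IsUnit (2 : R))
    (hi : LinearMap.range i = N) (hinj : Function.Injective i)
    (hmul : ∀ x y, (2 : R) • i (mul x y) = ⁅i x, ⁅f, i y⁆⁆) {g : 𝔏 ≃ₗ[R] 𝔏}
    (hg : g ∈ tripleCentralizer R f h e) :
    ∃ a ∈ algAut mul, ∀ x, i (a x) = g (i x) := by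
  have hN : ∀ x, i x ∈ N := fun x => hi ▸ ⟨x, rfl⟩
  have hmem : ∀ g ∈ tripleCentralizer R f h e, ∀ x, ∃ y, i y = g (i x) := by
    rintro g ⟨h1, -, h3, -⟩ x
    have : g (i x) ∈ N := by
      rw [T.mem_N_iff h2, ← map_smul, ← T.lie_h_N _ (hN x), h1, h3]
    rw [← hi] at this
    exact this
  obtain ⟨a, ha⟩ := exists_linearEquiv_of_graph
    (LinearMap.eqLocus (i.comp (LinearMap.snd R J J))
      ((g : 𝔏 →ₗ[R] 𝔏).comp (i.comp (LinearMap.fst R J J))))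
    (fun x => hmem g hg x)
    (fun y => by
      obtain ⟨x, hx⟩ := hmem _ (inv_mem hg) y
      refine ⟨x, ?_⟩
      change i y = g (i x)
      rw [hx]
      exact (g.apply_symm_apply _).symm)
    (fun y (hy : i y = g (i 0)) => hinj (by simpa using hy))
    (fun x (hx : i 0 = g (i x)) => hinj (by simpa using hx.symm))
  have ha' : ∀ x, i (a x) = g (i x) := ha
  refine ⟨a, fun x y => hinj ?_, ha'⟩
  apply (h2.smul_left_cancel).1
  rw [ha', hmul, ← map_smul, hmul, hg.1, hg.1, hg.2.1, ha', ha']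

/-- Restriction to `J` is an isomorphism from the centralizer of the triple onto `Aut(J)`. -/
theorem exists_mulEquiv (T : TubeGrading R f h e N M B) (h2 : IsUnit (2 : R))
    (hi : LinearMap.range i = N) (hinj : Function.Injective i)
    (hmul : ∀ x y, (2 : R) • i (mul x y) = ⁅i x, ⁅f, i y⁆⁆) :
    ∃ ι : tripleCentralizer R f h e ≃* algAut mul, ∀ c x, i ((ι c).1 x) = c.1 (i x) := by
  choose r hr hri using fun c : tripleCentralizer R f h e =>
    T.exists_restriction h2 hi hinj hmul c.2
  let ρ : tripleCentralizer R f h e →* algAut mul := MonoidHom.mk' (fun c => ⟨r c, hr c⟩) <| by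
    intro c d
    ext x
    apply hinj
    change i (r (c * d) x) = i (r c (r d x))
    rw [hri, hri, hri]
    rfl
  refine ⟨MulEquiv.ofBijective ρ ⟨fun c d hcd => ?_, fun a => ?_⟩, hri⟩
  · ext z
    refine T.eq_of_eqOn h2 (F := (c.1 : 𝔏 →ₗ[R] 𝔏).toAddMonoidHom)
      (G := (d.1 : 𝔏 →ₗ[R] 𝔏).toAddMonoidHom) c.2.1 d.2.1 (c.2.2.1.trans d.2.2.1.symm) ?_ z
    intro x hx
    obtain ⟨x, rfl⟩ : x ∈ LinearMap.range i := hi ▸ hx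
    change c.1 (i x) = d.1 (i x)
    rw [← hri, ← hri]
    exact congrArg (fun a : algAut mul => i (a.1 x)) hcd
  · obtain ⟨g, hg, hgi⟩ := T.exists_extension h2 hi hinj hmul a.2
    refine ⟨⟨g, hg⟩, ?_⟩
    ext x
    apply hinj
    exact (hri _ x).trans (hgi x)

end Extension

end TubeGrading

/-! ### The Jordan algebra -/

/-- With `u = [x, f]` and `x`, `f` in two commutative summands of a `3`-grading, `u` commutes with
`[x, [u, f]]`. This is the Jordan identity in disguise. -/
theorem three_nsmul_lie_lie_lie_eq_zero {L : Type*} [LieRing L] {x f u : L} (hu : ⁅x, f⁆ = u)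
    (h1 : ⁅x, ⁅u, x⁆⁆ = 0) (h2 : ⁅f, ⁅u, f⁆⁆ = 0) : 3 • ⁅u, ⁅x, ⁅u, f⁆⁆⁆ = 0 := by
  have e1 : ⁅⁅u, x⁆, f⁆ + ⁅x, ⁅u, f⁆⁆ = 0 := by rw [← leibniz_lie, hu, lie_self]
  obtain ⟨p, hp⟩ : ∃ p, p = ⁅x, ⁅u, f⁆⁆ := ⟨_, rfl⟩
  have e2 : ⁅⁅u, x⁆, f⁆ = -p := by rw [hp]; exact eq_neg_of_add_eq_zero_left e1
  have e3 : ⁅u, ⁅⁅u, x⁆, f⁆⁆ = ⁅⁅u, ⁅u, x⁆⁆, f⁆ + ⁅⁅u, x⁆, ⁅u, f⁆⁆ := leibniz_lie _ _ _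
  have e4 : ⁅u, ⁅x, ⁅u, f⁆⁆⁆ = ⁅⁅u, x⁆, ⁅u, f⁆⁆ + ⁅x, ⁅u, ⁅u, f⁆⁆⁆ := leibniz_lie _ _ _
  have e5 : ⁅u, ⁅u, x⁆⁆ = ⁅x, p⁆ := by
    nth_rw 1 [← hu]
    rw [lie_lie, h1, lie_zero, sub_zero, ← lie_skew f ⁅u, x⁆, e2, neg_neg]
  have e6 : ⁅u, ⁅u, f⁆⁆ = -⁅f, p⁆ := by
    nth_rw 1 [← hu]
    rw [lie_lie, h2, lie_zero, zero_sub, ← hp]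
  have e7 : ⁅⁅x, p⁆, f⁆ = ⁅x, ⁅p, f⁆⁆ + ⁅u, p⁆ := by
    rw [lie_lie, hu, ← lie_skew u p, sub_eq_add_neg]
  rw [e2, e5, e7, lie_neg] at e3
  rw [← hp, e6, lie_neg, ← lie_neg, lie_skew] at e4
  rw [← hp]
  have e8 : ⁅⁅u, x⁆, ⁅u, f⁆⁆ = ⁅u, p⁆ - ⁅x, ⁅p, f⁆⁆ := by rw [e4]; abel
  rw [e8] at e3
  have e9 : -⁅u, p⁆ = 2 • ⁅u, p⁆ := by rw [e3]; abel
  rw [show 3 • ⁅u, p⁆ = 2 • ⁅u, p⁆ - -⁅u, p⁆ by abel, ← e9, sub_self]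

namespace TubeGrading

section Field

variable {k : Type u} {L : Type v} [Field k] [CharZero k] [LieRing L] [LieAlgebra k L]
  {f h e : L} {N M B : Submodule k L}

/-- The product `½ [x, [f, y]]` makes `N` a Jordan algebra with identity `e`. -/
theorem exists_isJordanMul (T : TubeGrading k f h e N M B) :
    ∃ mul : N →ₗ[k] N →ₗ[k] N, IsJordanMul N f e mul := by
  have hmem : ∀ x y : N, (2⁻¹ : k) • ⁅(x : L), ⁅f, (y : L)⁆⁆ ∈ N := by
    intro x y
    rw [← lie_skew]
    exact N.smul_mem _ (N.neg_mem (T.lie_M_N _ (T.lie_f_mem_M y.2) _ x.2))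
  let mul : N →ₗ[k] N →ₗ[k] N := LinearMap.mk₂ k
    (fun x y => ⟨(2⁻¹ : k) • ⁅(x : L), ⁅f, (y : L)⁆⁆, hmem x y⟩)
    (fun x y z => Subtype.ext <| by simp) (fun c x y => Subtype.ext <| by simp [smul_comm c])
    (fun x y z => Subtype.ext <| by simp) (fun c x y => Subtype.ext <| by simp [smul_comm c])
  have hmul : ∀ x y, (mul x y : L) = (2⁻¹ : k) • ⁅(x : L), ⁅f, (y : L)⁆⁆ := fun _ _ => rfl
  have hmul' : ∀ x y, (mul x y : L) = (2⁻¹ : k) • ⁅⁅(x : L), f⁆, (y : L)⁆ := by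
    intro x y
    rw [hmul, leibniz_lie, T.lie_N_N _ x.2 _ y.2, lie_zero, add_zero]
  have hcomm : ∀ x y, mul x y = mul y x := by
    intro x y
    ext
    rw [hmul, hmul', ← lie_skew, ← lie_skew (y : L) f, neg_lie]
  have h2 : (2 : k) ≠ 0 := two_ne_zero
  refine ⟨mul, hmul, hcomm, ?_, ⟨e, T.mem_e⟩, rfl, ?_⟩
  · intro x y
    obtain ⟨u, hu⟩ : ∃ u, ⁅(x : L), f⁆ = u := ⟨_, rfl⟩
    have huM : u ∈ M := hu ▸ T.lie_N_B _ x.2 f T.mem_f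
    have h3 := three_nsmul_lie_lie_lie_eq_zero hu
      (T.lie_N_N _ x.2 _ (T.lie_M_N _ huM _ x.2))
        (T.lie_B_B _ T.mem_f _ (T.lie_M_B _ huM _ T.mem_f))
    have h4 : ⁅u, ⁅(x : L), ⁅u, f⁆⁆⁆ = 0 := by
      rw [← Nat.cast_smul_eq_nsmul k] at h3
      exact (smul_eq_zero.1 h3).resolve_left (by norm_num)
    -- `[x ∘ x, f]` is a multiple of `[x, [u, f]]`
    have h5 : ⁅(mul x x : L), f⁆ = -((2⁻¹ : k) • ⁅(x : L), ⁅u, f⁆⁆) := by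
      rw [hmul', hu, smul_lie, ← smul_neg]
      congr 1
      have := leibniz_lie u (x : L) f
      rw [hu, lie_self] at this
      exact eq_neg_of_add_eq_zero_left this.symm
    rw [hcomm (mul x y), hcomm y]
    ext
    rw [hmul', h5, hmul' x y, hmul' x (mul _ y), hmul' _ y, h5, hu]
    simp only [neg_lie, smul_lie, lie_smul, lie_neg, smul_neg]
    rw [leibniz_lie u, h4, zero_lie, zero_add]
  · intro x
    ext
    rw [hmul, T.lie_e_lie_f x.2, smul_smul, inv_mul_cancel₀ h2, one_smul]

end Field

section BaseChange

variable {k : Type u} {L : Type v} [Field k] [LieRing L] [LieAlgebra k L]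
  {f h e : L} {N M B : Submodule k L} (R : Type w) [CommRing R] [Algebra k R]

theorem baseChange_induction {P : Submodule k L} {p : R ⊗[k] L → Prop} (h0 : p 0)
    (hadd : ∀ x y, p x → p y → p (x + y)) (ht : ∀ (r : R), ∀ x ∈ P, p (r ⊗ₜ x)) :
    ∀ x ∈ P.baseChange R, p x := by
  rintro _ ⟨x, rfl⟩
  induction x with
  | zero => simpa using h0
  | add x y hx hy => rw [map_add]; exact hadd _ _ hx hy
  | tmul r x => exact ht r x x.2

theorem lie_mem_baseChange {P Q S : Submodule k L} (hPQ : ∀ x ∈ P, ∀ y ∈ Q, ⁅x, y⁆ ∈ S) :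
    ∀ x ∈ P.baseChange R, ∀ y ∈ Q.baseChange R, ⁅x, y⁆ ∈ S.baseChange R := by
  refine baseChange_induction R ?_ ?_ ?_
  · intro y _
    rw [zero_lie]
    exact zero_mem _
  · intro x x' hx hx' y hy
    rw [add_lie]
    exact add_mem (hx y hy) (hx' y hy)
  · intro r x hx
    refine baseChange_induction R ?_ ?_ ?_
    · rw [lie_zero]
      exact zero_mem _
    · intro y y' hy hy'
      rw [lie_add]
      exact add_mem hy hy'
    · intro s y hy
      rw [LieAlgebra.ExtendScalars.bracket_tmul]
      exact Submodule.tmul_mem_baseChange_of_mem _ (hPQ x hx y hy)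

theorem lie_eq_zero_of_mem_baseChange {P Q : Submodule k L} (hPQ : ∀ x ∈ P, ∀ y ∈ Q, ⁅x, y⁆ = 0) :
    ∀ x ∈ P.baseChange R, ∀ y ∈ Q.baseChange R, ⁅x, y⁆ = 0 := by
  have := lie_mem_baseChange R (S := ⊥) (fun x hx y hy => (Submodule.mem_bot k).2 (hPQ x hx y hy))
  simpa using this

/-- If no nonzero element of `P` commutes with `Q`, the same holds after extension of scalars. -/
theorem faithful_baseChange {P Q : Submodule k L}
    (hPQ : ∀ z ∈ P, (∀ x ∈ Q, ⁅z, x⁆ = 0) → z = 0) :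
    ∀ z ∈ P.baseChange R, (∀ x ∈ Q.baseChange R, ⁅z, x⁆ = 0) → z = 0 := by
  intro z hz hzQ
  classical
  -- Apply the hypothesis to the coordinates of `z` with respect to a basis of `R` over `k`.
  let 𝓑 := Module.Basis.ofVectorSpace k R
  apply (TensorProduct.equivFinsuppOfBasisLeft (N := L) 𝓑).injective
  ext i
  rw [map_zero, Finsupp.zero_apply]
  refine hPQ _ ?_ fun x hx => ?_
  · revert z
    refine fun z hz _ => baseChange_induction R
      (p := fun z => TensorProduct.equivFinsuppOfBasisLeft 𝓑 z i ∈ P) (by simp) ?_ ?_ z hz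
    · intro x y hx hy
      rw [map_add, Finsupp.add_apply]
      exact add_mem hx hy
    · intro r x hx
      rw [TensorProduct.equivFinsuppOfBasisLeft_apply_tmul_apply]
      exact P.smul_mem _ hx
  · have key : ∀ z : R ⊗[k] L, ⁅TensorProduct.equivFinsuppOfBasisLeft 𝓑 z i, x⁆ =
        TensorProduct.equivFinsuppOfBasisLeft 𝓑 ⁅z, (1 : R) ⊗ₜ[k] x⁆ i := by
      intro z
      induction z with
      | zero => simp
      | add y z hy hz => simp only [map_add, Finsupp.add_apply, add_lie, hy, hz]
      | tmul r y =>
        rw [LieAlgebra.ExtendScalars.bracket_tmul, mul_one,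
          TensorProduct.equivFinsuppOfBasisLeft_apply_tmul_apply,
          TensorProduct.equivFinsuppOfBasisLeft_apply_tmul_apply, smul_lie]
    rw [key, hzQ _ (Submodule.tmul_mem_baseChange_of_mem 1 hx), map_zero, Finsupp.zero_apply]

theorem isUnit_two [CharZero k] : IsUnit (2 : R) := by
  have : IsUnit (algebraMap k R 2) := (IsUnit.mk0 (2 : k) two_ne_zero).map (algebraMap k R)
  rwa [map_ofNat] at this

/-- Extension of scalars of a tube grading. -/
theorem baseChange (T : TubeGrading k f h e N M B) :
    TubeGrading R (1 ⊗ₜ[k] f : R ⊗[k] L) (1 ⊗ₜ h) (1 ⊗ₜ e) (N.baseChange R) (M.baseChange R)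
      (B.baseChange R) where
  lie_e_f := by rw [LieAlgebra.ExtendScalars.bracket_tmul, mul_one, T.lie_e_f]
  mem_e := Submodule.tmul_mem_baseChange_of_mem 1 T.mem_e
  mem_f := Submodule.tmul_mem_baseChange_of_mem 1 T.mem_f
  lie_h_N := baseChange_induction R (by simp) (fun x y hx hy => by rw [lie_add, hx, hy, smul_add])
    fun r x hx => by
      rw [LieAlgebra.ExtendScalars.bracket_tmul, one_mul, T.lie_h_N x hx, two_smul, two_smul,
        TensorProduct.tmul_add]
  lie_h_M := baseChange_induction R (by simp) (fun x y hx hy => by rw [lie_add, hx, hy, add_zero])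
    fun r x hx => by
      rw [LieAlgebra.ExtendScalars.bracket_tmul, one_mul, T.lie_h_M x hx, TensorProduct.tmul_zero]
  lie_h_B := baseChange_induction R (by simp)
    (fun x y hx hy => by rw [lie_add, hx, hy, smul_add, neg_add])
    fun r x hx => by
      rw [LieAlgebra.ExtendScalars.bracket_tmul, one_mul, T.lie_h_B x hx, two_smul, two_smul,
        TensorProduct.tmul_neg, TensorProduct.tmul_add]
  sup_eq_top := by
    rw [eq_top_iff]
    rintro z -
    induction z with
    | zero => exact zero_mem _
    | add x y hx hy => exact add_mem hx hy
    | tmul r x =>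
      obtain ⟨x, hx, m, hm, y, hy, rfl⟩ := T.exists_decomp x
      rw [TensorProduct.tmul_add, TensorProduct.tmul_add]
      exact Submodule.add_mem_sup (Submodule.add_mem_sup
        (Submodule.tmul_mem_baseChange_of_mem r hx) (Submodule.tmul_mem_baseChange_of_mem r hm))
        (Submodule.tmul_mem_baseChange_of_mem r hy)
  lie_N_N := lie_eq_zero_of_mem_baseChange R T.lie_N_N
  lie_B_B := lie_eq_zero_of_mem_baseChange R T.lie_B_B
  lie_N_B := lie_mem_baseChange R T.lie_N_B
  lie_M_N := lie_mem_baseChange R T.lie_M_N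
  lie_M_B := lie_mem_baseChange R T.lie_M_B
  lie_M_M := lie_mem_baseChange R T.lie_M_M
  M_le_span := baseChange_induction R (zero_mem _) (fun _ _ => add_mem) fun r x hx => by
    have hx' := T.M_le_span hx
    clear hx
    induction hx' using Submodule.span_induction with
    | zero => rw [TensorProduct.tmul_zero]; exact zero_mem _
    | add x y _ _ hx hy => rw [TensorProduct.tmul_add]; exact add_mem hx hy
    | smul c x _ hx =>
      rw [TensorProduct.tmul_smul, ← algebraMap_smul R c]
      exact Submodule.smul_mem _ _ hx
    | mem z hz =>
      obtain ⟨x, hx, y, hy, rfl⟩ := hz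
      refine Submodule.subset_span ⟨r ⊗ₜ x, Submodule.tmul_mem_baseChange_of_mem r hx, 1 ⊗ₜ y,
        Submodule.tmul_mem_baseChange_of_mem 1 hy, ?_⟩
      rw [LieAlgebra.ExtendScalars.bracket_tmul, mul_one]
  faithful := faithful_baseChange R T.faithful

theorem subtype_baseChange_injective (N : Submodule k L) :
    Function.Injective (N.subtype.baseChange R) := by
  rw [LinearMap.baseChange_eq_ltensor]
  exact Module.Flat.lTensor_preserves_injective_linearMap _ N.injective_subtype

theorem coe_baseChange_mul {mul : N →ₗ[k] N →ₗ[k] N} (hmul : IsJordanMul N f e mul)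
    (x y : R ⊗[k] N) : N.subtype.baseChange R (LinearMap.BilinMap.baseChange R mul x y) =
      (2⁻¹ : k) • ⁅N.subtype.baseChange R x,
        ⁅(1 ⊗ₜ[k] f : R ⊗[k] L), N.subtype.baseChange R y⁆⁆ := by
  induction x with
  | zero => simp
  | add x x' hx hx' => simp only [map_add, LinearMap.add_apply, add_lie, smul_add, hx, hx']
  | tmul r x =>
    induction y with
    | zero => simp
    | add y y' hy hy' => simp only [map_add, lie_add, smul_add, hy, hy']
    | tmul s y =>
      simp only [LinearMap.BilinMap.baseChange_tmul, LinearMap.baseChange_tmul,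
        LieAlgebra.ExtendScalars.bracket_tmul, one_mul, Submodule.subtype_apply]
      rw [hmul.coe_mul, TensorProduct.tmul_smul]

variable [CharZero k]

theorem two_smul_coe_baseChange_mul {mul : N →ₗ[k] N →ₗ[k] N} (hmul : IsJordanMul N f e mul)
    (x y : R ⊗[k] N) :
    (2 : R) • N.subtype.baseChange R (LinearMap.BilinMap.baseChange R mul x y) =
      ⁅N.subtype.baseChange R x, ⁅(1 ⊗ₜ[k] f : R ⊗[k] L), N.subtype.baseChange R y⁆⁆ := by
  rw [coe_baseChange_mul R hmul, ← map_ofNat (algebraMap k R) 2, algebraMap_smul, smul_smul,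
    mul_inv_cancel₀ two_ne_zero, one_smul]

theorem exists_mulEquiv_baseChange (T : TubeGrading k f h e N M B) {mul : N →ₗ[k] N →ₗ[k] N}
    (hmul : IsJordanMul N f e mul) :
    ∃ ι : centralizerPoints (k := k) f h e R ≃* autPoints mul R, ∀ c x,
      N.subtype.baseChange R ((ι c).1 x) = c.1 (N.subtype.baseChange R x) :=
  (T.baseChange R).exists_mulEquiv (isUnit_two (k := k) R) rfl (subtype_baseChange_injective R N)
    (two_smul_coe_baseChange_mul R hmul)

/-- The isomorphism of group functors given by restriction. -/
noncomputable def restrictionIso (T : TubeGrading k f h e N M B) {mul : N →ₗ[k] N →ₗ[k] N}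
    (hmul : IsJordanMul N f e mul) : RestrictionIso.{u, v, w} mul f h e where
  iso R _ _ := (T.exists_mulEquiv_baseChange R hmul).choose
  restrict R _ _ := (T.exists_mulEquiv_baseChange R hmul).choose_spec
  natural R R' _ _ _ _ φ c c' hc x := by
    apply subtype_baseChange_injective R' N
    rw [(T.exists_mulEquiv_baseChange R' hmul).choose_spec, ← LinearMap.rTensor_baseChange, hc,
      ← LinearMap.rTensor_baseChange, (T.exists_mulEquiv_baseChange R hmul).choose_spec]

end BaseChange

end TubeGrading

/-! ### Galois descent -/

section Descent

variable {k : Type u} [Field k] {K : Type w} [Field K] [Algebra k K]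
  {W : Type*} [AddCommGroup W] [Module K W]

open Topology

/-- A continuous semilinear action of the Galois group of `K/k` on a `K`-vector space. -/
structure IsSemilinearAction (ρ : (K ≃ₐ[k] K) → W →+ W) : Prop where
  map_smul : ∀ σ (a : K) x, ρ σ (a • x) = σ a • ρ σ x
  map_one : ∀ x, ρ 1 x = x
  map_mul : ∀ σ τ x, ρ (σ * τ) x = ρ σ (ρ τ x)
  continuous : ∀ x, {σ | ρ σ x = x} ∈ 𝓝 (1 : K ≃ₐ[k] K)

variable [IsGalois k K] {ρ : (K ≃ₐ[k] K) → W →+ W}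

/-- Fixed vectors that are linearly independent over `k` are linearly independent over `K`. -/
theorem IsSemilinearAction.linearIndependent [Module k W] [IsScalarTower k K W]
    (hρ : IsSemilinearAction ρ) {ι : Type*} {x : ι → W}
    (hx : ∀ i σ, ρ σ (x i) = x i) (hli : LinearIndependent k x) : LinearIndependent K x := by
  classical
  rw [linearIndependent_iff']
  intro s
  induction s using Finset.induction_on with
  | empty => simp
  | insert a s ha ih =>
    intro g hg
    have hga : g a = 0 := by
      by_contra hga
      -- Normalize the coefficient of `x a` to `1`; the relation is then fixed by the action.
      obtain ⟨c, hc⟩ : ∃ c : ι → K, c = fun i => (g a)⁻¹ * g i := ⟨_, rfl⟩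
      have hca : c a = 1 := by rw [hc]; exact inv_mul_cancel₀ hga
      have hsum : x a + ∑ i ∈ s, c i • x i = 0 := by
        have := congrArg ((g a)⁻¹ • ·) hg
        simp only [smul_zero, Finset.smul_sum, smul_smul] at this
        rw [Finset.sum_insert ha, inv_mul_cancel₀ hga, one_smul] at this
        rw [hc]
        exact this
      have hfix : ∀ i ∈ s, ∀ σ : K ≃ₐ[k] K, σ (c i) = c i := by
        intro i hi σ
        have h1 := congrArg (ρ σ) hsum
        rw [map_add, hx, map_sum, map_zero] at h1
        simp only [hρ.map_smul, hx] at h1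
        have h2 : ∑ i ∈ s, (σ (c i) - c i) • x i = 0 := by
          simp only [sub_smul, Finset.sum_sub_distrib]
          rw [← h1] at hsum
          exact sub_eq_zero.2 (add_left_cancel hsum).symm
        exact sub_eq_zero.1 (ih _ h2 i hi)
      have hk : ∀ i, ∃ r : k, i ∈ insert a s → algebraMap k K r = c i := by
        intro i
        by_cases hi : i ∈ insert a s
        · rcases Finset.mem_insert.1 hi with rfl | hi
          · exact ⟨1, fun _ => by rw [hca, _root_.map_one]⟩
          · obtain ⟨r, hr⟩ := (InfiniteGalois.mem_range_algebraMap_iff_fixed (c i)).2 (hfix i hi)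
            exact ⟨r, fun _ => hr⟩
        · exact ⟨0, fun h => absurd h hi⟩
      choose r hr using hk
      have h3 : ∑ i ∈ insert a s, r i • x i = 0 := by
        rw [← hsum, Finset.sum_insert ha, ← algebraMap_smul K (r a),
          hr a (Finset.mem_insert_self a s), hca, one_smul]
        congr 1
        refine Finset.sum_congr rfl fun i hi => ?_
        rw [← algebraMap_smul K (r i), hr i (Finset.mem_insert_of_mem hi)]
      have h4 := linearIndependent_iff'.1 hli _ _ h3 a (Finset.mem_insert_self a s)
      have h5 := hr a (Finset.mem_insert_self a s)
      rw [h4, hca, map_zero] at h5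
      exact zero_ne_one h5
    intro i hi
    rw [Finset.sum_insert ha, hga, zero_smul, zero_add] at hg
    rcases Finset.mem_insert.1 hi with rfl | hi
    · exact hga
    · exact ih g hg i hi

/-- The fixed vectors of a continuous semilinear action span the whole space over `K`. -/
theorem IsSemilinearAction.span_eq_top (hρ : IsSemilinearAction ρ) :
    Submodule.span K {x : W | ∀ σ, ρ σ x = x} = ⊤ := by
  rw [eq_top_iff]
  rintro x -
  by_contra hx
  obtain ⟨φ, hφx, hφ⟩ := Submodule.exists_dual_map_eq_bot_of_notMem hx inferInstance
  have hφ0 : ∀ y, (∀ σ, ρ σ y = y) → φ y = 0 := fun y hy => by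
    have : φ y ∈ (Submodule.span K {x : W | ∀ σ, ρ σ x = x}).map φ :=
      Submodule.mem_map_of_mem (Submodule.subset_span hy)
    rwa [hφ, Submodule.mem_bot] at this
  obtain ⟨F, hF⟩ := (InfiniteGalois.krullTopology_mem_nhds_one_iff_of_isGalois _).1
    (hρ.continuous x)
  choose s hs using AlgEquiv.restrictNormalHom_surjective (F := k) (K₁ := F) K
  have hres : ∀ (σ : K ≃ₐ[k] K) (b : F), ((AlgEquiv.restrictNormalHom F σ b : F) : K) = σ b :=
    fun σ b => AlgEquiv.restrictNormal_commutes σ F b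
  have hker : ∀ σ τ : K ≃ₐ[k] K, AlgEquiv.restrictNormalHom F σ = AlgEquiv.restrictNormalHom F τ →
      ρ σ x = ρ τ x := by
    intro σ τ h
    have h1 : τ⁻¹ * σ ∈ (F.fixingSubgroup : Set (K ≃ₐ[k] K)) := by
      rw [SetLike.mem_coe, IntermediateField.mem_fixingSubgroup_iff]
      intro b hb
      have h2 : AlgEquiv.restrictNormalHom F (τ⁻¹ * σ) = 1 := by
        rw [_root_.map_mul, map_inv, h, inv_mul_cancel]
      have := hres (τ⁻¹ * σ) ⟨b, hb⟩
      rw [h2] at this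
      exact this.symm
    have h3 : ρ (τ⁻¹ * σ) x = x := hF h1
    conv_rhs => rw [← h3, ← hρ.map_mul, mul_inv_cancel_left]
  -- The traces of the vectors `b • x`, for `b ∈ F`, are fixed.
  have htr : ∀ b : F, φ (∑ τ : F ≃ₐ[k] F, (τ b : K) • ρ (s τ) x) = 0 := by
    intro b
    apply hφ0
    intro σ
    rw [map_sum]
    refine Fintype.sum_equiv (Equiv.mulLeft (AlgEquiv.restrictNormalHom F σ)) _ _ fun τ => ?_
    rw [hρ.map_smul, ← hρ.map_mul, ← hres, Equiv.coe_mulLeft]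
    congr 1
    apply hker
    rw [_root_.map_mul, hs, hs]
  -- By independence of characters all coefficients vanish.
  have hli := (linearIndependent_monoidHom F K).comp
    (fun τ : F ≃ₐ[k] F => ((algebraMap F K : F →* K).comp (τ : F →* F))) (by
      intro τ τ' h
      ext b
      exact DFunLike.congr_fun h b)
  have := Fintype.linearIndependent_iff.1 hli (fun τ => φ (ρ (s τ) x)) (by
    ext b
    have := htr b
    rw [map_sum] at this
    simp only [_root_.map_smul, smul_eq_mul] at this
    simpa [mul_comm] using this) 1
  apply hφx
  rw [← this, hker (s 1) 1 (by rw [hs, _root_.map_one]), hρ.map_one]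

/-- Galois descent: the fixed vectors of a continuous semilinear action form a `k`-form. -/
theorem IsSemilinearAction.exists_linearEquiv [Module k W] [IsScalarTower k K W]
    (hρ : IsSemilinearAction ρ) (B : Submodule k W)
    (hB : ∀ x, x ∈ B ↔ ∀ σ, ρ σ x = x) :
    ∃ θ : (K ⊗[k] B) ≃ₗ[K] W, ∀ x : B, θ (1 ⊗ₜ[k] x) = x := by
  let θ : (K ⊗[k] B) →ₗ[K] W := LinearMap.liftBaseChange K B.subtype
  have hθ : ∀ x : B, θ (1 ⊗ₜ[k] x) = x := fun x => by simp [θ]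
  have hinj : Function.Injective θ := by
    let 𝓑 := Module.Basis.ofVectorSpace k B
    have hli := hρ.linearIndependent (x := fun i => (𝓑 i : W)) (fun i => (hB _).1 (𝓑 i).2)
      (𝓑.linearIndependent.map' B.subtype B.ker_subtype)
    have h1 : (fun i => (𝓑 i : W)) = θ ∘ (𝓑.baseChange K) := by
      ext i
      rw [Function.comp_apply, Module.Basis.baseChange_apply, hθ]
    rw [h1] at hli
    exact LinearMap.injective_of_linearIndependent (𝓑.baseChange K).span_eq hli
  have hsurj : Function.Surjective θ := by
    rw [← LinearMap.range_eq_top, eq_top_iff, ← hρ.span_eq_top, Submodule.span_le]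
    intro x hx
    exact ⟨1 ⊗ₜ ⟨x, (hB x).2 hx⟩, hθ _⟩
  exact ⟨LinearEquiv.ofBijective θ ⟨hinj, hsurj⟩, hθ⟩

end Descent

section Cocycle

variable {k : Type u} [Field k] {K : Type w} [Field K] [Algebra k K]
  {V : Type*} [AddCommGroup V] [Module k V]

open Topology

theorem galAct_smul (σ : K ≃ₐ[k] K) (a : K) (x : K ⊗[k] V) :
    galAct K V σ (a • x) = σ a • galAct K V σ x := by
  induction x with
  | zero => simp
  | add x y hx hy => simp only [smul_add, map_add, hx, hy]
  | tmul b v => simp [galAct, TensorProduct.smul_tmul']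

theorem galAct_one (x : K ⊗[k] V) : galAct K V 1 x = x := by
  induction x with
  | zero => simp
  | add x y hx hy => rw [map_add, hx, hy]
  | tmul b v => rfl

theorem galAct_mul (σ τ : K ≃ₐ[k] K) (x : K ⊗[k] V) :
    galAct K V (σ * τ) x = galAct K V σ (galAct K V τ x) := by
  induction x with
  | zero => simp
  | add x y hx hy => simp only [map_add, hx, hy]
  | tmul b v => rfl

theorem IsCocycle.map_one {c : (K ≃ₐ[k] K) → ((K ⊗[k] V) ≃ₗ[K] (K ⊗[k] V))} (hc : IsCocycle c)
    (x : K ⊗[k] V) : c 1 x = x := by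
  have := hc.2 1 1 x
  rw [one_mul, galAct_one, galAct_one] at this
  exact ((c 1).injective this).symm

/-- The twisted Galois action attached to a cocycle. -/
theorem IsCocycle.isSemilinearAction [IsGalois k K]
    {c : (K ≃ₐ[k] K) → ((K ⊗[k] V) ≃ₗ[K] (K ⊗[k] V))}
    (hc : IsCocycle c) :
    IsSemilinearAction (k := k) (K := K) (W := K ⊗[k] V) fun σ =>
      ((c σ : (K ⊗[k] V) →ₗ[K] (K ⊗[k] V)).toAddMonoidHom).comp (galAct K V σ).toAddMonoidHom where
  map_smul σ a x := by
    change c σ (galAct K V σ (a • x)) = σ a • c σ (galAct K V σ x)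
    rw [galAct_smul, map_smul]
  map_one x := by
    change c 1 (galAct K V 1 x) = x
    rw [galAct_one, hc.map_one]
  map_mul σ τ x := by
    change c (σ * τ) (galAct K V (σ * τ) x) = c σ (galAct K V σ (c τ (galAct K V τ x)))
    rw [galAct_mul, hc.2]
  continuous x := by
    change {σ | c σ (galAct K V σ x) = x} ∈ 𝓝 (1 : K ≃ₐ[k] K)
    induction x with
    | zero => simp
    | add x y hx hy =>
      filter_upwards [hx, hy] with σ h1 h2
      change c σ (galAct K V σ (x + y)) = x + y
      rw [map_add, map_add, h1, h2]
    | tmul a v =>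
      have h1 : {σ : K ≃ₐ[k] K | σ a = a} ∈ 𝓝 (1 : K ≃ₐ[k] K) := by
        exact (stabilizer_isOpen_of_isIntegral a).mem_nhds
          (MulAction.stabilizer (K ≃ₐ[k] K) a).one_mem
      filter_upwards [h1, hc.1.eventually_eq 1] with σ h2 h3
      rw [h3, hc.map_one]
      change σ a ⊗ₜ v = a ⊗ₜ v
      rw [h2]

theorem IsCocycle.exists_linearEquiv [IsGalois k K]
    {c : (K ≃ₐ[k] K) → ((K ⊗[k] V) ≃ₗ[K] (K ⊗[k] V))} (hc : IsCocycle c) :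
    ∃ θ : (K ⊗[k] twistedForm c) ≃ₗ[K] (K ⊗[k] V), ∀ x : twistedForm c, θ (1 ⊗ₜ[k] x) = x :=
  hc.isSemilinearAction.exists_linearEquiv (twistedForm c) fun _ => Iff.rfl

end Cocycle

/-! ### Forms -/

section Forms

variable {k : Type u} {L : Type v} [Field k] [LieRing L] [LieAlgebra k L]

section

variable {K : Type w} [Field K] [Algebra k K]

theorem galAct_lie (σ : K ≃ₐ[k] K) (x y : K ⊗[k] L) :
    galAct K L σ ⁅x, y⁆ = ⁅galAct K L σ x, galAct K L σ y⁆ :=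
  (LieAlgebra.ExtendScalars.map (σ : K →ₐ[k] K) (LieHom.id : L →ₗ⁅k⁆ L)).map_lie x y

theorem galAct_one_tmul {V : Type*} [AddCommGroup V] [Module k V] (σ : K ≃ₐ[k] K) (v : V) :
    galAct K V σ (1 ⊗ₜ v) = 1 ⊗ₜ v := by
  simp [galAct]

theorem galAct_baseChange {V W : Type*} [AddCommGroup V] [Module k V] [AddCommGroup W] [Module k W]
    (σ : K ≃ₐ[k] K) (φ : V →ₗ[k] W) (x : K ⊗[k] V) :
    galAct K W σ (φ.baseChange K x) = φ.baseChange K (galAct K V σ x) := by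
  induction x with
  | zero => simp
  | add x y hx hy => simp only [map_add, hx, hy]
  | tmul a v => rfl

theorem galAct_baseChange_mul {V : Type*} [AddCommGroup V] [Module k V] (mul : V →ₗ[k] V →ₗ[k] V)
    (σ : K ≃ₐ[k] K) (x y : K ⊗[k] V) :
    galAct K V σ (LinearMap.BilinMap.baseChange K mul x y) =
      LinearMap.BilinMap.baseChange K mul (galAct K V σ x) (galAct K V σ y) := by
  induction x with
  | zero => simp
  | add x x' hx hx' => simp only [map_add, LinearMap.add_apply, hx, hx']
  | tmul r x =>
    induction y with
    | zero => simp
    | add y y' hy hy' => simp only [map_add, hy, hy']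
    | tmul s y => simp [galAct]

/-- A `K`-linear isomorphism from the extension of scalars of a Lie algebra that restricts to a
homomorphism of Lie algebras over `k` is an isomorphism of Lie algebras. -/
theorem exists_lieEquiv_of_linearEquiv {A : Type*} [LieRing A] [LieAlgebra k A]
    (j : A →ₗ⁅k⁆ K ⊗[k] L)
    (h : ∃ θ : (K ⊗[k] A) ≃ₗ[K] (K ⊗[k] L), ∀ x : A, θ (1 ⊗ₜ[k] x) = j x) :
    ∃ θ : (K ⊗[k] A) ≃ₗ⁅K⁆ (K ⊗[k] L), ∀ x : A, θ (1 ⊗ₜ[k] x) = j x := by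
  obtain ⟨θ, hθ⟩ := h
  have ht : ∀ (a : K) (x : A), θ (a ⊗ₜ x) = a • j x := by
    intro a x
    rw [← hθ, ← map_smul, TensorProduct.smul_tmul', smul_eq_mul, mul_one]
  refine ⟨{ θ with map_lie' := ?_ }, hθ⟩
  intro x y
  change θ ⁅x, y⁆ = ⁅θ x, θ y⁆
  induction x with
  | zero => simp
  | add x x' hx hx' => simp only [map_add, add_lie, hx, hx']
  | tmul a x =>
    induction y with
    | zero => simp
    | add y y' hy hy' => simp only [map_add, lie_add, hy, hy']
    | tmul b y =>
      rw [LieAlgebra.ExtendScalars.bracket_tmul, ht, ht, ht, smul_lie, lie_smul, smul_smul,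
        j.map_lie]

end

variable {f h e : L} {N M B : Submodule k L} {mul : N →ₗ[k] N →ₗ[k] N}
  (ι : RestrictionIso.{u, v, w} mul f h e)

namespace RestrictionIso

theorem toLieAut_mem (R : Type w) [CommRing R] [Algebra k R] (a : autPoints mul R) :
    (ι.toLieAut R a).1 ∈ centralizerPoints (k := k) f h e R :=
  ((ι.iso R).symm a).2

theorem toLieAut_baseChange (R : Type w) [CommRing R] [Algebra k R] (a : autPoints mul R)
    (x : R ⊗[k] N) :
    (ι.toLieAut R a).1 (N.subtype.baseChange R x) = N.subtype.baseChange R (a.1 x) := by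
  have := ι.restrict R ((ι.iso R).symm a) x
  rw [MulEquiv.apply_symm_apply] at this
  exact this.symm

variable [CharZero k] {K : Type w} [Field K] [Algebra k K]

/-- Two semilinear compositions of automorphisms of `K ⊗ L` agree if they agree on `K ⊗ N` and at
`f`. -/
theorem eq_of_eqOn (T : TubeGrading k f h e N M B) {F G : K ⊗[k] L →+ K ⊗[k] L}
    (hF : ∀ x y, F ⁅x, y⁆ = ⁅F x, F y⁆) (hG : ∀ x y, G ⁅x, y⁆ = ⁅G x, G y⁆)
    (hf : F (1 ⊗ₜ f) = G (1 ⊗ₜ f))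
    (hN : ∀ x : K ⊗[k] N, F (N.subtype.baseChange K x) = G (N.subtype.baseChange K x))
    (z : K ⊗[k] L) : F z = G z :=
  (T.baseChange K).eq_of_eqOn (TubeGrading.isUnit_two (k := k) K) hF hG hf
    (by rintro _ ⟨x, rfl⟩; exact hN x) z

theorem isCocycle_toLieAut (T : TubeGrading k f h e N M B)
    {c : (K ≃ₐ[k] K) → autPoints mul K} (hc : IsCocycle (fun σ => (c σ).1)) :
    IsCocycle (fun σ => (ι.toLieAut K (c σ)).1) := by
  constructor
  · rw [IsLocallyConstant.iff_eventually_eq]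
    intro σ
    filter_upwards [hc.1.eventually_eq σ] with τ hτ
    rw [Subtype.ext hτ]
  · intro σ τ
    refine eq_of_eqOn T
      (F := ((ι.toLieAut K (c (σ * τ))).1 : (K ⊗[k] L) →ₗ[K] _).toAddMonoidHom.comp
        (galAct K L σ).toAddMonoidHom)
      (G := (((ι.toLieAut K (c σ)).1 : (K ⊗[k] L) →ₗ[K] _).toAddMonoidHom.comp
        (galAct K L σ).toAddMonoidHom).comp
        ((ι.toLieAut K (c τ)).1 : (K ⊗[k] L) →ₗ[K] _).toAddMonoidHom) ?_ ?_ ?_ ?_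
    · intro x y
      change (ι.toLieAut K (c (σ * τ))).1 (galAct K L σ ⁅x, y⁆) = _
      rw [galAct_lie, (ι.toLieAut K (c (σ * τ))).2]
      rfl
    · intro x y
      change (ι.toLieAut K (c σ)).1 (galAct K L σ ((ι.toLieAut K (c τ)).1 ⁅x, y⁆)) = _
      rw [(ι.toLieAut K (c τ)).2, galAct_lie, (ι.toLieAut K (c σ)).2]
      rfl
    · change (ι.toLieAut K (c (σ * τ))).1 (galAct K L σ (1 ⊗ₜ f)) =
        (ι.toLieAut K (c σ)).1 (galAct K L σ ((ι.toLieAut K (c τ)).1 (1 ⊗ₜ f)))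
      rw [(ι.toLieAut_mem K (c τ)).2.1, galAct_one_tmul, (ι.toLieAut_mem K (c σ)).2.1,
        (ι.toLieAut_mem K (c (σ * τ))).2.1]
    · intro x
      change (ι.toLieAut K (c (σ * τ))).1 (galAct K L σ (N.subtype.baseChange K x)) =
        (ι.toLieAut K (c σ)).1 (galAct K L σ ((ι.toLieAut K (c τ)).1 (N.subtype.baseChange K x)))
      rw [galAct_baseChange, toLieAut_baseChange, toLieAut_baseChange, galAct_baseChange,
        toLieAut_baseChange]
      exact congrArg _ (hc.2 σ τ x)

theorem isCoboundaryBetween_toLieAut (T : TubeGrading k f h e N M B)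
    {c c' : (K ≃ₐ[k] K) → autPoints mul K} {a : autPoints mul K}
    (ha : IsCoboundaryBetween (fun σ => (c σ).1) (fun σ => (c' σ).1) a.1) :
    IsCoboundaryBetween (fun σ => (ι.toLieAut K (c σ)).1) (fun σ => (ι.toLieAut K (c' σ)).1)
      (ι.toLieAut K a).1 := by
  intro σ
  refine eq_of_eqOn T
    (F := (((ι.toLieAut K a).1 : (K ⊗[k] L) →ₗ[K] _).toAddMonoidHom.comp
      ((ι.toLieAut K (c' σ)).1 : (K ⊗[k] L) →ₗ[K] _).toAddMonoidHom).comp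
      (galAct K L σ).toAddMonoidHom)
    (G := (((ι.toLieAut K (c σ)).1 : (K ⊗[k] L) →ₗ[K] _).toAddMonoidHom.comp
      (galAct K L σ).toAddMonoidHom).comp
      ((ι.toLieAut K a).1 : (K ⊗[k] L) →ₗ[K] _).toAddMonoidHom) ?_ ?_ ?_ ?_
  · intro x y
    change (ι.toLieAut K a).1 ((ι.toLieAut K (c' σ)).1 (galAct K L σ ⁅x, y⁆)) = _
    rw [galAct_lie, (ι.toLieAut K (c' σ)).2, (ι.toLieAut K a).2]
    rfl
  · intro x y
    change (ι.toLieAut K (c σ)).1 (galAct K L σ ((ι.toLieAut K a).1 ⁅x, y⁆)) = _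
    rw [(ι.toLieAut K a).2, galAct_lie, (ι.toLieAut K (c σ)).2]
    rfl
  · change (ι.toLieAut K a).1 ((ι.toLieAut K (c' σ)).1 (galAct K L σ (1 ⊗ₜ f))) =
      (ι.toLieAut K (c σ)).1 (galAct K L σ ((ι.toLieAut K a).1 (1 ⊗ₜ f)))
    rw [(ι.toLieAut_mem K a).2.1, galAct_one_tmul, (ι.toLieAut_mem K (c σ)).2.1,
      (ι.toLieAut_mem K (c' σ)).2.1, (ι.toLieAut_mem K a).2.1]
  · intro x
    change (ι.toLieAut K a).1 ((ι.toLieAut K (c' σ)).1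
        (galAct K L σ (N.subtype.baseChange K x))) =
      (ι.toLieAut K (c σ)).1 (galAct K L σ ((ι.toLieAut K a).1 (N.subtype.baseChange K x)))
    rw [galAct_baseChange, toLieAut_baseChange, toLieAut_baseChange, toLieAut_baseChange,
      galAct_baseChange, toLieAut_baseChange]
    exact congrArg _ (ha σ x)

end RestrictionIso

/-- The isomorphism that exhibits two cocycles as cohomologous maps one twisted form onto the
other. -/
theorem IsCoboundaryBetween.map_twistedForm {K : Type w} [Field K] [Algebra k K] {V : Type*}
    [AddCommGroup V] [Module k V] {c c' : (K ≃ₐ[k] K) → ((K ⊗[k] V) ≃ₗ[K] (K ⊗[k] V))}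
    {a : (K ⊗[k] V) ≃ₗ[K] (K ⊗[k] V)} (ha : IsCoboundaryBetween c c' a) :
    (twistedForm c').map ((a : _ →ₗ[K] _).restrictScalars k) = twistedForm c := by
  apply le_antisymm
  · rintro _ ⟨x, hx, rfl⟩ σ
    change c σ (galAct K V σ (a x)) = a x
    rw [← ha, hx σ]
  · intro y hy
    refine ⟨a.symm y, fun σ => a.injective ?_, a.apply_symm_apply y⟩
    rw [ha, a.apply_symm_apply, hy σ]

/-- The Lie algebra version of `IsCoboundaryBetween.map_twistedForm`. -/
theorem IsCoboundaryBetween.exists_lieEquiv {K : Type w} [Field K] [Algebra k K]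
    {c c' : (K ≃ₐ[k] K) → lieAut K (K ⊗[k] L)} {a : lieAut K (K ⊗[k] L)}
    (ha : IsCoboundaryBetween (fun σ => (c σ).1) (fun σ => (c' σ).1) a.1) :
    ∃ θ : twistedLieForm c' ≃ₗ⁅k⁆ twistedLieForm c, ∀ x, (θ x : K ⊗[k] L) = a.1 x := by
  have h := ha.map_twistedForm
  let θ : twistedLieForm c' ≃ₗ[k] twistedLieForm c :=
    (a.1.restrictScalars k).ofSubmodules _ _ h
  exact ⟨{ θ with map_lie' := fun {x y} => Subtype.ext (a.2 x y) }, fun x => rfl⟩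

section KKTForm

variable [CharZero k] {K : Type w} [Field K] [Algebra k K]

/-- A Lie subalgebra containing `h` contains the components of its elements with respect to the
eigenspaces of `ad h`. -/
theorem TubeGrading.adEigen_sup_eq {𝔏 : Type*} [LieRing 𝔏] [LieAlgebra k 𝔏] [LieAlgebra K 𝔏]
    [IsScalarTower k K 𝔏] {f h e : 𝔏} {N M B : Submodule K 𝔏}
    (T : TubeGrading K f h e N M B) (A : LieSubalgebra k 𝔏) (hA : h ∈ A) :
    adEigen A h (-2) ⊔ adEigen A h 0 ⊔ adEigen A h 2 = A.toSubmodule := by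
  have h2 : ∀ x : 𝔏, (2 : K) • x = (2 : k) • x := fun x => by
    rw [two_smul, two_smul]
  refine le_antisymm (sup_le (sup_le inf_le_left inf_le_left) inf_le_left) fun z hz => ?_
  obtain ⟨x, hx, m, hm, y, hy, rfl⟩ := T.exists_decomp z
  have e1 : ⁅h, x + m + y⁆ = (2 : k) • (x - y) := by
    rw [T.lie_h_decomp hx hm hy, h2, h2, smul_sub]
  have e2 : ⁅h, x - y⁆ = (2 : k) • (x + y) := by
    rw [lie_sub, T.lie_h_N x hx, T.lie_h_B y hy, h2, h2, sub_neg_eq_add, smul_add]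
  have h20 : (2 : k) ≠ 0 := two_ne_zero
  have hdiff : x - y ∈ A := by
    have := A.smul_mem (2⁻¹ : k) (A.lie_mem hA hz)
    rwa [e1, smul_smul, inv_mul_cancel₀ h20, one_smul] at this
  have hsum : x + y ∈ A := by
    have := A.smul_mem (2⁻¹ : k) (A.lie_mem hA hdiff)
    rwa [e2, smul_smul, inv_mul_cancel₀ h20, one_smul] at this
  have hxA : x ∈ A := by
    have := A.smul_mem (2⁻¹ : k) (A.add_mem hdiff hsum)
    rwa [show x - y + (x + y) = (2 : k) • x by module, smul_smul, inv_mul_cancel₀ h20,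
      one_smul] at this
  have hyA : y ∈ A := by
    have := A.sub_mem hsum hxA
    rwa [add_sub_cancel_left] at this
  have hmA : m ∈ A := by
    have := A.sub_mem (A.sub_mem hz hxA) hyA
    rwa [add_assoc, add_sub_cancel_left, add_sub_cancel_right] at this
  rw [show x + m + y = y + m + x by abel]
  refine Submodule.add_mem_sup (Submodule.add_mem_sup ⟨hyA, ?_⟩ ⟨hmA, ?_⟩) ⟨hxA, ?_⟩
  · rw [SetLike.mem_coe, Module.End.mem_eigenspace_iff, LieAlgebra.ad_apply, T.lie_h_B y hy, h2,
      neg_smul]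
  · rw [SetLike.mem_coe, Module.End.mem_eigenspace_iff, LieAlgebra.ad_apply, T.lie_h_M m hm,
      zero_smul]
  · rw [SetLike.mem_coe, Module.End.mem_eigenspace_iff, LieAlgebra.ad_apply, T.lie_h_N x hx, h2]

theorem iSupIndep_adEigen {𝔏 : Type*} [LieRing 𝔏] [LieAlgebra k 𝔏] (A : LieSubalgebra k 𝔏)
    (h : 𝔏) : iSupIndep ![adEigen A h (-2), adEigen A h 0, adEigen A h 2] := by
  have hinj : Function.Injective ![(-2 : k), 0, 2] := by
    intro i j hij
    fin_cases i <;> fin_cases j <;> simp at hij ⊢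
    · exact two_ne_zero (self_eq_neg.1 hij.symm : (2 : k) = 0)
    · exact two_ne_zero (self_eq_neg.1 hij : (2 : k) = 0)
  refine ((LieAlgebra.ad k 𝔏 h).eigenspaces_iSupIndep.comp hinj).mono fun i => ?_
  fin_cases i <;> exact inf_le_right

theorem isKKTForm [IsGalois k K] (T : TubeGrading k f h e N M B) (hmul : IsJordanMul N f e mul)
    {c : (K ≃ₐ[k] K) → autPoints mul K} (hc : IsCocycle (fun σ => (c σ).1)) :
    IsKKTForm mul f h e (twistedForm (fun σ => (c σ).1))
      (twistedLieForm (fun σ => ι.toLieAut K (c σ))) := by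
  have hfix : ∀ {x : L}, (∀ σ, (ι.toLieAut K (c σ)).1 (1 ⊗ₜ x) = 1 ⊗ₜ x) →
      (1 ⊗ₜ x : K ⊗[k] L) ∈ twistedLieForm (fun σ => ι.toLieAut K (c σ)) := by
    intro x hx σ
    change (ι.toLieAut K (c σ)).1 (galAct K L σ (1 ⊗ₜ x)) = 1 ⊗ₜ x
    rw [galAct_one_tmul, hx]
  have hh := hfix fun σ => (ι.toLieAut_mem K (c σ)).2.2.1
  refine ⟨?_, hc.exists_linearEquiv, exists_lieEquiv_of_linearEquiv
    (LieSubalgebra.incl _) (ι.isCocycle_toLieAut T hc).exists_linearEquiv,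
    hfix fun σ => (ι.toLieAut_mem K (c σ)).2.1, hh,
    hfix fun σ => (ι.toLieAut_mem K (c σ)).2.2.2, iSupIndep_adEigen _ _,
    (T.baseChange K).adEigen_sup_eq _ hh, ?_,
    fun x _ y _ => TubeGrading.coe_baseChange_mul K hmul x y⟩
  · intro x hx y hy σ
    change (c σ).1 (galAct K N σ _) = _
    rw [galAct_baseChange_mul, (c σ).2]
    exact congrArg₂ (fun x y => LinearMap.BilinMap.baseChange K mul x y) (hx σ) (hy σ)
  · have key : ∀ (σ : K ≃ₐ[k] K) (x : K ⊗[k] N),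
        (ι.toLieAut K (c σ)).1 (galAct K L σ (N.subtype.baseChange K x)) =
          N.subtype.baseChange K ((c σ).1 (galAct K N σ x)) := by
      intro σ x
      rw [galAct_baseChange, ι.toLieAut_baseChange]
    have h2 : ∀ x : K ⊗[k] L, (2 : K) • x = (2 : k) • x := fun x => by
      rw [two_smul, two_smul]
    apply le_antisymm
    · rintro _ ⟨x, hx, rfl⟩
      refine ⟨fun σ => (key σ x).trans (congrArg _ (hx σ)), ?_⟩
      rw [SetLike.mem_coe, Module.End.mem_eigenspace_iff, LieAlgebra.ad_apply, ← h2]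
      exact (T.baseChange K).lie_h_N _ ⟨x, rfl⟩
    · rintro y ⟨hy, hy2⟩
      rw [SetLike.mem_coe, Module.End.mem_eigenspace_iff, LieAlgebra.ad_apply, ← h2] at hy2
      obtain ⟨x, rfl⟩ := ((T.baseChange K).mem_N_iff (TubeGrading.isUnit_two (k := k) K)).2 hy2
      refine ⟨x, fun σ => TubeGrading.subtype_baseChange_injective K N ?_, rfl⟩
      exact (key σ x).symm.trans (hy σ)

end KKTForm

end Forms

/-! ### The action of endomorphisms on multilinear forms -/

section Multilinear

variable {ι k L : Type*} [DecidableEq ι] [Field k] [AddCommGroup L] [Module k L]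

/-- The endomorphism `φ ↦ φ(…, A vᵢ, …)` of the space of multilinear forms. -/
noncomputable def slot (i : ι) (A : Module.End k L) :
    Module.End k (MultilinearMap k (fun _ : ι => L) k) :=
  MultilinearMap.compLinearMapₗ (Function.update (fun _ => LinearMap.id) i A)

theorem slot_apply (i : ι) (A : Module.End k L) (φ : MultilinearMap k (fun _ : ι => L) k)
    (v : ι → L) : slot i A φ v = φ (Function.update v i (A (v i))) := by
  simp only [slot, MultilinearMap.compLinearMapₗ_apply, MultilinearMap.compLinearMap_apply]
  congr 1
  ext j
  by_cases h : j = i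
  · subst h; simp
  · simp [h]

theorem slot_mul_slot_self (i : ι) (A B : Module.End k L) :
    slot i A * slot i B = slot i (B * A) := by
  ext φ v
  simp [slot_apply]

theorem slot_mul_slot_comm {i j : ι} (hij : i ≠ j) (A B : Module.End k L) :
    slot i A * slot j B = slot j B * slot i A := by
  ext φ v
  simp [slot_apply, hij, hij.symm, Function.update_comm hij]

theorem slot_add (i : ι) (A B : Module.End k L) : slot i (A + B) = slot i A + slot i B := by
  ext φ v
  simp [slot_apply]

theorem slot_smul (i : ι) (t : k) (A : Module.End k L) : slot i (t • A) = t • slot i A := by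
  ext φ v
  simp [slot_apply]

theorem slot_one (i : ι) : slot i (1 : Module.End k L) = 1 := by
  ext φ v
  simp [slot_apply]

theorem slot_pow (i : ι) (A : Module.End k L) (n : ℕ) : slot i A ^ n = slot i (A ^ n) := by
  induction n with
  | zero => simp [slot_one]
  | succ n ih => rw [pow_succ, ih, slot_mul_slot_self, ← pow_succ']

variable [Fintype ι]

/-- The endomorphism `φ ↦ Σᵢ φ(…, A vᵢ, …)` of the space of multilinear forms: the derivative of
`φ ↦ φ ∘ exp(tA)` at `t = 0`. -/
noncomputable def slotSum (A : Module.End k L) :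
    Module.End k (MultilinearMap k (fun _ : ι => L) k) :=
  ∑ i, slot i A

theorem slotSum_apply (A : Module.End k L) (φ : MultilinearMap k (fun _ : ι => L) k)
    (v : ι → L) : slotSum A φ v = ∑ i, φ (Function.update v i (A (v i))) := by
  simp [slotSum, slot_apply]

theorem slotSum_add (A B : Module.End k L) :
    (slotSum (A + B) : Module.End k (MultilinearMap k (fun _ : ι => L) k)) =
      slotSum A + slotSum B := by
  simp [slotSum, slot_add, Finset.sum_add_distrib]

theorem slotSum_smul (t : k) (A : Module.End k L) :
    (slotSum (t • A) : Module.End k (MultilinearMap k (fun _ : ι => L) k)) = t • slotSum A := by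
  simp [slotSum, slot_smul, Finset.smul_sum]

theorem slotSum_mul_add (A B : Module.End k L) :
    (slotSum A * slotSum B + slotSum (A * B) :
      Module.End k (MultilinearMap k (fun _ : ι => L) k)) =
      slotSum B * slotSum A + slotSum (B * A) := by
  have h : ∀ i j : ι, slot i A * slot j B + (if i = j then slot i (A * B) else 0) =
      slot j B * slot i A + (if i = j then slot i (B * A) else 0) := by
    intro i j
    split_ifs with hij
    · subst hij
      rw [slot_mul_slot_self, slot_mul_slot_self, add_comm]
    · rw [slot_mul_slot_comm hij]
  have hsum := Finset.sum_congr (rfl : (Finset.univ : Finset ι) = Finset.univ)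
    fun i _ => Finset.sum_congr (rfl : (Finset.univ : Finset ι) = Finset.univ) fun j _ => h i j
  simp only [Finset.sum_add_distrib, Finset.sum_ite_eq, Finset.mem_univ, if_true] at hsum
  rw [Finset.sum_comm (f := fun i j => slot j B * slot i A)] at hsum
  simpa only [slotSum, Finset.sum_mul_sum] using hsum

/-- If `exp A` is given by a finite exponential series, then a subspace of multilinear forms which
is stable under the derivative `slotSum A` is stable under composition with `exp A`. -/
theorem compLinearMap_exp_mem [CharZero k] {A : Module.End k L} {n : ℕ} (hA : A ^ n = 0)
    (W : Submodule k (MultilinearMap k (fun _ : ι => L) k)) (hW : ∀ φ ∈ W, slotSum A φ ∈ W)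
    {φ : MultilinearMap k (fun _ : ι => L) k} (hφ : φ ∈ W) :
    φ.compLinearMap (fun _ => ∑ i ∈ Finset.range n, ((i.factorial : k)⁻¹) • A ^ i) ∈ W := by
  set E : Module.End k L := ∑ i ∈ Finset.range n, ((i.factorial : k)⁻¹) • A ^ i with hE
  have hsm : ∀ (q : ℚ) (T : Module.End k (MultilinearMap k (fun _ : ι => L) k)),
      q • T = (q : k) • T := fun q T => by
    ext φ v
    simp [Rat.smul_def]
  have hn : ∀ i : ι, slot i A ^ n = 0 := fun i => by
    rw [slot_pow, hA, ← zero_smul k (0 : Module.End k L), slot_smul, zero_smul]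
  have hexp : ∀ i : ι, IsNilpotent.exp (slot i A) = slot i E := by
    intro i
    have hs : slot i E = ∑ m ∈ Finset.range n, slot i (((m.factorial : k)⁻¹) • A ^ m) := by
      ext φ v
      simp [hE, slot_apply, MultilinearMap.map_update_sum]
    rw [IsNilpotent.exp_eq_sum (hn i), hs]
    refine Finset.sum_congr rfl fun m _ => ?_
    rw [hsm, slot_pow, slot_smul]
    simp
  have hcomm : ∀ i j : ι, Commute (slot i A) (slot j A) := by
    intro i j
    by_cases hij : i = j
    · subst hij; exact Commute.refl _
    · exact slot_mul_slot_comm hij A A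
  -- Exponentiate the commuting slots one after the other.
  have key : ∀ s : Finset ι, IsNilpotent (∑ i ∈ s, slot i A) ∧
      IsNilpotent.exp (∑ i ∈ s, slot i A) =
        MultilinearMap.compLinearMapₗ (fun j => if j ∈ s then E else LinearMap.id) := by
    intro s
    induction s using Finset.induction_on with
    | empty =>
      refine ⟨by simp, ?_⟩
      rw [IsNilpotent.exp_eq_sum (k := 1) (by simp)]
      ext φ v
      simp
    | insert i s his ih =>
      have hc : Commute (slot i A) (∑ i ∈ s, slot i A) :=
        Commute.sum_right _ _ _ fun j _ => hcomm i j
      have hi : IsNilpotent (slot i A) := ⟨n, hn i⟩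
      rw [Finset.sum_insert his]
      refine ⟨hc.isNilpotent_add hi ih.1, ?_⟩
      rw [IsNilpotent.exp_add_of_commute hc hi ih.1, ih.2, hexp]
      ext φ v
      rw [Module.End.mul_apply, slot_apply, MultilinearMap.compLinearMapₗ_apply,
        MultilinearMap.compLinearMapₗ_apply, MultilinearMap.compLinearMap_apply,
        MultilinearMap.compLinearMap_apply]
      congr 1
      ext j
      by_cases hj : j = i
      · subst hj; simp [his]
      · simp [hj]
  have hfin : φ.compLinearMap (fun _ => E) =
      IsNilpotent.exp (slotSum A : Module.End k (MultilinearMap k (fun _ : ι => L) k)) φ := by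
    rw [slotSum, (key Finset.univ).2]
    simp
  obtain ⟨m, hm⟩ := (key Finset.univ).1
  rw [hfin, IsNilpotent.exp_eq_sum (k := m) hm, LinearMap.sum_apply]
  refine W.sum_mem fun i hi => ?_
  rw [hsm, LinearMap.smul_apply]
  refine W.smul_mem _ ?_
  clear hfin hi
  induction i with
  | zero => simpa using hφ
  | succ i ih => rw [pow_succ', Module.End.mul_apply]; exact hW _ ih

/-- The derivative of an alternating form along an endomorphism is alternating. -/
theorem exists_alternatingMap_slotSum (A : Module.End k L) (ω : L [⋀^ι]→ₗ[k] k) :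
    ∃ ω' : L [⋀^ι]→ₗ[k] k, ω'.toMultilinearMap = slotSum A ω.toMultilinearMap := by
  refine ⟨⟨slotSum A ω.toMultilinearMap, fun v a b hab hne => ?_⟩, rfl⟩
  change slotSum A ω.toMultilinearMap v = 0
  rw [slotSum_apply]
  rw [Finset.sum_eq_add a b hne]
  · change ω _ + ω _ = 0
    -- the two remaining terms differ by a transposition of the arguments
    have h := ω.map_swap (Function.update v a (A (v a))) hne
    rw [show (Function.update v a (A (v a)) ∘ Equiv.swap a b : ι → L) =
      Function.update v b (A (v b)) from ?_] at h
    · rw [h]; simp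
    · ext j
      rcases eq_or_ne j a with rfl | hja
      · simp [hne, hne.symm, hab]
      rcases eq_or_ne j b with rfl | hjb
      · simp [hab]
      · simp [Equiv.swap_apply_of_ne_of_ne hja hjb, hja, hjb]
  · intro i _ hi
    refine ω.map_eq_zero_of_eq _ ?_ hne
    simp [hi.1.symm, hi.2.symm, hab]
  · simp
  · simp

end Multilinear

/-- The action of a Lie algebra on the multilinear forms on it. -/
@[reducible] noncomputable def multilinearLieRingModule (ι k L : Type*) [Fintype ι] [DecidableEq ι]
    [Field k] [LieRing L] [LieAlgebra k L] :
    LieRingModule L (MultilinearMap k (fun _ : ι => L) k) where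
  bracket x φ := -slotSum (LieAlgebra.ad k L x) φ
  add_lie x y φ := by
    rw [map_add, slotSum_add, LinearMap.add_apply, neg_add]
  lie_add x φ ψ := by rw [map_add, neg_add]
  leibniz_lie x y φ := by
    have h := LinearMap.congr_fun
      (slotSum_mul_add (ι := ι) (LieAlgebra.ad k L y) (LieAlgebra.ad k L x)) φ
    have h2 : LieAlgebra.ad k L x * LieAlgebra.ad k L y =
        LieAlgebra.ad k L y * LieAlgebra.ad k L x + LieAlgebra.ad k L ⁅x, y⁆ := by
      ext z
      simp
    rw [h2, slotSum_add] at h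
    simp only [LinearMap.add_apply, Module.End.mul_apply] at h
    simp only [map_neg, neg_neg]
    generalize slotSum (LieAlgebra.ad k L ⁅x, y⁆) φ = p at *
    generalize slotSum (LieAlgebra.ad k L y * LieAlgebra.ad k L x) φ = q at *
    rw [show p = (q + p) - q by abel, ← add_sub_cancel_left
      (slotSum (LieAlgebra.ad k L x) (slotSum (LieAlgebra.ad k L y) φ)) (q + p), ← h]
    abel

theorem multilinearLieModule (ι k L : Type*) [Fintype ι] [DecidableEq ι]
    [Field k] [LieRing L] [LieAlgebra k L] :
    letI := multilinearLieRingModule ι k L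
    LieModule k L (MultilinearMap k (fun _ : ι => L) k) :=
  letI := multilinearLieRingModule ι k L
  { smul_lie := fun t x φ => by
      change -slotSum (LieAlgebra.ad k L (t • x)) φ = t • -slotSum (LieAlgebra.ad k L x) φ
      rw [map_smul, slotSum_smul, LinearMap.smul_apply, smul_neg]
    lie_smul := fun t x φ => by
      change -slotSum (LieAlgebra.ad k L x) (t • φ) = t • -slotSum (LieAlgebra.ad k L x) φ
      rw [map_smul, smul_neg] }

/-! ### Modules generated by an extremal vector -/

section Tower

variable {k L V : Type*} [Field k] [LieRing L] [LieAlgebra k L] [AddCommGroup V]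
  [Module k V] [LieRingModule L V] [LieModule k L V]

/-- The span of the vectors `x₁ ⋯ x_b ω` with `xᵢ ∈ N`. -/
def tower (N : Submodule k L) (ω : V) : ℕ → Submodule k V
  | 0 => Submodule.span k {ω}
  | b + 1 => Submodule.span k {z | ∃ x ∈ N, ∃ v ∈ tower N ω b, ⁅x, v⁆ = z}

variable {N M B : Submodule k L} {ω : V}

omit [LieModule k L V] in
theorem lie_mem_tower_succ {b : ℕ} {x : L} (hx : x ∈ N) {v : V} (hv : v ∈ tower N ω b) :
    ⁅x, v⁆ ∈ tower N ω (b + 1) :=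
  Submodule.subset_span ⟨x, hx, v, hv, rfl⟩

theorem lie_levi_mem_tower (hMN : ∀ z ∈ M, ∀ x ∈ N, ⁅z, x⁆ ∈ N)
    (hMω : ∀ z ∈ M, ⁅z, ω⁆ ∈ Submodule.span k {ω}) (b : ℕ) {z : L} (hz : z ∈ M) {v : V}
    (hv : v ∈ tower N ω b) : ⁅z, v⁆ ∈ tower N ω b := by
  induction b generalizing v with
  | zero =>
    obtain ⟨t, rfl⟩ := Submodule.mem_span_singleton.1 hv
    rw [lie_smul]
    exact Submodule.smul_mem _ _ (hMω z hz)
  | succ b ih =>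
    refine Submodule.span_induction (p := fun v _ => ⁅z, v⁆ ∈ tower N ω (b + 1))
      ?_ ?_ ?_ ?_ hv
    · rintro _ ⟨x, hx, u, hu, rfl⟩
      rw [leibniz_lie]
      exact add_mem (lie_mem_tower_succ (hMN z hz x hx) hu) (lie_mem_tower_succ hx (ih hu))
    · simp
    · intro u u' _ _ h h'
      rw [lie_add]
      exact add_mem h h'
    · intro t u _ h
      rw [lie_smul]
      exact Submodule.smul_mem _ _ h

theorem lie_opp_eq_zero (hBω : ∀ y ∈ B, ⁅y, ω⁆ = 0) {y : L} (hy : y ∈ B) {v : V}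
    (hv : v ∈ tower N ω 0) : ⁅y, v⁆ = 0 := by
  obtain ⟨t, rfl⟩ := Submodule.mem_span_singleton.1 hv
  rw [lie_smul, hBω y hy, smul_zero]

theorem lie_opp_mem_tower (hMN : ∀ z ∈ M, ∀ x ∈ N, ⁅z, x⁆ ∈ N)
    (hBN : ∀ y ∈ B, ∀ x ∈ N, ⁅y, x⁆ ∈ M)
    (hMω : ∀ z ∈ M, ⁅z, ω⁆ ∈ Submodule.span k {ω}) (hBω : ∀ y ∈ B, ⁅y, ω⁆ = 0)
    (b : ℕ) {y : L} (hy : y ∈ B) {v : V} (hv : v ∈ tower N ω (b + 1)) :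
    ⁅y, v⁆ ∈ tower N ω b := by
  induction b generalizing v with
  | zero =>
    refine Submodule.span_induction (p := fun v _ => ⁅y, v⁆ ∈ tower N ω 0) ?_ ?_ ?_ ?_ hv
    · rintro _ ⟨x, hx, u, hu, rfl⟩
      rw [leibniz_lie, lie_opp_eq_zero hBω hy hu, lie_zero, add_zero]
      exact lie_levi_mem_tower hMN hMω 0 (hBN y hy x hx) hu
    · simp
    · intro u u' _ _ h h'
      rw [lie_add]
      exact add_mem h h'
    · intro t u _ h
      rw [lie_smul]
      exact Submodule.smul_mem _ _ h
  | succ b ih =>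
    refine Submodule.span_induction (p := fun v _ => ⁅y, v⁆ ∈ tower N ω (b + 1)) ?_ ?_ ?_ ?_ hv
    · rintro _ ⟨x, hx, u, hu, rfl⟩
      rw [leibniz_lie]
      exact add_mem (lie_levi_mem_tower hMN hMω _ (hBN y hy x hx) hu)
        (lie_mem_tower_succ hx (ih hu))
    · simp
    · intro u u' _ _ h h'
      rw [lie_add]
      exact add_mem h h'
    · intro t u _ h
      rw [lie_smul]
      exact Submodule.smul_mem _ _ h

/-- The commutator of `z` and `e ^ (n + 1)`, when `[z, e]` commutes with `e`. -/
theorem lie_toEnd_pow_succ {z e : L} (he : ⁅⁅z, e⁆, e⁆ = 0) (n : ℕ) (u : V) :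
    ⁅z, (LieModule.toEnd k L V e ^ (n + 1)) u⁆ = (LieModule.toEnd k L V e ^ (n + 1)) ⁅z, u⁆ +
      (n + 1 : k) • (LieModule.toEnd k L V e ^ n) ⁅⁅z, e⁆, u⁆ := by
  have hcomm : ∀ (m : ℕ) (w : V), ⁅⁅z, e⁆, (LieModule.toEnd k L V e ^ m) w⁆ =
      (LieModule.toEnd k L V e ^ m) ⁅⁅z, e⁆, w⁆ := by
    intro m w
    induction m with
    | zero => rfl
    | succ m ih =>
      rw [pow_succ', Module.End.mul_apply, Module.End.mul_apply, LieModule.toEnd_apply_apply,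
        LieModule.toEnd_apply_apply, leibniz_lie, he, zero_lie, zero_add, ih]
  induction n with
  | zero =>
    simp only [zero_add, pow_one, pow_zero, LieModule.toEnd_apply_apply, Module.End.one_apply,
      Nat.cast_zero, one_smul]
    rw [leibniz_lie, add_comm]
  | succ n ih =>
    rw [pow_succ', Module.End.mul_apply, LieModule.toEnd_apply_apply, leibniz_lie, ih, hcomm,
      lie_add, lie_smul, ← LieModule.toEnd_apply_apply k L V e, ← Module.End.mul_apply,
      ← pow_succ', ← LieModule.toEnd_apply_apply k L V e, ← Module.End.mul_apply, ← pow_succ']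
    push_cast
    module

/-- Polarization: if `e ^ s` kills `ω`, then so does every product of `s` elements of `N`. It is
enough that `N = [M, e]` is commutative and that `M` preserves the line of `ω`. -/
theorem tower_eq_bot [CharZero k] {e : L} (hMN : ∀ z ∈ M, ∀ x ∈ N, ⁅z, x⁆ ∈ N)
    (hMω : ∀ z ∈ M, ⁅z, ω⁆ ∈ Submodule.span k {ω}) (he : e ∈ N)
    (hNN : ∀ x ∈ N, ∀ y ∈ N, ⁅x, y⁆ = 0) (hN : ∀ x ∈ N, ∃ z ∈ M, ⁅z, e⁆ = x) {s : ℕ}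
    (hs : (LieModule.toEnd k L V e ^ s) ω = 0) : tower N ω s = ⊥ := by
  have key : ∀ b a : ℕ, a + b = s → ∀ v ∈ tower N ω b, (LieModule.toEnd k L V e ^ a) v = 0 := by
    intro b
    induction b with
    | zero =>
      rintro a rfl v hv
      obtain ⟨t, rfl⟩ := Submodule.mem_span_singleton.1 hv
      rw [map_smul, show a = a + 0 from rfl, hs, smul_zero]
    | succ b ih =>
      rintro a hab v hv
      refine Submodule.span_induction (p := fun v _ => (LieModule.toEnd k L V e ^ a) v = 0)
        ?_ ?_ ?_ ?_ hv
      · rintro _ ⟨x, hx, u, hu, rfl⟩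
        obtain ⟨z, hz, rfl⟩ := hN x hx
        have h := lie_toEnd_pow_succ (k := k) (hNN _ hx e he) a u
        rw [ih (a + 1) (by omega) u hu, lie_zero,
          ih (a + 1) (by omega) _ (lie_levi_mem_tower hMN hMω b hz hu), zero_add] at h
        exact (smul_eq_zero.1 h.symm).resolve_left (by exact_mod_cast Nat.succ_ne_zero a)
      · simp
      · intro u u' _ _ h h'
        rw [map_add, h, h', add_zero]
      · intro t u _ h
        rw [map_smul, h, smul_zero]
  rw [Submodule.eq_bot_iff]
  intro v hv
  simpa using key s 0 (zero_add s) v hv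

/-- If the products of `s` elements of `N` kill `ω`, then the shorter products span an
`L`-submodule. -/
theorem lie_mem_iSup_tower (htop : N ⊔ M ⊔ B = ⊤) (hMN : ∀ z ∈ M, ∀ x ∈ N, ⁅z, x⁆ ∈ N)
    (hBN : ∀ y ∈ B, ∀ x ∈ N, ⁅y, x⁆ ∈ M)
    (hMω : ∀ z ∈ M, ⁅z, ω⁆ ∈ Submodule.span k {ω}) (hBω : ∀ y ∈ B, ⁅y, ω⁆ = 0) {s : ℕ}
    (hs : tower N ω s = ⊥) (x : L) {v : V} (hv : v ∈ ⨆ r : Fin s, tower N ω r) :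
    ⁅x, v⁆ ∈ ⨆ r : Fin s, tower N ω r := by
  have hle : ∀ r : ℕ, r ≤ s → tower N ω r ≤ ⨆ r : Fin s, tower N ω r := by
    intro r hr
    rcases hr.lt_or_eq with h | rfl
    · exact le_iSup (fun r : Fin s => tower N ω r) ⟨r, h⟩
    · rw [hs]; exact bot_le
  induction hv using Submodule.iSup_induction' with
  | zero => simp
  | add u u' _ _ h h' => rw [lie_add]; exact add_mem h h'
  | mem r v hv =>
    obtain ⟨y, hy, b, hb, rfl⟩ := Submodule.mem_sup.1 (htop ▸ Submodule.mem_top (x := x))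
    obtain ⟨n, hn, m, hm, rfl⟩ := Submodule.mem_sup.1 hy
    rw [add_lie, add_lie]
    refine add_mem (add_mem (hle _ r.2 (lie_mem_tower_succ hn hv))
      (hle _ r.2.le (lie_levi_mem_tower hMN hMω _ hm hv))) ?_
    obtain ⟨r, hr⟩ := r
    cases r with
    | zero => rw [lie_opp_eq_zero hBω hb hv]; exact zero_mem _
    | succ r => exact hle r (by omega) (lie_opp_mem_tower hMN hBN hMω hBω r hb hv)

theorem lie_eq_smul_of_mem_tower {ζ : L} {c : k} (hζ : ∀ x ∈ N, ⁅ζ, x⁆ = x)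
    (hζω : ⁅ζ, ω⁆ = c • ω) (b : ℕ) {v : V} (hv : v ∈ tower N ω b) : ⁅ζ, v⁆ = (c + b) • v := by
  induction b generalizing v with
  | zero =>
    obtain ⟨t, rfl⟩ := Submodule.mem_span_singleton.1 hv
    rw [lie_smul, hζω, smul_comm]
    simp
  | succ b ih =>
    refine Submodule.span_induction (p := fun v _ => ⁅ζ, v⁆ = (c + (b + 1 : ℕ)) • v)
      ?_ ?_ ?_ ?_ hv
    · rintro _ ⟨x, hx, u, hu, rfl⟩
      rw [leibniz_lie, hζ x hx, ih hu, lie_smul]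
      push_cast
      module
    · simp
    · intro u u' _ _ h h'
      rw [lie_add, h, h', smul_add]
    · intro t u _ h
      rw [lie_smul, h, smul_comm]

/-- The eigenvalues of `ζ` in the module generated by `ω` are the integral translates `c + r`,
`r < s`, of the eigenvalue `c` of `ω`. -/
theorem exists_nat_of_mem_iSup_tower {ζ : L} {c c' : k} (hζ : ∀ x ∈ N, ⁅ζ, x⁆ = x)
    (hζω : ⁅ζ, ω⁆ = c • ω) {s : ℕ} {ψ : V} (hψ : ψ ∈ ⨆ r : Fin s, tower N ω r) (hψ0 : ψ ≠ 0)
    (hζψ : ⁅ζ, ψ⁆ = c' • ψ) : ∃ r < s, c' = c + r := by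
  by_contra! hne
  have hle : (⨆ r : Fin s, tower N ω r) ≤
      ⨆ t, ⨆ (_ : t ≠ c'), Module.End.eigenspace (LieModule.toEnd k L V ζ) t := by
    refine iSup_le fun r v hv => ?_
    refine Submodule.mem_iSup_of_mem (c + r) (Submodule.mem_iSup_of_mem (hne r r.2).symm ?_)
    rw [Module.End.mem_eigenspace_iff]
    exact lie_eq_smul_of_mem_tower hζ hζω r hv
  have hd := Module.End.eigenspaces_iSupIndep (LieModule.toEnd k L V ζ) c'
  refine hψ0 ((Submodule.disjoint_def.1 hd) ψ ?_ (hle hψ))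
  rw [Module.End.mem_eigenspace_iff]
  exact hζψ

end Tower

/-! ### The trace inequality -/

section Trace

variable {k L : Type*} [Field k] [CharZero k] [LieRing L] [LieAlgebra k L]
  [FiniteDimensional k L]

omit [CharZero k] [LieRing L] [LieAlgebra k L] [FiniteDimensional k L] in
theorem exists_mem_of_injective {V : Type*} [AddCommGroup V] [Module k V] [FiniteDimensional k V]
    {T : Module.End k V} (hT : Function.Injective T) {W : Submodule k V} (hW : ∀ φ ∈ W, T φ ∈ W)
    {φ : V} (hφ : φ ∈ W) : ∃ ψ ∈ W, T ψ = φ := by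
  have hA : Function.Injective (T.restrict hW) := fun x y h =>
    Subtype.ext (hT (congrArg Subtype.val h))
  obtain ⟨ψ, hψ⟩ := (LinearMap.injective_iff_surjective.1 hA) ⟨φ, hφ⟩
  exact ⟨ψ, ψ.2, congrArg Subtype.val hψ⟩

/-- A subspace of multilinear forms on a Lie algebra which is stable under the Lie algebra is stable
under the group generated by exponentials of nilpotent elements. -/
theorem compLinearMap_mem_of_mem_closure {ι : Type*} [Fintype ι] [DecidableEq ι]
    (W : Submodule k (MultilinearMap k (fun _ : ι => L) k))
    (hW : ∀ x : L, ∀ φ ∈ W, slotSum (LieAlgebra.ad k L x) φ ∈ W) (T : Set (L ≃ₗ[k] L))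
    (hT : ∀ g ∈ T, ∃ x : L, ∃ n : ℕ, (LieAlgebra.ad k L x) ^ n = 0 ∧
      (g : L →ₗ[k] L) = ∑ i ∈ Finset.range n, ((i.factorial : k)⁻¹) • (LieAlgebra.ad k L x) ^ i)
    {g : L ≃ₗ[k] L} (hg : g ∈ Subgroup.closure T) :
    ∀ φ ∈ W, φ.compLinearMap (fun _ => (g : L →ₗ[k] L)) ∈ W := by
  induction hg using Subgroup.closure_induction with
  | mem g hg =>
    intro φ hφ
    obtain ⟨x, n, hn, hx⟩ := hT g hg
    rw [hx]
    exact compLinearMap_exp_mem hn W (hW x) hφ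
  | one => intro φ hφ; exact hφ
  | mul a b _ _ ha hb => intro φ hφ; exact hb _ (ha φ hφ)
  | inv a _ ha =>
    intro φ hφ
    -- an injective endomorphism of the finite dimensional space `W` is surjective
    have ha_inj : Function.Injective
        (MultilinearMap.compLinearMapₗ (M₂ := k) (fun _ : ι => (a : L →ₗ[k] L))) := by
      intro ψ χ h
      ext v
      have := congrArg (fun χ : MultilinearMap k (fun _ : ι => L) k => χ fun i => a.symm (v i)) h
      simpa using this
    obtain ⟨ψ, hψW, h⟩ := exists_mem_of_injective ha_inj ha hφ
    replace h : φ = ψ.compLinearMap (fun _ => (a : L →ₗ[k] L)) := h.symm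
    have h2 : φ.compLinearMap (fun _ => ((a⁻¹ : L ≃ₗ[k] L) : L →ₗ[k] L)) = ψ := by
      rw [h]
      ext v
      simp only [MultilinearMap.compLinearMap_apply]
      congr 1
      ext i
      exact a.apply_symm_apply _
    rw [h2]
    exact hψW

/-- Let `L = N ⊕ M ⊕ B` be the eigenspace decomposition of `ad ζ` for the eigenvalues `1`, `0`,
`-1`, let `(h, e, f)` be an `𝔰𝔩₂`-triple with `e ∈ N`, `f ∈ B` and `[M, e] = N`, and suppose that a
product of exponentials maps `M + N` to `M + B`. Then the trace of `ad h` on `N` is at least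
`2 dim N`.

The determinant of the `N`-components is a multilinear form `ω` of weight `-dim N` for `ζ`, killed
by `B`, and its translate by the group element has weight `dim N`. By polarization the products
of more than `tr(h|N)` elements of `N` kill `ω`, so that the weights in the module
generated by `ω` are at most `tr(h|N) - dim N`. -/
theorem two_mul_card_le_sum {N M B : Submodule k L} {h e f ζ : L} (hsl : IsSl2Triple h e f)
    (heN : e ∈ N) (hfB : f ∈ B) (hhM : h ∈ M) (htop : N ⊔ M ⊔ B = ⊤)
    (hζN : ∀ x ∈ N, ⁅ζ, x⁆ = x) (hζM : ∀ x ∈ M, ⁅ζ, x⁆ = 0) (hζB : ∀ x ∈ B, ⁅ζ, x⁆ = -x)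
    (hNN : ∀ x ∈ N, ∀ y ∈ N, ⁅x, y⁆ = 0) (hBB : ∀ x ∈ B, ∀ y ∈ B, ⁅x, y⁆ = 0)
    (hBN : ∀ x ∈ B, ∀ y ∈ N, ⁅x, y⁆ ∈ M) (hMN : ∀ x ∈ M, ∀ y ∈ N, ⁅x, y⁆ ∈ N)
    (hMB : ∀ x ∈ M, ∀ y ∈ B, ⁅x, y⁆ ∈ B) (hMM : ∀ x ∈ M, ∀ y ∈ M, ⁅x, y⁆ ∈ M)
    (hN : ∀ x ∈ N, ∃ z ∈ M, ⁅z, e⁆ = x)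
    {ι : Type*} [Fintype ι] [DecidableEq ι] (v : Module.Basis ι k N) (c : ι → ℕ)
    (hv : ∀ i, ⁅h, (v i : L)⁆ = (c i : k) • (v i : L)) (T : Set (L ≃ₗ[k] L))
    (hT : ∀ g ∈ T, ∃ x : L, ∃ n : ℕ, (LieAlgebra.ad k L x) ^ n = 0 ∧
      (g : L →ₗ[k] L) = ∑ i ∈ Finset.range n, ((i.factorial : k)⁻¹) • (LieAlgebra.ad k L x) ^ i)
    (g : L ≃ₗ[k] L) (hg : g ∈ Subgroup.closure T)
    (hgp : ∀ x ∈ M ⊔ N, g x ∈ M ⊔ B) : 2 * Fintype.card ι ≤ ∑ i, c i := by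
  have hdec : ∀ x : L, ∃ n ∈ N, ∃ m ∈ M, ∃ b ∈ B, n + m + b = x := by
    intro x
    obtain ⟨y, hy, b, hb, rfl⟩ := Submodule.mem_sup.1 (htop ▸ Submodule.mem_top (x := x))
    obtain ⟨n, hn, m, hm, rfl⟩ := Submodule.mem_sup.1 hy
    exact ⟨n, hn, m, hm, b, hb, rfl⟩
  have hcompl : IsCompl N (M ⊔ B) := by
    refine ⟨Submodule.disjoint_def.2 fun x hx hx' => ?_,
      codisjoint_iff.2 (by rw [← sup_assoc, htop])⟩
    obtain ⟨m, hm, b, hb, rfl⟩ := Submodule.mem_sup.1 hx'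
    have h1 := hζN _ hx
    have h2 := congrArg (fun y => ⁅ζ, y⁆) h1
    simp only [lie_add, hζM m hm, hζB b hb, lie_neg, zero_add, neg_neg] at h1 h2
    rw [← h1, neg_eq_zero]
    have h3 : (2 : k) • b = 0 := by
      rw [two_smul]
      nth_rw 1 [h2]
      rw [neg_add_cancel]
    exact (smul_eq_zero.1 h3).resolve_left two_ne_zero
  -- the projection to `N` along `M ⊕ B`
  set π : L →ₗ[k] N := N.projectionOnto (M ⊔ B) hcompl with hπ
  have hπN : ∀ x : N, π x = x := Submodule.projectionOnto_apply_left hcompl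
  have hπ0 : ∀ x ∈ M ⊔ B, π x = 0 := fun x hx =>
    (Submodule.projectionOnto_apply_eq_zero_iff hcompl).2 hx
  have hπ3 : ∀ n (hn : n ∈ N), ∀ m ∈ M, ∀ b ∈ B, π (n + m + b) = ⟨n, hn⟩ := by
    intro n hn m hm b hb
    rw [add_assoc, map_add, hπ0 _ (Submodule.add_mem_sup hm hb), add_zero]
    exact hπN ⟨n, hn⟩
  let ω : MultilinearMap k (fun _ : ι => L) k := v.det.toMultilinearMap.compLinearMap fun _ => π
  have hω : ∀ w : ι → L, ω w = v.det (fun i => π (w i)) := fun w => rfl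
  have hωupd : ∀ (w : ι → L) (i : ι) (x : L),
      ω (Function.update w i x) = v.det (Function.update (fun i => π (w i)) i (π x)) := by
    intro w i x
    rw [hω]
    congr 1
    ext j
    by_cases hj : j = i
    · subst hj; simp
    · simp [hj]
  let := multilinearLieRingModule ι k L
  have := multilinearLieModule ι k L
  have hlie : ∀ (x : L) (φ : MultilinearMap k (fun _ : ι => L) k) (w : ι → L),
      ⁅x, φ⁆ w = -∑ i, φ (Function.update w i ⁅x, w i⁆) := by
    intro x φ w
    exact congrArg Neg.neg (slotSum_apply (LieAlgebra.ad k L x) φ w)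
  have hBω : ∀ y ∈ B, ⁅y, ω⁆ = 0 := by
    intro y hy
    ext w
    rw [hlie]
    refine neg_eq_zero.2 ?_
    refine Finset.sum_eq_zero fun i _ => ?_
    obtain ⟨n, hn, m, hm, b, hb, hw⟩ := hdec (w i)
    have : π ⁅y, w i⁆ = 0 := by
      rw [← hw, lie_add, lie_add, hBB y hy b hb, add_zero]
      refine hπ0 _ (Submodule.add_mem_sup (hBN y hy n hn) ?_)
      rw [← lie_skew]
      exact neg_mem (hMB m hm y hy)
    rw [hωupd, this, AlternatingMap.map_update_zero]
  -- `M` acts on `ω` through a trace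
  have hMω' : ∀ z ∈ M, ∃ A : Module.End k N, (∀ x : N, (A x : L) = ⁅z, (x : L)⁆) ∧
      ⁅z, ω⁆ = (-∑ i, v.det (Function.update v i (A (v i)))) • ω := by
    intro z hz
    let A : Module.End k N := (LieAlgebra.ad k L z).restrict (hMN z hz)
    have hA : ∀ x : N, (A x : L) = ⁅z, (x : L)⁆ := fun x => rfl
    refine ⟨A, hA, ?_⟩
    have hπA : ∀ x : L, π ⁅z, x⁆ = A (π x) := by
      intro x
      obtain ⟨n, hn, m, hm, b, hb, rfl⟩ := hdec x
      rw [hπ3 n hn m hm b hb, lie_add, lie_add,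
        hπ3 _ (hMN z hz n hn) _ (hMM z hz m hm) _ (hMB z hz b hb)]
      rfl
    obtain ⟨ω', hω'⟩ := exists_alternatingMap_slotSum A v.det
    have hω'2 : ∀ w : ι → N, ω' w = ∑ i, v.det (Function.update w i (A (w i))) := by
      intro w
      exact (congrArg (fun φ => φ w) hω').trans (slotSum_apply A _ w)
    ext w
    have hsum : ∑ i, ω (Function.update w i ⁅z, w i⁆) = ω' (fun i => π (w i)) := by
      rw [hω'2]
      exact Finset.sum_congr rfl fun i _ => by rw [hωupd, hπA]
    rw [hlie, hsum, ω'.eq_smul_basis_det v, hω'2, AlternatingMap.smul_apply,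
      ← neg_smul]
    rfl
  have hMω : ∀ z ∈ M, ⁅z, ω⁆ ∈ Submodule.span k {ω} := by
    intro z hz
    obtain ⟨A, -, h⟩ := hMω' z hz
    rw [h]
    exact Submodule.smul_mem _ _ (Submodule.mem_span_singleton_self ω)
  have hhω : ⁅-h, ω⁆ = ((∑ i, c i : ℕ) : k) • ω := by
    obtain ⟨A, hA, hz⟩ := hMω' h hhM
    have hsum : ∑ i, v.det (Function.update v i (A (v i))) = (∑ i, c i : ℕ) := by
      push_cast
      refine Finset.sum_congr rfl fun i _ => ?_
      have : A (v i) = (c i : k) • v i := Subtype.ext (by rw [hA, hv]; rfl)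
      rw [this, AlternatingMap.map_update_smul, Function.update_eq_self, v.det_self, smul_eq_mul,
        mul_one]
    rw [neg_lie, hz, hsum]
    generalize ((∑ i, c i : ℕ) : k) = t
    ext w
    change -(-t * ω w) = t * ω w
    ring
  have hζω : ⁅ζ, ω⁆ = (-(Fintype.card ι : k)) • ω := by
    ext w
    have hi : ∀ i, ω (Function.update w i ⁅ζ, w i⁆) = ω w := by
      intro i
      obtain ⟨n, hn, m, hm, b, hb, hw⟩ := hdec (w i)
      have : π ⁅ζ, w i⁆ = π (w i) := by
        rw [← hw, hπ3 n hn m hm b hb, lie_add, lie_add, hζN n hn, hζM m hm, hζB b hb,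
          hπ3 n hn 0 (zero_mem _) _ (neg_mem hb)]
      rw [hωupd, this, Function.update_eq_self i (fun i => π (w i)), hω]
    rw [hlie, Finset.sum_congr rfl fun i _ => hi i]
    simp
  have hω0 : ω ≠ 0 := by
    intro h0
    have : ω (fun i => (v i : L)) = 1 := by
      rw [hω]
      simp only [hπN]
      exact v.det_self
    rw [h0] at this
    exact zero_ne_one this
  have hpow := (IsSl2Triple.HasPrimitiveVectorWith.mk hω0 hhω (hBω f hfB) :
    IsSl2Triple.HasPrimitiveVectorWith hsl.symm ω
      ((∑ i, c i : ℕ) : k)).pow_toEnd_f_eq_zero_of_eq_nat rfl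
  have hbot := tower_eq_bot hMN hMω heN hNN hN hpow
  -- the translate of `ω` by the group element
  let ψ : MultilinearMap k (fun _ : ι => L) k := ω.compLinearMap fun _ => (g : L →ₗ[k] L)
  have hψ : ∀ w : ι → L, ψ w = ω (fun i => g (w i)) := fun w => rfl
  have hψ0 : ψ ≠ 0 := by
    intro h0
    apply hω0
    ext w
    have := congrArg (fun φ => φ (fun i => g.symm (w i))) h0
    simpa [hψ] using this
  have hψW : ψ ∈ ⨆ r : Fin (∑ i, c i + 1), tower N ω r := by
    refine compLinearMap_mem_of_mem_closure _ (fun x φ hφ => ?_) T hT hg ω ?_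
    · have := lie_mem_iSup_tower htop hMN hBN hMω hBω hbot x hφ
      exact neg_mem_iff.1 this
    · exact Submodule.mem_iSup_of_mem (⟨0, by omega⟩ : Fin (∑ i, c i + 1))
        (Submodule.mem_span_singleton_self ω)
  have hζψ : ⁅ζ, ψ⁆ = (Fintype.card ι : k) • ψ := by
    ext w
    have hi : ∀ i, ψ (Function.update w i ⁅ζ, w i⁆) = -ψ w := by
      intro i
      obtain ⟨n, hn, m, hm, b, hb, hw⟩ := hdec (w i)
      have hmem : ⁅ζ, w i⁆ + w i ∈ M ⊔ N := by
        rw [← hw, lie_add, lie_add, hζN n hn, hζM m hm, hζB b hb,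
          show n + 0 + -b + (n + m + b) = m + (n + n) by abel]
        exact Submodule.add_mem_sup hm (add_mem hn hn)
      have : π (g ⁅ζ, w i⁆) = (-1 : k) • π (g (w i)) := by
        have h0 := hπ0 _ (hgp _ hmem)
        rw [map_add, map_add] at h0
        rw [neg_one_smul]
        exact eq_neg_of_add_eq_zero_left h0
      have hfun : (fun i' => g (Function.update w i ⁅ζ, w i⁆ i')) =
          Function.update (fun i' => g (w i')) i (g ⁅ζ, w i⁆) := by
        ext j
        by_cases hj : j = i
        · subst hj; simp
        · simp [hj]
      rw [hψ, hψ, hfun, hωupd, this, AlternatingMap.map_update_smul,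
        Function.update_eq_self i (fun i' => π (g (w i'))), hω, neg_one_smul]
    rw [hlie, Finset.sum_congr rfl fun i _ => hi i]
    simp
  obtain ⟨r, hr, hrc⟩ := exists_nat_of_mem_iSup_tower hζN hζω hψW hψ0 hζψ
  have : (r : k) = (2 * Fintype.card ι : ℕ) := by
    push_cast
    rw [two_mul]
    nth_rw 1 [hrc]
    rw [hrc]
    ring
  have := Nat.cast_injective (R := k) this
  omega

end Trace

/-! ### The grading attached to a simple root -/

section Grading

open LieAlgebra LieAlgebra.IsKilling

variable {k : Type u} {L : Type v} [Field k] [CharZero k] [LieRing L] [LieAlgebra k L]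
  [FiniteDimensional k L] [LieAlgebra.IsKilling k L]
  {H : LieSubalgebra k L} [H.IsCartanSubalgebra] [LieModule.IsTriangularizable k H L]

/-- The element `ζ` of the Cartan subalgebra with `α(ζ) = m_j(α)` for all roots `α`. -/
theorem exists_gradingElement (b : (rootSystem H).Base) (j : b.support) :
    ∃ ζ : H, ∀ α : H.root, (α : LieModule.Weight k H L) ζ = (simpleCoeff b j α : k) := by
  refine ⟨(Module.evalEquiv k H).symm (b.toWeightBasis.coord j), fun α => ?_⟩
  have h1 : (α : LieModule.Weight k H L) ((Module.evalEquiv k H).symm (b.toWeightBasis.coord j)) =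
      b.toWeightBasis.coord j ((rootSystem H).root α) :=
    Module.apply_evalEquiv_symm_apply k H ((rootSystem H).root α) (b.toWeightBasis.coord j)
  have h2 : (rootSystem H).root α = ∑ i, simpleCoeff b i α • (rootSystem H).root i := by
    have h3 := congrArg Subtype.val
      (b.toWeightBasisInt.sum_repr ((rootSystem H).rootSpanMem ℤ α))
    rw [AddSubmonoidClass.coe_finsetSum] at h3
    simp only [Submodule.coe_smul, RootPairing.Base.coe_toWeightBasisInt_apply] at h3
    exact h3.symm
  rw [h1, h2, map_sum, Finset.sum_eq_single j]
  · rw [map_zsmul, Module.Basis.coord_apply, RootPairing.Base.toWeightBasis_repr_root]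
    simp
  · intro i _ hij
    rw [map_zsmul, Module.Basis.coord_apply, RootPairing.Base.toWeightBasis_repr_root]
    simp [hij]
  · simp

variable {b : (rootSystem H).Base} {j : b.support}

theorem simpleCoeff_add {α β γ : H.root}
    (h : ∀ x : H, (γ : LieModule.Weight k H L) x =
      (α : LieModule.Weight k H L) x + (β : LieModule.Weight k H L) x) :
    simpleCoeff b j γ = simpleCoeff b j α + simpleCoeff b j β := by
  obtain ⟨ζ, hζ⟩ := exists_gradingElement b j
  have := h ζ
  rw [hζ, hζ, hζ] at this
  exact_mod_cast this

theorem simpleCoeff_neg {α β : H.root}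
    (h : ∀ x : H, (β : LieModule.Weight k H L) x = -(α : LieModule.Weight k H L) x) :
    simpleCoeff b j β = -simpleCoeff b j α := by
  obtain ⟨ζ, hζ⟩ := exists_gradingElement b j
  have := h ζ
  rw [hζ, hζ] at this
  exact_mod_cast this

theorem simpleCoeff_of_mem_support {i : H.root} (hi : i ∈ b.support) :
    simpleCoeff b j i = 0 ∨ simpleCoeff b j i = 1 := by
  have h : (rootSystem H).rootSpanMem ℤ i = b.toWeightBasisInt ⟨i, hi⟩ :=
    Subtype.ext (by rw [RootPairing.Base.coe_toWeightBasisInt_apply])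
  classical
  rw [simpleCoeff, h, Module.Basis.repr_self, Finsupp.single_apply]
  split_ifs <;> simp

theorem simpleCoeff_self : simpleCoeff b j j = 1 := by
  have h : (rootSystem H).rootSpanMem ℤ (j : H.root) = b.toWeightBasisInt j :=
    Subtype.ext (by rw [RootPairing.Base.coe_toWeightBasisInt_apply])
  rw [simpleCoeff, h, Module.Basis.repr_self, Finsupp.single_eq_same]

omit [CharZero k] [LieAlgebra.IsKilling k L] [LieModule.IsTriangularizable k H L] in
theorem exists_mem_rootSpace_ne_zero (α : H.root) :
    ∃ x ∈ rootSpace H (α : LieModule.Weight k H L), x ≠ 0 := by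
  by_contra! h
  exact (α : LieModule.Weight k H L).genWeightSpace_ne_bot' ((LieSubmodule.eq_bot_iff _).2 h)

theorem mem_span_singleton_of_mem_rootSpace {α : H.root} {x y : L}
    (hx : x ∈ rootSpace H (α : LieModule.Weight k H L)) (hx0 : x ≠ 0)
    (hy : y ∈ rootSpace H (α : LieModule.Weight k H L)) : ∃ t : k, t • x = y := by
  obtain ⟨t, ht⟩ := (finrank_eq_one_iff_of_nonzero'
    (⟨x, hx⟩ : rootSpace H (α : LieModule.Weight k H L))
    (fun h => hx0 (congrArg Subtype.val h))).1
    (finrank_rootSpace_eq_one _ (H.isNonZero_coe_root α)) ⟨y, hy⟩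
  exact ⟨t, congrArg Subtype.val ht⟩

omit [CharZero k] [LieAlgebra.IsKilling k L] [LieModule.IsTriangularizable k H L] in
theorem exists_root_of_mem_rootSpace {χ : H → k} (hχ : χ ≠ 0) {x : L} (hx : x ∈ rootSpace H χ)
    (hx0 : x ≠ 0) : ∃ α : H.root, ((α : LieModule.Weight k H L) : H → k) = χ := by
  let α : LieModule.Weight k H L := ⟨χ, fun h => hx0 ((LieSubmodule.eq_bot_iff _).1 h x hx)⟩
  exact ⟨⟨α, Finset.mem_filter.2 ⟨Finset.mem_univ _, hχ⟩⟩, rfl⟩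

omit [CharZero k] in
theorem exists_neg_root (α : H.root) : ∃ β : H.root,
    ((β : LieModule.Weight k H L) : H → k) = -((α : LieModule.Weight k H L) : H → k) :=
  ⟨⟨-(α : LieModule.Weight k H L), by
    simpa using (H.isNonZero_coe_root α).neg⟩, by simp⟩

omit [CharZero k] [FiniteDimensional k L] [LieAlgebra.IsKilling k L]
  [LieModule.IsTriangularizable k H L] in
theorem lie_mem_rootSpace {χ ψ : H → k} {x y : L} (hx : x ∈ rootSpace H χ)
    (hy : y ∈ rootSpace H ψ) : ⁅x, y⁆ ∈ rootSpace H (χ + ψ) :=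
  lie_mem_genWeightSpace_of_mem_genWeightSpace hx hy

theorem mem_rootSum {p : ℤ → Prop} {α : H.root} (hα : p (simpleCoeff b j α)) {x : L}
    (hx : x ∈ rootSpace H (α : LieModule.Weight k H L)) : x ∈ rootSum b j p :=
  Submodule.mem_iSup_of_mem α (Submodule.mem_iSup_of_mem hα hx)

theorem rootSum_induction {p : ℤ → Prop} {P : L → Prop}
    (hmem : ∀ α : H.root, p (simpleCoeff b j α) →
      ∀ x ∈ rootSpace H (α : LieModule.Weight k H L), P x)
    (zero : P 0) (add : ∀ x y, P x → P y → P (x + y)) {x : L} (hx : x ∈ rootSum b j p) : P x := by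
  refine Submodule.iSup_induction _ (motive := P) hx (fun α y hy => ?_) zero add
  exact Submodule.iSup_induction _ (motive := P) hy (fun hα z hz => hmem α hα z hz) zero add

/-- If the roots `α`, `β` and `α + β` have positive coefficients at `α_j`, then the corresponding
root spaces do not all commute: otherwise `𝔤_{α+β}` would have weight `0` for the `𝔰𝔩₂` of `α`,
and `𝔤_β` would consist of vectors of weight `-2` killed by `e_α`. -/
theorem not_root_add_of_pos (hab : ∀ x ∈ nilradical b j, ∀ y ∈ nilradical b j, ⁅x, y⁆ = 0)
    {α β γ : H.root} (h : ∀ x : H, (γ : LieModule.Weight k H L) x =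
      (α : LieModule.Weight k H L) x + (β : LieModule.Weight k H L) x)
    (hα : 0 < simpleCoeff b j α) (hβ : 0 < simpleCoeff b j β) : False := by
  have hγ : 0 < simpleCoeff b j γ := by rw [simpleCoeff_add h]; omega
  obtain ⟨t, e, f, hsl, he, hf⟩ := exists_isSl2Triple_of_weight_isNonZero (H.isNonZero_coe_root α)
  obtain ⟨x, hx, hx0⟩ := exists_mem_rootSpace_ne_zero β
  obtain ⟨z, hz, hz0⟩ := exists_mem_rootSpace_ne_zero γ
  obtain rfl := hsl.h_eq_coroot (H.isNonZero_coe_root α) he hf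
  have hfz : ⁅f, z⁆ ∈ nilradical b j := by
    refine mem_rootSum hβ ?_
    have := lie_mem_rootSpace hf hz
    rwa [show -((α : LieModule.Weight k H L) : H → k) + (γ : LieModule.Weight k H L) =
      (β : LieModule.Weight k H L) from funext fun y => by
        rw [Pi.add_apply, Pi.neg_apply, h]; ring] at this
  have h1 := lie_eq_smul_of_mem_rootSpace hz (coroot (α : LieModule.Weight k H L))
  rw [LieSubalgebra.coe_bracket_of_module, ← hsl.lie_e_f, lie_lie,
    hab e (mem_rootSum hα he) z (mem_rootSum hγ hz), hab e (mem_rootSum hα he) _ hfz, lie_zero,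
    sub_zero, h, root_apply_coroot (H.isNonZero_coe_root α)] at h1
  have h2 := (smul_eq_zero.1 h1.symm).resolve_right hz0
  have h3 := lie_eq_smul_of_mem_rootSpace hx (coroot (α : LieModule.Weight k H L))
  obtain ⟨n, hn⟩ := (IsSl2Triple.HasPrimitiveVectorWith.mk hx0 h3
    (hab e (mem_rootSum hα he) x (mem_rootSum hβ hx)) :
    IsSl2Triple.HasPrimitiveVectorWith hsl x _).exists_nat
  rw [hn] at h2
  exact absurd h2 (by exact_mod_cast (show 2 + n ≠ 0 by omega))

/-- A positive root is obtained from a simple one by adding simple roots one at a time, and its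
coefficient at `α_j` cannot pass from `1` to `2` on the way. -/
theorem simpleCoeff_trichotomy
    (hab : ∀ x ∈ nilradical b j, ∀ y ∈ nilradical b j, ⁅x, y⁆ = 0) (α : H.root) :
    simpleCoeff b j α = -1 ∨ simpleCoeff b j α = 0 ∨ simpleCoeff b j α = 1 := by
  have hpos : ∀ α : H.root, b.IsPos α → simpleCoeff b j α = 0 ∨ simpleCoeff b j α = 1 := by
    intro α hα
    refine hα.induction_on_add (p := fun α => simpleCoeff b j α = 0 ∨ simpleCoeff b j α = 1)
      (fun i hi => simpleCoeff_of_mem_support hi) fun i i' l hl hi hi' => ?_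
    have hadd : ∀ x : H, (l : LieModule.Weight k H L) x =
        (i : LieModule.Weight k H L) x + (i' : LieModule.Weight k H L) x :=
      fun x => LinearMap.congr_fun hl x
    have h := simpleCoeff_add (b := b) (j := j) hadd
    have hi'' := simpleCoeff_of_mem_support (j := j) hi'
    have := not_root_add_of_pos hab hadd
    rcases hi with hi | hi <;> rcases hi'' with hi'' | hi''
    · left; omega
    · right; omega
    · right; omega
    · exact (this (by omega) (by omega)).elim
  rcases RootPairing.Base.IsPos.or_neg b α with h | h
  · have := hpos _ h
    omega
  · have h1 := hpos _ h
    rw [simpleCoeff_neg (α := α)] at h1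
    · omega
    · intro x
      refine LinearMap.congr_fun (f := (rootSystem H).root ((rootSystem H).reflectionPerm α α))
        (g := -(rootSystem H).root α) ?_ x
      rw [RootPairing.root_reflectionPerm, RootPairing.reflection_apply_self]

theorem simpleCoeff_eq_one (hab : ∀ x ∈ nilradical b j, ∀ y ∈ nilradical b j, ⁅x, y⁆ = 0)
    {α : H.root} (hα : 0 < simpleCoeff b j α) : simpleCoeff b j α = 1 := by
  have := simpleCoeff_trichotomy hab α
  omega

end Grading

/-! ### Three-gradings of simple Lie algebras -/

/-- A decomposition `L = N ⊕ M ⊕ B` into the eigenspaces of `ad ζ` for the eigenvalues `1`, `0` and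
`-1`. -/
structure ThreeGrading (k : Type*) {L : Type*} [Field k] [LieRing L] [LieAlgebra k L]
    (ζ : L) (N M B : Submodule k L) : Prop where
  sup_eq_top : N ⊔ M ⊔ B = ⊤
  lie_N : ∀ x ∈ N, ⁅ζ, x⁆ = x
  lie_M : ∀ x ∈ M, ⁅ζ, x⁆ = 0
  lie_B : ∀ x ∈ B, ⁅ζ, x⁆ = -x

namespace ThreeGrading

variable {k L : Type*} [Field k] [CharZero k] [LieRing L] [LieAlgebra k L]
  {ζ : L} {N M B : Submodule k L} (G : ThreeGrading k ζ N M B)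

include G

omit [CharZero k] in
theorem exists_decomp (x : L) : ∃ n ∈ N, ∃ m ∈ M, ∃ b ∈ B, n + m + b = x := by
  obtain ⟨y, hy, b, hb, rfl⟩ := Submodule.mem_sup.1 (G.sup_eq_top ▸ Submodule.mem_top (x := x))
  obtain ⟨n, hn, m, hm, rfl⟩ := Submodule.mem_sup.1 hy
  exact ⟨n, hn, m, hm, b, hb, rfl⟩

theorem decomp_eq_zero {n m b : L} (hn : n ∈ N) (hm : m ∈ M) (hb : b ∈ B) (h : n + m + b = 0) :
    n = 0 ∧ m = 0 ∧ b = 0 := by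
  have h1 : n - b = 0 := by
    have := congrArg (fun x => ⁅ζ, x⁆) h
    simpa [G.lie_N n hn, G.lie_M m hm, G.lie_B b hb, ← sub_eq_add_neg] using this
  have h2 : n + b = 0 := by
    have := congrArg (fun x => ⁅ζ, x⁆) h1
    simpa [G.lie_N n hn, G.lie_B b hb] using this
  have h3 : (2 : k) • n = 0 := by
    rw [two_smul]
    calc n + n = (n - b) + (n + b) := by abel
      _ = 0 := by rw [h1, h2, add_zero]
  obtain rfl := (smul_eq_zero.1 h3).resolve_left two_ne_zero
  obtain rfl : b = 0 := by simpa using h2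
  simpa using h

theorem eq_of_lie_eq_smul {t : k} {x : L} (hx : ⁅ζ, x⁆ = t • x) : ∃ n ∈ N, ∃ m ∈ M, ∃ b ∈ B,
    n + m + b = x ∧ (1 - t) • n = 0 ∧ t • m = 0 ∧ (1 + t) • b = 0 := by
  obtain ⟨n, hn, m, hm, b, hb, rfl⟩ := G.exists_decomp x
  obtain ⟨h1, h2, h3⟩ := G.decomp_eq_zero (N.smul_mem (1 - t) hn) (M.smul_mem (-t) hm)
    (B.smul_mem (-(1 + t)) hb) (by
      rw [lie_add, lie_add, G.lie_N n hn, G.lie_M m hm, G.lie_B b hb] at hx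
      calc _ = (n + 0 + -b) - t • (n + m + b) := by module
        _ = 0 := by rw [hx, sub_self])
  exact ⟨n, hn, m, hm, b, hb, rfl, h1, by simpa using h2, by
    rwa [neg_smul, neg_eq_zero] at h3⟩

theorem mem_N {x : L} (hx : ⁅ζ, x⁆ = x) : x ∈ N := by
  obtain ⟨n, hn, m, hm, b, hb, rfl, -, h2, h3⟩ :=
    G.eq_of_lie_eq_smul (t := 1) (by rw [hx, one_smul])
  rw [one_add_one_eq_two, smul_eq_zero_iff_right two_ne_zero] at h3
  rw [one_smul] at h2
  simpa [h2, h3] using hn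

theorem mem_M {x : L} (hx : ⁅ζ, x⁆ = 0) : x ∈ M := by
  obtain ⟨n, hn, m, hm, b, hb, rfl, h1, -, h3⟩ :=
    G.eq_of_lie_eq_smul (t := 0) (by rw [hx, zero_smul])
  rw [sub_zero, one_smul] at h1
  rw [add_zero, one_smul] at h3
  simpa [h1, h3] using hm

theorem mem_B {x : L} (hx : ⁅ζ, x⁆ = -x) : x ∈ B := by
  obtain ⟨n, hn, m, hm, b, hb, rfl, h1, h2, -⟩ := G.eq_of_lie_eq_smul (t := -1) (by rw [hx]; simp)
  rw [sub_neg_eq_add, one_add_one_eq_two, smul_eq_zero_iff_right two_ne_zero] at h1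
  rw [neg_smul, one_smul, neg_eq_zero] at h2
  simpa [h1, h2] using hb

theorem eq_zero_of_lie_eq_smul {t : k} (h1 : t ≠ 1) (h0 : t ≠ 0) (hn1 : t ≠ -1) {x : L}
    (hx : ⁅ζ, x⁆ = t • x) : x = 0 := by
  obtain ⟨n, hn, m, hm, b, hb, rfl, h2, h3, h4⟩ := G.eq_of_lie_eq_smul hx
  rw [smul_eq_zero_iff_right (sub_ne_zero.2 h1.symm)] at h2
  rw [smul_eq_zero_iff_right h0] at h3
  rw [smul_eq_zero_iff_right fun h => hn1 (by rw [← neg_eq_of_add_eq_zero_right h])] at h4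
  simp [h2, h3, h4]

theorem lie_N_N {x y : L} (hx : x ∈ N) (hy : y ∈ N) : ⁅x, y⁆ = 0 :=
  G.eq_zero_of_lie_eq_smul (t := 2) (by norm_num) two_ne_zero (by norm_num) (by
    rw [leibniz_lie, G.lie_N x hx, G.lie_N y hy, two_smul])

theorem lie_B_B {x y : L} (hx : x ∈ B) (hy : y ∈ B) : ⁅x, y⁆ = 0 :=
  G.eq_zero_of_lie_eq_smul (t := -2) (by norm_num) (by norm_num) (by norm_num) (by
    rw [leibniz_lie, G.lie_B x hx, G.lie_B y hy, neg_lie, lie_neg, neg_smul, two_smul, neg_add])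

theorem lie_N_B {x y : L} (hx : x ∈ N) (hy : y ∈ B) : ⁅x, y⁆ ∈ M :=
  G.mem_M (by rw [leibniz_lie, G.lie_N x hx, G.lie_B y hy, lie_neg, add_neg_cancel])

theorem lie_B_N {x y : L} (hx : x ∈ B) (hy : y ∈ N) : ⁅x, y⁆ ∈ M := by
  rw [← lie_skew]
  exact neg_mem (G.lie_N_B hy hx)

theorem lie_M_N {x y : L} (hx : x ∈ M) (hy : y ∈ N) : ⁅x, y⁆ ∈ N :=
  G.mem_N (by rw [leibniz_lie, G.lie_M x hx, G.lie_N y hy, zero_lie, zero_add])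

theorem lie_M_B {x y : L} (hx : x ∈ M) (hy : y ∈ B) : ⁅x, y⁆ ∈ B :=
  G.mem_B (by rw [leibniz_lie, G.lie_M x hx, G.lie_B y hy, zero_lie, zero_add, lie_neg])

theorem lie_M_M {x y : L} (hx : x ∈ M) (hy : y ∈ M) : ⁅x, y⁆ ∈ M :=
  G.mem_M (by rw [leibniz_lie, G.lie_M x hx, G.lie_M y hy, zero_lie, lie_zero, add_zero])

/-- If `L` is simple and `N ≠ 0`, then `M = [N, B]`, because `N + [N, B] + B` is an ideal. -/
theorem M_le_span [LieAlgebra.IsSimple k L] (hN : N ≠ ⊥) :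
    M ≤ Submodule.span k {z | ∃ x ∈ N, ∃ y ∈ B, ⁅x, y⁆ = z} := by
  set D := Submodule.span k {z | ∃ x ∈ N, ∃ y ∈ B, ⁅x, y⁆ = z} with hD
  have hsub : ∀ {x y : L}, x ∈ N → y ∈ B → ⁅x, y⁆ ∈ D := fun hx hy =>
    Submodule.subset_span ⟨_, hx, _, hy, rfl⟩
  have hDM : D ≤ M := by
    refine Submodule.span_le.2 ?_
    rintro _ ⟨x, hx, y, hy, rfl⟩
    exact G.lie_N_B hx hy
  have hMD : ∀ {m d : L}, m ∈ M → d ∈ D → ⁅m, d⁆ ∈ D := by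
    intro m d hm hd
    refine Submodule.span_induction (p := fun d _ => ⁅m, d⁆ ∈ D) ?_ ?_ ?_ ?_ hd
    · rintro _ ⟨x, hx, y, hy, rfl⟩
      rw [leibniz_lie]
      exact add_mem (hsub (G.lie_M_N hm hx) hy) (hsub hx (G.lie_M_B hm hy))
    · simp
    · intro u u' _ _ h h'
      rw [lie_add]
      exact add_mem h h'
    · intro t u _ h
      rw [lie_smul]
      exact Submodule.smul_mem _ _ h
  have hNI : N ≤ N ⊔ D ⊔ B := le_sup_left.trans le_sup_left
  have hDI : D ≤ N ⊔ D ⊔ B := le_sup_right.trans le_sup_left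
  have hBI : B ≤ N ⊔ D ⊔ B := le_sup_right
  let I : LieIdeal k L :=
    { N ⊔ D ⊔ B with
      lie_mem := by
        intro z w hw
        change ⁅z, w⁆ ∈ N ⊔ D ⊔ B
        obtain ⟨n, hn, m, hm, b, hb, rfl⟩ := G.exists_decomp z
        obtain ⟨y, hy, b', hb', rfl⟩ := Submodule.mem_sup.1 hw
        obtain ⟨n', hn', d, hd, rfl⟩ := Submodule.mem_sup.1 hy
        simp only [add_lie, lie_add]
        refine add_mem (add_mem (add_mem (add_mem ?_ ?_) ?_) (add_mem (add_mem ?_ ?_) ?_))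
          (add_mem (add_mem ?_ ?_) ?_)
        · rw [G.lie_N_N hn hn']; exact zero_mem _
        · exact hNI (G.lie_M_N hm hn')
        · rw [← lie_skew]; exact neg_mem (hDI (hsub hn' hb))
        · rw [← lie_skew]; exact neg_mem (hNI (G.lie_M_N (hDM hd) hn))
        · exact hDI (hMD hm hd)
        · rw [← lie_skew]; exact neg_mem (hBI (G.lie_M_B (hDM hd) hb))
        · exact hDI (hsub hn hb')
        · exact hBI (G.lie_M_B hm hb')
        · rw [G.lie_B_B hb hb']; exact zero_mem _ }
  have hI : ∀ x : L, x ∈ I ↔ x ∈ N ⊔ D ⊔ B := fun x => Iff.rfl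
  intro m hm
  rcases LieAlgebra.IsSimple.eq_bot_or_eq_top (R := k) I with h | h
  · obtain ⟨x, hx, hx0⟩ := (Submodule.ne_bot_iff N).1 hN
    have : x ∈ I := hNI hx
    rw [h] at this
    exact (hx0 this).elim
  · have : m ∈ N ⊔ D ⊔ B := (hI m).1 (h ▸ LieSubmodule.mem_top m)
    obtain ⟨y, hy, b, hb, hyb⟩ := Submodule.mem_sup.1 this
    obtain ⟨n, hn, d, hd, rfl⟩ := Submodule.mem_sup.1 hy
    obtain ⟨rfl, h2, rfl⟩ := G.decomp_eq_zero hn (sub_mem (hDM hd) hm) hb (by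
      rw [← hyb]; abel)
    rw [sub_eq_zero] at h2
    rwa [← h2]

/-- An element that commutes with `N` and `B` is central, as these generate `L`. -/
theorem eq_zero_of_lie_eq_zero [FiniteDimensional k L] [LieAlgebra.IsSimple k L] (hN : N ≠ ⊥)
    {z : L} (h1 : ∀ x ∈ N, ⁅z, x⁆ = 0) (h2 : ∀ y ∈ B, ⁅z, y⁆ = 0) : z = 0 := by
  have h3 : ∀ m ∈ M, ⁅z, m⁆ = 0 := by
    intro m hm
    refine Submodule.span_induction (p := fun m _ => ⁅z, m⁆ = 0) ?_ ?_ ?_ ?_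
      (G.M_le_span hN hm)
    · rintro _ ⟨x, hx, y, hy, rfl⟩
      rw [leibniz_lie, h1 x hx, h2 y hy, zero_lie, lie_zero, add_zero]
    · simp
    · intro u u' _ _ h h'
      rw [lie_add, h, h', add_zero]
    · intro t u _ h
      rw [lie_smul, h, smul_zero]
  have hz : z ∈ LieAlgebra.center k L := by
    rw [LieModule.mem_maxTrivSubmodule]
    intro w
    obtain ⟨n, hn, m, hm, b, hb, rfl⟩ := G.exists_decomp w
    rw [← lie_skew, lie_add, lie_add, h1 n hn, h3 m hm, h2 b hb]
    simp
  rw [LieAlgebra.center_eq_bot] at hz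
  exact hz

/-- `M` acts faithfully on `N`: the kernel of the action annihilates `B` too, because `B` is dual to
`N` under the Killing form. -/
theorem faithful [FiniteDimensional k L] [LieAlgebra.IsSimple k L] (hN : N ≠ ⊥) {z : L}
    (hz : z ∈ M) (h1 : ∀ x ∈ N, ⁅z, x⁆ = 0) : z = 0 := by
  refine G.eq_zero_of_lie_eq_zero hN h1 fun y hy => ?_
  have hw := G.lie_M_B hz hy
  have hinv : ∀ a b c : L, killingForm k L ⁅a, b⁆ c = killingForm k L a ⁅b, c⁆ :=
    LieModule.traceForm_apply_lie_apply k L L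
  have hζ : ∀ c, killingForm k L ⁅z, y⁆ c = killingForm k L ⁅z, y⁆ ⁅ζ, c⁆ := by
    intro c
    rw [← hinv, ← lie_skew _ ζ, G.lie_B _ hw, neg_neg]
  refine (LieAlgebra.IsKilling.killingForm_nondegenerate k L).1 _ fun c => ?_
  obtain ⟨n, hn, m, hm, b, hb, rfl⟩ := G.exists_decomp c
  have e1 : killingForm k L ⁅z, y⁆ n = 0 := by
    rw [← lie_skew, map_neg, LinearMap.neg_apply, hinv, h1 n hn, map_zero, neg_zero]
  have e2 : killingForm k L ⁅z, y⁆ m = 0 := by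
    rw [hζ, G.lie_M m hm, map_zero]
  have e3 : killingForm k L ⁅z, y⁆ b = 0 := by
    have := hζ b
    rw [G.lie_B b hb, map_neg] at this
    exact self_eq_neg.1 this
  rw [map_add, map_add, e1, e2, e3, add_zero, add_zero]

end ThreeGrading

/-! ### The triple attached to strongly orthogonal roots -/

section Triple

open LieAlgebra LieAlgebra.IsKilling

variable {k : Type u} {L : Type v} [Field k] [CharZero k] [LieRing L] [LieAlgebra k L]
  [FiniteDimensional k L] [LieAlgebra.IsKilling k L]
  {H : LieSubalgebra k L} [H.IsCartanSubalgebra] [LieModule.IsTriangularizable k H L]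
  {b : (rootSystem H).Base} {j : b.support}

theorem threeGrading (hab : ∀ x ∈ nilradical b j, ∀ y ∈ nilradical b j, ⁅x, y⁆ = 0) {ζ : H}
    (hζ : ∀ α : H.root, (α : LieModule.Weight k H L) ζ = (simpleCoeff b j α : k)) :
    ThreeGrading k (ζ : L) (nilradical b j) (levi b j) (oppNilradical b j) := by
  have hlie : ∀ (α : H.root) (x : L), x ∈ rootSpace H (α : LieModule.Weight k H L) →
      ⁅(ζ : L), x⁆ = (simpleCoeff b j α : k) • x := fun α x hx => by
    rw [← hζ]
    exact lie_eq_smul_of_mem_rootSpace hx ζ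
  refine ⟨?_, fun x hx => ?_, fun x hx => ?_, fun x hx => ?_⟩
  · have hN : nilradical b j ≤ nilradical b j ⊔ levi b j ⊔ oppNilradical b j :=
      le_sup_left.trans le_sup_left
    have hM : levi b j ≤ nilradical b j ⊔ levi b j ⊔ oppNilradical b j :=
      le_sup_right.trans le_sup_left
    have hB : oppNilradical b j ≤ nilradical b j ⊔ levi b j ⊔ oppNilradical b j := le_sup_right
    have h := congrArg LieSubmodule.toSubmodule (LieModule.iSup_genWeightSpace_eq_top' k H L)
    rw [LieSubmodule.iSup_toSubmodule, LieSubmodule.top_toSubmodule] at h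
    refine top_le_iff.1 (h.symm.trans_le (iSup_le fun χ x hx => ?_))
    by_cases hχ : χ.IsZero
    · have hx' : x ∈ rootSpace H (0 : H → k) := hχ ▸ hx
      rw [rootSpace_zero_eq] at hx'
      exact hM ((le_sup_left : H.toSubmodule ≤ levi b j) hx')
    · obtain ⟨α, rfl⟩ : ∃ α : H.root, (α : LieModule.Weight k H L) = χ :=
        ⟨⟨χ, Finset.mem_filter.2 ⟨Finset.mem_univ _, hχ⟩⟩, rfl⟩
      rcases lt_trichotomy (simpleCoeff b j α) 0 with hm | hm | hm
      · exact hB (mem_rootSum (p := fun m => m < 0) hm hx)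
      · exact hM ((le_sup_right : rootSum b j (fun m => m = 0) ≤ levi b j)
          (mem_rootSum (p := fun m => m = 0) hm hx))
      · exact hN (mem_rootSum (p := fun m => 0 < m) hm hx)
  · refine rootSum_induction (P := fun x => ⁅(ζ : L), x⁆ = x) (fun α hα x hx => ?_) (by simp)
      (fun x y h h' => by rw [lie_add, h, h']) hx
    rw [hlie α x hx, simpleCoeff_eq_one hab hα]
    simp
  · obtain ⟨t, ht, y, hy, rfl⟩ := Submodule.mem_sup.1 hx
    rw [lie_add]
    have h1 : ⁅(ζ : L), t⁆ = 0 := by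
      have := LieAlgebra.IsKilling.instIsLieAbelianOfIsCartanSubalgebra k L H
      exact congrArg Subtype.val (trivial_lie_zero H H ζ ⟨t, ht⟩)
    rw [h1, zero_add]
    refine rootSum_induction (P := fun x => ⁅(ζ : L), x⁆ = 0) (fun α hα x hx => ?_) (by simp)
      (fun x y h h' => by rw [lie_add, h, h']; simp) hy
    rw [hlie α x hx, hα]
    simp
  · refine rootSum_induction (P := fun x => ⁅(ζ : L), x⁆ = -x) (fun α hα x hx => ?_) (by simp)
      (fun x y h h' => by rw [lie_add, h, h', neg_add]) hx
    have : simpleCoeff b j α = -1 := by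
      have := simpleCoeff_trichotomy hab α
      omega
    rw [hlie α x hx, this]
    simp

theorem StronglyOrthogonal.symm {ι R M N : Type*} [CommRing R] [AddCommGroup M] [Module R M]
    [AddCommGroup N] [Module R N] {P : RootPairing ι R M N} {α β : ι}
    (h : StronglyOrthogonal P α β) : StronglyOrthogonal P β α := by
  refine ⟨by rw [add_comm]; exact h.1, fun h' => h.2 ?_⟩
  rcases h' with h' | ⟨i, hi⟩
  · exact Or.inl (by rw [← neg_sub, h', neg_zero])
  · exact Or.inr ⟨P.reflectionPerm i i, by
      rw [RootPairing.root_reflectionPerm, RootPairing.reflection_apply_self, hi, neg_sub]⟩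

theorem StronglyOrthogonal.lie_eq_zero {α β : H.root}
    (h : StronglyOrthogonal (rootSystem H) α β) {x y : L}
    (hx : x ∈ rootSpace H (α : LieModule.Weight k H L))
    (hy : y ∈ rootSpace H (-(β : LieModule.Weight k H L))) : ⁅x, y⁆ = 0 := by
  by_contra h0
  have hxy := lie_mem_rootSpace hx hy
  refine h.2 (or_iff_not_imp_left.2 fun hne => ?_)
  have hχ : (((α : LieModule.Weight k H L) : H → k) + -(β : LieModule.Weight k H L)) ≠ 0 := by
    refine fun hχ => hne (LinearMap.ext fun t => ?_)
    have := congrFun hχ t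
    simpa [sub_eq_add_neg] using this
  obtain ⟨γ, hγ⟩ := exists_root_of_mem_rootSpace hχ hxy h0
  refine ⟨γ, LinearMap.ext fun t => ?_⟩
  have := congrFun hγ t
  simpa [sub_eq_add_neg] using this

/-- The data of a maximal set `S` of strongly orthogonal roots of `𝔫` together with an `𝔰𝔩₂`-triple
for every root in `S`. -/
structure TripleData (b : (rootSystem H).Base) (j : b.support) (S : Finset H.root)
    (fs hs es : H.root → L) : Prop where
  comm : ∀ x ∈ nilradical b j, ∀ y ∈ nilradical b j, ⁅x, y⁆ = 0
  maximal : IsMaximalStronglyOrthogonal b j S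
  mem_e : ∀ α ∈ S, es α ∈ rootSpace H (α : LieModule.Weight k H L)
  mem_f : ∀ α ∈ S, fs α ∈ rootSpace H (-(α : LieModule.Weight k H L))
  triple : ∀ α ∈ S, IsSl2Triple (hs α) (es α) (fs α)

namespace TripleData

variable {S : Finset H.root} {fs hs es : H.root → L} (D : TripleData b j S fs hs es)

include D

theorem pos {α : H.root} (hα : α ∈ S) : 0 < simpleCoeff b j α := D.maximal.1.1 α hα

theorem mem_nilradical {α : H.root} (hα : α ∈ S) : es α ∈ nilradical b j :=
  mem_rootSum (p := fun m => 0 < m) (D.pos hα) (D.mem_e α hα)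

theorem mem_oppNilradical {α : H.root} (hα : α ∈ S) : fs α ∈ oppNilradical b j := by
  obtain ⟨β, hβ⟩ := exists_neg_root α
  refine mem_rootSum (p := fun m => m < 0) (α := β) ?_ (by rw [hβ]; exact D.mem_f α hα)
  rw [simpleCoeff_neg (α := α) (fun x => congrFun hβ x)]
  have := D.pos hα
  omega

theorem hs_eq {α : H.root} (hα : α ∈ S) : hs α = (coroot (α : LieModule.Weight k H L) : L) :=
  (D.triple α hα).h_eq_coroot (H.isNonZero_coe_root α) (D.mem_e α hα) (D.mem_f α hα)

theorem lie_e_f {α β : H.root} (hα : α ∈ S) (hβ : β ∈ S) (hne : α ≠ β) : ⁅es α, fs β⁆ = 0 :=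
  (D.maximal.1.2 hα hβ hne).lie_eq_zero (D.mem_e α hα) (D.mem_f β hβ)

theorem lie_f_f {α β : H.root} (hα : α ∈ S) (hβ : β ∈ S) : ⁅fs α, fs β⁆ = 0 := by
  obtain ⟨ζ, hζ⟩ := exists_gradingElement b j
  exact (threeGrading D.comm hζ).lie_B_B (D.mem_oppNilradical hα) (D.mem_oppNilradical hβ)

theorem lie_h_e {α β : H.root} (hα : α ∈ S) (hβ : β ∈ S) (hne : α ≠ β) : ⁅hs α, es β⁆ = 0 := by
  rw [← (D.triple α hα).lie_e_f, lie_lie, ← lie_skew (fs α) (es β), D.lie_e_f hβ hα hne.symm,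
    D.comm _ (D.mem_nilradical hα) _ (D.mem_nilradical hβ)]
  simp

theorem lie_h_f {α β : H.root} (hα : α ∈ S) (hβ : β ∈ S) (hne : α ≠ β) : ⁅hs α, fs β⁆ = 0 := by
  rw [← (D.triple α hα).lie_e_f, lie_lie, D.lie_f_f hα hβ, D.lie_e_f hα hβ hne]
  simp

theorem nonempty : S.Nonempty := by
  rw [Finset.nonempty_iff_ne_empty]
  rintro rfl
  have h := D.maximal.2 (y := {(j : H.root)})
    ⟨by simp [simpleCoeff_self], by simp⟩ (Finset.empty_subset _)
  simp at h

variable {f h e : L} (hf : f = ∑ α ∈ S, fs α) (hh : h = ∑ α ∈ S, hs α) (he : e = ∑ α ∈ S, es α)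

include hf hh he in
theorem isSl2Triple : IsSl2Triple h e f := by
  subst hf hh he
  have h1 : ∀ α ∈ S, ⁅∑ β ∈ S, hs β, es α⁆ = 2 • es α := fun α hα => by
    rw [sum_lie, Finset.sum_eq_single_of_mem α hα
      fun β hβ hne => D.lie_h_e hβ hα hne, (D.triple α hα).lie_h_e_nsmul]
  refine ⟨?_, ?_, ?_, ?_⟩
  · intro h0
    obtain ⟨α, hα⟩ := D.nonempty
    have h2 := h1 α hα
    rw [h0, zero_lie, eq_comm, ← Nat.cast_smul_eq_nsmul k] at h2
    exact (D.triple α hα).e_ne_zero ((smul_eq_zero.1 h2).resolve_left (by norm_num))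
  · rw [sum_lie]
    refine Finset.sum_congr rfl fun α hα => ?_
    rw [lie_sum, Finset.sum_eq_single_of_mem α hα
      fun β hβ hne => D.lie_e_f hα hβ hne.symm, (D.triple α hα).lie_e_f]
  · rw [lie_sum, Finset.smul_sum]
    exact Finset.sum_congr rfl h1
  · rw [lie_sum, Finset.smul_sum, ← Finset.sum_neg_distrib]
    refine Finset.sum_congr rfl fun α hα => ?_
    rw [sum_lie, Finset.sum_eq_single_of_mem α hα
      fun β hβ hne => D.lie_h_f hβ hα hne, (D.triple α hα).lie_h_f_nsmul]

/-- A root of `𝔫` takes natural values on the coroots of `S`. -/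
theorem exists_nat_coroot {γ : H.root} (hγ : 0 < simpleCoeff b j γ) {β : H.root} (hβ : β ∈ S) :
    ∃ n : ℕ, (γ : LieModule.Weight k H L) (coroot (β : LieModule.Weight k H L)) = n := by
  obtain ⟨x, hx, hx0⟩ := exists_mem_rootSpace_ne_zero γ
  have hlie := lie_eq_smul_of_mem_rootSpace hx (coroot (β : LieModule.Weight k H L))
  rw [LieSubalgebra.coe_bracket_of_module, ← D.hs_eq hβ] at hlie
  exact (IsSl2Triple.HasPrimitiveVectorWith.mk hx0 hlie
    (D.comm _ (D.mem_nilradical hβ) x (mem_rootSum (p := fun m => 0 < m) hγ hx)) :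
    IsSl2Triple.HasPrimitiveVectorWith (D.triple β hβ) x _).exists_nat

/-- By maximality of `S`, no root of `𝔫` vanishes on all coroots of `S`. -/
theorem exists_coroot_ne_zero {γ : H.root} (hγ : 0 < simpleCoeff b j γ) :
    ∃ β ∈ S, (γ : LieModule.Weight k H L) (coroot (β : LieModule.Weight k H L)) ≠ 0 := by
  classical
  by_contra! h0
  have hγS : γ ∉ S := fun hγS => two_ne_zero (α := k) <| by
    rw [← root_apply_coroot (H.isNonZero_coe_root γ)]
    exact h0 γ hγS
  obtain ⟨ζ, hζ⟩ := exists_gradingElement b j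
  have hadd : ∀ β ∈ S, (rootSystem H).root γ + (rootSystem H).root β ∉
      Set.range (rootSystem H).root := by
    rintro β hβ ⟨δ, hδ⟩
    exact not_root_add_of_pos D.comm (fun x => LinearMap.congr_fun hδ x) hγ (D.pos hβ)
  have horth : ∀ β ∈ S, StronglyOrthogonal (rootSystem H) γ β := by
    refine fun β hβ => ⟨?_, ?_⟩
    · rintro (h | h)
      · have h1 : (γ : LieModule.Weight k H L) ζ + (β : LieModule.Weight k H L) ζ = 0 :=
          LinearMap.congr_fun h ζ
        rw [hζ, hζ] at h1
        have h2 : simpleCoeff b j γ + simpleCoeff b j β = 0 := by exact_mod_cast h1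
        have := D.pos hβ
        omega
      · exact hadd β hβ h
    · rintro (h | ⟨δ, hδ⟩)
      · exact hγS ((rootSystem H).root.injective (sub_eq_zero.1 h) ▸ hβ)
      · -- the reflection in `β` maps the root `γ - β` to `γ + β`
        refine hadd β hβ ⟨(rootSystem H).reflectionPerm β δ, ?_⟩
        have h1 : (rootSystem H).root γ ((rootSystem H).coroot β) = 0 := h0 β hβ
        have h2 : (rootSystem H).root β ((rootSystem H).coroot β) = 2 :=
          root_apply_coroot (H.isNonZero_coe_root β)
        have h3 : (rootSystem H).root ((rootSystem H).reflectionPerm β δ) =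
            (rootSystem H).root δ -
              ((rootSystem H).root δ ((rootSystem H).coroot β)) • (rootSystem H).root β := by
          rw [RootPairing.root_reflectionPerm, RootPairing.reflection_apply]
          rfl
        rw [h3, hδ, LinearMap.sub_apply, h1, h2]
        module
  have hins := D.maximal.2 (y := insert γ S) ⟨?_, ?_⟩ (Finset.subset_insert γ S)
  · exact hγS (hins (Finset.mem_insert_self γ S))
  · intro α hα
    rcases Finset.mem_insert.1 hα with rfl | hα
    · exact hγ
    · exact D.pos hα
  · rw [Finset.coe_insert]
    exact D.maximal.1.2.insert fun β hβ _ => ⟨horth β hβ, (horth β hβ).symm⟩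

end TripleData

end Triple

/-! ### Self-opposite parabolics and tube gradings -/

section Tube

open LieAlgebra LieAlgebra.IsKilling

variable {k : Type u} {L : Type v} [Field k] [CharZero k] [LieRing L] [LieAlgebra k L]
  [FiniteDimensional k L]
  {H : LieSubalgebra k L} [H.IsCartanSubalgebra] [LieModule.IsTriangularizable k H L]

/-- A choice of root vectors is a basis of `𝔫`. -/
theorem exists_basis_nilradical [LieAlgebra.IsKilling k L] (b : (rootSystem H).Base)
    (j : b.support) :
    ∃ v : Module.Basis {γ : H.root // 0 < simpleCoeff b j γ} k (nilradical b j),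
      ∀ γ, (v γ : L) ∈ rootSpace H (γ.1 : LieModule.Weight k H L) := by
  choose x hx hx0 using fun γ : H.root => exists_mem_rootSpace_ne_zero γ
  let y : {γ : H.root // 0 < simpleCoeff b j γ} → nilradical b j :=
    fun γ => ⟨x γ.1, mem_rootSum (p := fun m => 0 < m) γ.2 (hx γ.1)⟩
  have hli : LinearIndependent k (fun γ => (y γ : L)) := by
    have hind := LieSubmodule.iSupIndep_toSubmodule.2 (LieModule.iSupIndep_genWeightSpace' k H L)
    exact (hind.comp (f := fun γ : {γ : H.root // 0 < simpleCoeff b j γ} =>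
      (γ.1 : LieModule.Weight k H L))
      (Subtype.val_injective.comp Subtype.val_injective)).linearIndependent _
      (fun γ => hx γ.1) (fun γ => hx0 γ.1)
  have hspan : ⊤ ≤ Submodule.span k (Set.range y) := by
    rw [← Submodule.map_le_map_iff_of_injective (nilradical b j).injective_subtype,
      Submodule.map_span, Submodule.map_top, Submodule.range_subtype]
    refine iSup_le fun γ => iSup_le fun hγ z hz => ?_
    obtain ⟨t, rfl⟩ := mem_span_singleton_of_mem_rootSpace (hx γ) (hx0 γ) hz
    exact Submodule.smul_mem _ _ (Submodule.subset_span ⟨y ⟨γ, hγ⟩, ⟨_, rfl⟩, rfl⟩)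
  refine ⟨Module.Basis.mk (LinearIndependent.of_comp (v := y) (nilradical b j).subtype hli) hspan,
    fun γ => ?_⟩
  rw [Module.Basis.mk_apply]
  exact hx γ.1

namespace TripleData

variable [LieAlgebra.IsSimple k L] {b : (rootSystem H).Base} {j : b.support}
  {S : Finset H.root} {fs hs es : H.root → L} (D : TripleData b j S fs hs es)
  {f h e : L} (hf : f = ∑ α ∈ S, fs α) (hh : h = ∑ α ∈ S, hs α) (he : e = ∑ α ∈ S, es α)

include D

include hh in
theorem exists_coe_eq : ∃ t : H, (t : L) = h ∧ ∀ γ : H.root,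
    (γ : LieModule.Weight k H L) t =
      ∑ β ∈ S, (γ : LieModule.Weight k H L) (coroot (β : LieModule.Weight k H L)) := by
  refine ⟨∑ β ∈ S, coroot (β : LieModule.Weight k H L), ?_, fun γ => ?_⟩
  · rw [hh, AddSubmonoidClass.coe_finsetSum]
    exact Finset.sum_congr rfl fun β hβ => (D.hs_eq hβ).symm
  · exact map_sum (LieModule.Weight.toLinear k H L γ) _ _

include he in
theorem sum_mem_nilradical : e ∈ nilradical b j :=
  he ▸ Submodule.sum_mem _ fun _ hα => D.mem_nilradical hα

include hf in
theorem sum_mem_oppNilradical : f ∈ oppNilradical b j :=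
  hf ▸ Submodule.sum_mem _ fun _ hα => D.mem_oppNilradical hα

include hf hh he in
/-- The weights of `h` on `𝔫` are `1` or `2`: they are positive by maximality of `S`, and at most
`2` because `(ad f)³` vanishes on `𝔫`. -/
theorem exists_weight {t : H} (ht : (t : L) = h) {γ : H.root} (hγ : 0 < simpleCoeff b j γ) :
    ∃ c : ℕ, 0 < c ∧ c ≤ 2 ∧ (γ : LieModule.Weight k H L) t = c := by
  obtain ⟨t', ht', hsum⟩ := D.exists_coe_eq hh
  obtain rfl : t = t' := Subtype.ext (ht.trans ht'.symm)
  choose! n hn using fun β (hβ : β ∈ S) => D.exists_nat_coroot hγ hβ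
  have hc : (γ : LieModule.Weight k H L) t = (∑ β ∈ S, n β : ℕ) := by
    rw [hsum, Finset.sum_congr rfl fun β hβ => hn β hβ]
    push_cast
    rfl
  refine ⟨∑ β ∈ S, n β, ?_, ?_, hc⟩
  · obtain ⟨β, hβ, hne⟩ := D.exists_coroot_ne_zero hγ
    rw [hn β hβ] at hne
    exact Finset.sum_pos' (fun _ _ => Nat.zero_le _)
      ⟨β, hβ, Nat.pos_of_ne_zero fun h0 => hne (by rw [h0, Nat.cast_zero])⟩
  · by_contra! hlt
    obtain ⟨x, hx, hx0⟩ := exists_mem_rootSpace_ne_zero γ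
    have hxN : x ∈ nilradical b j := mem_rootSum (p := fun m => 0 < m) hγ hx
    have hlie := lie_eq_smul_of_mem_rootSpace hx t
    rw [LieSubalgebra.coe_bracket_of_module, ht, hc] at hlie
    have hprim : IsSl2Triple.HasPrimitiveVectorWith (D.isSl2Triple hf hh he) x
        ((∑ β ∈ S, n β : ℕ) : k) :=
      ⟨hx0, hlie, D.comm _ (D.sum_mem_nilradical he) x hxN⟩
    refine hprim.pow_toEnd_f_ne_zero_of_eq_nat (i := 3) rfl hlt ?_
    obtain ⟨ζ, hζ⟩ := exists_gradingElement b j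
    have G := threeGrading D.comm hζ
    have hfB := D.sum_mem_oppNilradical hf
    change ⁅f, ⁅f, ⁅f, x⁆⁆⁆ = 0
    refine G.lie_B_B hfB ?_
    rw [← lie_skew]
    exact neg_mem (G.lie_M_B (G.lie_B_N hfB hxN) hfB)

include hf hh he in
theorem lie_lie_eq_smul {t : H} (ht : (t : L) = h) {γ : H.root} (hγ : 0 < simpleCoeff b j γ)
    {x : L} (hx : x ∈ rootSpace H (γ : LieModule.Weight k H L)) :
    ⁅e, ⁅f, x⁆⁆ = (γ : LieModule.Weight k H L) t • x := by
  rw [leibniz_lie, (D.isSl2Triple hf hh he).lie_e_f,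
    D.comm _ (D.sum_mem_nilradical he) x (mem_rootSum (p := fun m => 0 < m) hγ hx), lie_zero,
    add_zero, ← ht]
  exact lie_eq_smul_of_mem_rootSpace hx t

include hf hh he in
theorem exists_lie_eq {x : L} (hx : x ∈ nilradical b j) : ∃ z ∈ levi b j, ⁅z, e⁆ = x := by
  obtain ⟨t, ht, -⟩ := D.exists_coe_eq hh
  obtain ⟨ζ, hζ⟩ := exists_gradingElement b j
  have G := threeGrading D.comm hζ
  refine rootSum_induction (P := fun x => ∃ z ∈ levi b j, ⁅z, e⁆ = x) (fun γ hγ x hx => ?_)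
    ⟨0, zero_mem _, zero_lie _⟩ ?_ hx
  · obtain ⟨c, hc, -, hγt⟩ := D.exists_weight hf hh he ht hγ
    have hfx : ⁅f, x⁆ ∈ levi b j :=
      G.lie_B_N (D.sum_mem_oppNilradical hf) (mem_rootSum (p := fun m => 0 < m) hγ hx)
    refine ⟨-(c : k)⁻¹ • ⁅f, x⁆, Submodule.smul_mem _ _ hfx, ?_⟩
    rw [smul_lie, neg_smul, ← smul_neg, lie_skew, D.lie_lie_eq_smul hf hh he ht hγ hx, hγt,
      smul_smul, inv_mul_cancel₀ (by exact_mod_cast hc.ne'), one_smul]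
  · rintro x y ⟨z, hz, rfl⟩ ⟨z', hz', rfl⟩
    exact ⟨z + z', add_mem hz hz', add_lie _ _ _⟩

include hf hh he in
/-- If the parabolic subalgebra is conjugate to its opposite, then `h` acts on `𝔫` by `2`: its
weights are at most `2`, and on average at least `2`. -/
theorem weight_eq_two (hopp : IsSelfOpposite b j) {t : H} (ht : (t : L) = h) {γ : H.root}
    (hγ : 0 < simpleCoeff b j γ) : (γ : LieModule.Weight k H L) t = 2 := by
  classical
  obtain ⟨ζ, hζ⟩ := exists_gradingElement b j
  have G := threeGrading D.comm hζ
  obtain ⟨v, hv⟩ := exists_basis_nilradical b j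
  choose c hc hc2 hct using fun γ : {γ : H.root // 0 < simpleCoeff b j γ} =>
    D.exists_weight hf hh he ht γ.2
  obtain ⟨g, hg, hgp⟩ := hopp
  have heN := D.sum_mem_nilradical he
  have hfB := D.sum_mem_oppNilradical hf
  have hsl := D.isSl2Triple hf hh he
  have key := two_mul_card_le_sum hsl heN hfB (hsl.lie_e_f ▸ G.lie_N_B heN hfB) G.sup_eq_top
    G.lie_N G.lie_M G.lie_B (fun x hx y hy => G.lie_N_N hx hy) (fun x hx y hy => G.lie_B_B hx hy)
    (fun x hx y hy => G.lie_B_N hx hy) (fun x hx y hy => G.lie_M_N hx hy)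
    (fun x hx y hy => G.lie_M_B hx hy) (fun x hx y hy => G.lie_M_M hx hy)
    (fun x hx => D.exists_lie_eq hf hh he hx) v c (fun γ => by
      have := lie_eq_smul_of_mem_rootSpace (hv γ) t
      rwa [LieSubalgebra.coe_bracket_of_module, ht, hct] at this) _
    (fun g hg => by
      obtain ⟨α, x, -, n, hn, hx⟩ := hg
      exact ⟨x, n, hn, hx⟩) g hg fun x hx => by
      have : g x ∈ (parabolic b j).map (g : L →ₗ[k] L) := ⟨x, hx, rfl⟩
      rwa [hgp] at this
  have hle : ∑ γ, c γ ≤ ∑ _γ : {γ : H.root // 0 < simpleCoeff b j γ}, 2 :=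
    Finset.sum_le_sum fun γ _ => hc2 γ
  have heq := (Finset.sum_eq_sum_iff_of_le fun γ _ => hc2 γ).1 (hle.antisymm (by
    rw [Finset.sum_const, Finset.card_univ, smul_eq_mul, mul_comm]
    exact key)) ⟨γ, hγ⟩ (Finset.mem_univ _)
  rw [hct ⟨γ, hγ⟩, heq]
  rfl

include hf hh he in
/-- The decomposition `𝔤 = 𝔫 ⊕ 𝔪 ⊕ 𝔫̄` is a tube grading: `h - 2ζ` kills `𝔫` and `𝔫̄`, so that it is
central. -/
theorem tubeGrading (hopp : IsSelfOpposite b j) :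
    TubeGrading k f h e (nilradical b j) (levi b j) (oppNilradical b j) := by
  obtain ⟨ζ, hζ⟩ := exists_gradingElement b j
  have G := threeGrading D.comm hζ
  obtain ⟨t, ht, -⟩ := D.exists_coe_eq hh
  have heN := D.sum_mem_nilradical he
  have hfB := D.sum_mem_oppNilradical hf
  have hsl := D.isSl2Triple hf hh he
  have hN0 : nilradical b j ≠ ⊥ := fun h0 => hsl.e_ne_zero (by simpa [h0] using heN)
  have hN : ∀ x ∈ nilradical b j, ⁅h, x⁆ = (2 : k) • x := by
    intro x hx
    refine rootSum_induction (P := fun x => ⁅h, x⁆ = (2 : k) • x) (fun γ hγ x hx => ?_) (by simp)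
      (fun x y h h' => by rw [lie_add, h, h', smul_add]) hx
    have := lie_eq_smul_of_mem_rootSpace hx t
    rwa [LieSubalgebra.coe_bracket_of_module, ht, D.weight_eq_two hf hh he hopp ht hγ] at this
  have hB : ∀ x ∈ oppNilradical b j, ⁅h, x⁆ = -((2 : k) • x) := by
    intro x hx
    refine rootSum_induction (P := fun x => ⁅h, x⁆ = -((2 : k) • x)) (fun γ hγ x hx => ?_)
      (by simp) (fun x y h h' => by rw [lie_add, h, h', smul_add, neg_add]) hx
    obtain ⟨α, hα⟩ := exists_neg_root γ
    have hαpos : 0 < simpleCoeff b j α := by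
      rw [simpleCoeff_neg (α := γ) (fun x => congrFun hα x)]
      omega
    have hγt : (γ : LieModule.Weight k H L) t = -2 := by
      rw [← D.weight_eq_two hf hh he hopp ht hαpos, hα, Pi.neg_apply, neg_neg]
    have := lie_eq_smul_of_mem_rootSpace hx t
    rwa [LieSubalgebra.coe_bracket_of_module, ht, hγt, neg_smul] at this
  have hζh : h = (2 : k) • (ζ : L) := by
    rw [← sub_eq_zero]
    refine G.eq_zero_of_lie_eq_zero hN0 (fun x hx => ?_) fun x hx => ?_
    · rw [sub_lie, hN x hx, smul_lie, G.lie_N x hx, sub_self]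
    · rw [sub_lie, hB x hx, smul_lie, G.lie_B x hx, smul_neg, sub_self]
  exact
    { lie_e_f := hsl.lie_e_f
      mem_e := heN
      mem_f := hfB
      lie_h_N := hN
      lie_h_M := fun x hx => by rw [hζh, smul_lie, G.lie_M x hx, smul_zero]
      lie_h_B := hB
      sup_eq_top := G.sup_eq_top
      lie_N_N := fun x hx y hy => G.lie_N_N hx hy
      lie_B_B := fun x hx y hy => G.lie_B_B hx hy
      lie_N_B := fun x hx y hy => G.lie_N_B hx hy
      lie_M_N := fun x hx y hy => G.lie_M_N hx hy
      lie_M_B := fun x hx y hy => G.lie_M_B hx hy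
      lie_M_M := fun x hx y hy => G.lie_M_M hx hy
      M_le_span := G.M_le_span hN0
      faithful := fun z hz h1 => G.faithful hN0 hz h1 }

end TripleData

end Tube

end KKT

theorem mainTheorem8 {k : Type u} {L : Type v} [Field k] [CharZero k] [LieRing L]
    [LieAlgebra k L] [FiniteDimensional k L] [LieAlgebra.IsSimple k L]
    (H : LieSubalgebra k L) [H.IsCartanSubalgebra] [LieModule.IsTriangularizable k H L]
    (b : (LieAlgebra.IsKilling.rootSystem H).Base) (j : b.support)
    (hab : ∀ x ∈ KKT.nilradical b j, ∀ y ∈ KKT.nilradical b j, ⁅x, y⁆ = 0)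
    (hopp : KKT.IsSelfOpposite b j)
    (S : Finset H.root) (hS : KKT.IsMaximalStronglyOrthogonal b j S)
    (fs hs es : H.root → L)
    (hes : ∀ α ∈ S, es α ∈ LieAlgebra.rootSpace H (α : LieModule.Weight k H L))
    (hfs : ∀ α ∈ S, fs α ∈ LieAlgebra.rootSpace H (-(α : LieModule.Weight k H L)))
    (hsl : ∀ α ∈ S, IsSl2Triple (hs α) (es α) (fs α))
    (f h e : L) (hf : f = ∑ α ∈ S, fs α) (hh : h = ∑ α ∈ S, hs α) (he : e = ∑ α ∈ S, es α) :
    IsSl2Triple h e f ∧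
    ∃ mul : KKT.nilradical b j →ₗ[k] KKT.nilradical b j →ₗ[k] KKT.nilradical b j,
      KKT.IsJordanMul (KKT.nilradical b j) f e mul ∧
      -- the isomorphism on `k`-points
      (∃ ι : KKT.tripleCentralizer k f h e ≃* KKT.algAut mul,
        ∀ c x, ((ι c).1 x : L) = c.1 x) ∧
      -- the isomorphism of group functors
      ∃ ι : KKT.RestrictionIso.{u, v, w} mul f h e,
        -- the construction of forms, for every Galois extension `K` of `k`
        ∀ (K : Type w) [Field K] [Algebra k K] [IsGalois k K],
          (∀ c : (K ≃ₐ[k] K) → KKT.autPoints mul K,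
            KKT.IsCocycle (fun σ => (c σ).1) →
              KKT.IsCocycle (fun σ => (ι.toLieAut K (c σ)).1) ∧
              KKT.IsKKTForm mul f h e (KKT.twistedForm (fun σ => (c σ).1))
                (KKT.twistedLieForm (fun σ => ι.toLieAut K (c σ)))) ∧
          -- cohomologous cocycles give cohomologous cocycles and isomorphic forms
          (∀ (c c' : (K ≃ₐ[k] K) → KKT.autPoints mul K) (a : KKT.autPoints mul K),
            KKT.IsCocycle (fun σ => (c σ).1) → KKT.IsCocycle (fun σ => (c' σ).1) →
            KKT.IsCoboundaryBetween (fun σ => (c σ).1) (fun σ => (c' σ).1) a.1 →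
              KKT.IsCoboundaryBetween (fun σ => (ι.toLieAut K (c σ)).1)
                (fun σ => (ι.toLieAut K (c' σ)).1) (ι.toLieAut K a).1 ∧
              (KKT.twistedForm (fun σ => (c' σ).1)).map
                  ((a.1 : _ →ₗ[K] _).restrictScalars k) =
                KKT.twistedForm (fun σ => (c σ).1) ∧
              ∃ θ : KKT.twistedLieForm (fun σ => ι.toLieAut K (c' σ)) ≃ₗ⁅k⁆
                  KKT.twistedLieForm (fun σ => ι.toLieAut K (c σ)),
                ∀ x, (θ x : K ⊗[k] L) = (ι.toLieAut K a).1 x) := by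
  have D : KKT.TripleData b j S fs hs es := ⟨hab, hS, hes, hfs, hsl⟩
  have T := D.tubeGrading hf hh he hopp
  obtain ⟨mul, hmul⟩ := T.exists_isJordanMul
  have hpoints := T.exists_mulEquiv (IsUnit.mk0 2 two_ne_zero) (KKT.nilradical b j).range_subtype
    (KKT.nilradical b j).injective_subtype (mul := mul) fun x y => by
      change (2 : k) • (mul x y : L) = _
      rw [hmul.coe_mul, smul_inv_smul₀ two_ne_zero]
      rfl
  refine ⟨D.isSl2Triple hf hh he, mul, hmul, hpoints, T.restrictionIso hmul, fun K _ _ _ => ?_⟩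
  refine ⟨fun c hc => ⟨KKT.RestrictionIso.isCocycle_toLieAut _ T hc,
    KKT.isKKTForm _ T hmul hc⟩, fun c c' a _ _ ha => ?_⟩
  have ha' := KKT.RestrictionIso.isCoboundaryBetween_toLieAut (T.restrictionIso hmul) T ha
  exact ⟨ha', ha.map_twistedForm, ha'.exists_lieEquiv⟩
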